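/- **Conventions.** Let $0<a\le\infty$ and $I_a=[-a,a]$ ($I_\infty=\mathbb R$). A function $f:\mathbb R\to\mathbb C$ is *complex analytic in $I_a$* if it agrees on $I_a$ with a function of a complex variable that is analytic at every point of $I_a$. Let $\rho_0\in(0,\infty]$ be the distance from the origin to the nearest singularity of the complex extension of $f$, i.e. the supremum of the radii of the discs about $0$ to which $f$ extends analytically ($\rho_0=\infty$ if $f$ is entire). For finite $a$, $\mathrm{PV}\!\int_{-a}^a h$ is the Cauchy principal value at $x=\omega$, and the finite part $\mathrm{FP}\!\int_0^a h(x)\,dx$ is $\lim_{\varepsilon\to0^+}C_\varepsilon$, where $\int_\varepsilon^a h=C_\varepsilon+D_\varepsilon$ with $C_\varepsilon$ convergent and $D_\varepsilon$ a linear combination of powers $\varepsilon^{-p}$ $(p>0)$ and $\ln\varepsilon$. For $a=\infty$, $\mathrm{PV}\!\int_{-\infty}^\infty$, $\mathrm{FP}\!\int_0^\infty$ and $\int_0^\infty$ denote the limits as $A\to\infty$ of $\mathrm{PV}\!\int_{-A}^A$, $\mathrm{FP}\!\int_0^A$ and $\int_0^A$. **Theorem.** Let $0<\nu<1$ and let $f$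 be complex analytic in $I_a$. If $a=\infty$, assume also that the principal value $\mathrm{PV}\!\int_{-\infty}^{\infty}\frac{f(x)}{|x|^\nu(\omega-x)}dx$ exists for every real $\omega$ with $|\omega|<\rho_0$. Then for every real $\omega$ with $|\omega|<a$ and $|\omega|<\rho_0$ (so for all real $\omega$ if $a=\infty$ and $f$ is entire), all integrals, finite parts and principal values below exist, the series converge, and the following hold, where $\operatorname{sgn}(\omega)f(\omega)|\omega|^{-\nu}$ is read as $0$ at $\omega=0$. 1. $$\mathrm{PV}\!\int_{-a}^a\frac{f(x)}{|x|^\nu(\omega-x)}dx=\sum_{k=0}^\infty\omega^k\,\mathrm{FP}\!\int_0^a\frac{(-1)^kf(-x)-f(x)}{x^{k+\nu+1}}dx+\pi\tan\!\Big(\frac{\pi\nu}2\Big)\operatorname{sgn}(\omega)\frac{f(\omega)}{|\omega|^\nu}.$$ 2. If $f$ is even on $I_a$, then $$\mathrm{PV}\!\int_{-a}^a\frac{f(x)}{|x|^\nu(\omega-x)}dx=-2\sum_{k=0}^\infty\omega^{2k+1}\,\mathrm{FP}\!\int_0^a\frac{f(x)}{x^{2k+\nu+2}}dx+\pi\tan\!\Big(\frac{\pi\nu}2\Big)\operatorname{sgn}(\omega)\frac{f(\omega)}{|\omega|^\nu}.$$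 3. If $f(x)=x^mg(x)$ on $I_a$ with an integer $m\ge1$ and $g$ complex analytic in $I_a$, then $$\mathrm{PV}\!\int_{-a}^a\frac{f(x)}{|x|^\nu(\omega-x)}dx=\sum_{k=0}^{m-1}\omega^k\int_0^a\frac{(-1)^{k+m}g(-x)-g(x)}{x^{k-m+\nu+1}}dx+\sum_{k=0}^\infty\omega^{k+m}\,\mathrm{FP}\!\int_0^a\frac{(-1)^kg(-x)-g(x)}{x^{k+\nu+1}}dx+\pi\tan\!\Big(\frac{\pi\nu}2\Big)\operatorname{sgn}(\omega)\frac{\omega^mg(\omega)}{|\omega|^\nu}.$$ 4. If moreover $g$ is even on $I_a$, then $$\mathrm{PV}\!\int_{-a}^a\frac{f(x)}{|x|^\nu(\omega-x)}dx=-2\sum_{k=0}^{\lfloor (m-1)/2\rfloor}\omega^{2k+1+2\lfloor m/2\rfloor-m}\int_0^a\frac{g(x)}{x^{2k-2\lfloor (m-1)/2\rfloor+\nu}}dx-2\sum_{k=0}^\infty\omega^{2k+m+1}\,\mathrm{FP}\!\int_0^a\frac{g(x)}{x^{2k+\nu+2}}dx+\pi\tan\!\Big(\frac{\pi\nu}2\Big)\operatorname{sgn}(\omega)\frac{\omega^mg(\omega)}{|\omega|^\nu}.$$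 In each case the finite parts and integrals do not depend on $\omega$, and the series converge absolutely. -/

import Mathlib

open Filter Topology MeasureTheory
open scoped ENNReal

/-- The symmetric interval `[-a, a]`; it is the whole real line when `a = ∞`. -/
def symmInterval (a : ℝ≥0∞) : Set ℝ := {x | ‖x‖ₑ ≤ a}

/-- `f` is complex analytic in the set `s` of reals: it is the restriction to `s` of a function of a
complex variable that is analytic at (that is, in a complex neighbourhood of) every point of `s`. -/
def ComplexAnalyticOn (f : ℝ → ℂ) (s : Set ℝ) : Prop :=
  ∃ F : ℂ → ℂ, AnalyticOnNhd ℂ F ((fun x : ℝ => (x : ℂ)) '' s) ∧ ∀ x ∈ s, F x = f x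

/-- The distance from the origin to the nearest singularity of the complex extension of `f`: the
supremum of the radii of the open discs about `0` to which `f` extends analytically. It is `∞` when
`f` extends to an entire function. -/
noncomputable def singularityDistance (f : ℝ → ℂ) : ℝ≥0∞ :=
  sSup {r | ∃ F : ℂ → ℂ, AnalyticOnNhd ℂ F {z | ‖z‖ₑ < r} ∧ ∀ᶠ x : ℝ in 𝓝 0, F x = f x}

/-- The Cauchy principal value at `ω` of `∫_{-A}^{A} h`, for a finite `A`, exists and equals `L`. -/
def HasPVOn (h : ℝ → ℂ) (ω A : ℝ) (L : ℂ) : Prop :=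
  (∀ ε > 0, IntegrableOn h (Set.Icc (-A) A \ Set.Ioo (ω - ε) (ω + ε))) ∧
  Tendsto (fun ε : ℝ => ∫ x in Set.Icc (-A) A \ Set.Ioo (ω - ε) (ω + ε), h x) (𝓝[>] 0) (𝓝 L)

/-- The principal value at `ω` of `∫_{-a}^{a} h`, `0 < a ≤ ∞`, exists and equals `L`. For `a = ∞` it
is the limit of the principal values over `[-A, A]` as `A → ∞`. -/
def HasPVIntegral (h : ℝ → ℂ) (ω : ℝ) (a : ℝ≥0∞) (L : ℂ) : Prop :=
  (a ≠ ∞ → HasPVOn h ω a.toReal L) ∧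
  (a = ∞ → ∃ P : ℝ → ℂ, (∀ᶠ A in atTop, HasPVOn h ω A (P A)) ∧ Tendsto P atTop (𝓝 L))

/-- The finite part of `∫_0^A h`, for a finite `A`, exists and equals `L`: one has
`∫_ε^A h = C_ε + D_ε`, where `D_ε` is a linear combination of powers `ε ^ (-p)` with `p > 0` and of
`log ε`, and `C_ε → L` as `ε → 0+`. -/
def HasFinitePartOn (h : ℝ → ℂ) (A : ℝ) (L : ℂ) : Prop :=
  (∀ ε > 0, IntegrableOn h (Set.Ioc ε A)) ∧
  ∃ (s : Finset ℝ) (b : ℝ → ℂ) (d : ℂ), (∀ p ∈ s, 0 < p) ∧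
    Tendsto (fun ε : ℝ => (∫ x in Set.Ioc ε A, h x) -
        ((∑ p ∈ s, b p * ((ε ^ (-p) : ℝ) : ℂ)) + d * ((Real.log ε : ℝ) : ℂ)))
      (𝓝[>] 0) (𝓝 L)

/-- The finite part of `∫_0^a h`, `0 < a ≤ ∞`, exists and equals `L`. For `a = ∞` it is the limit of
the finite parts of `∫_0^A h` as `A → ∞`. -/
def HasFinitePart (h : ℝ → ℂ) (a : ℝ≥0∞) (L : ℂ) : Prop :=
  (a ≠ ∞ → HasFinitePartOn h a.toReal L) ∧
  (a = ∞ → ∃ P : ℝ → ℂ, (∀ A > 0, HasFinitePartOn h A (P A)) ∧ Tendsto P atTop (𝓝 L))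

/-- The integral `∫_0^a h`, `0 < a ≤ ∞`, converges and equals `L`. For `a = ∞` it is the improper
integral, the limit of `∫_0^A h` as `A → ∞`. -/
def HasConvergentIntegral (h : ℝ → ℂ) (a : ℝ≥0∞) (L : ℂ) : Prop :=
  (a ≠ ∞ → IntegrableOn h (Set.Ioc 0 a.toReal) ∧ ∫ x in Set.Ioc 0 a.toReal, h x = L) ∧
  (a = ∞ → (∀ A > 0, IntegrableOn h (Set.Ioc 0 A)) ∧
    Tendsto (fun A : ℝ => ∫ x in Set.Ioc 0 A, h x) atTop (𝓝 L))

/-- The integrand `f(x) / (|x|^ν (ω - x))`. -/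
noncomputable def hilbertIntegrand (ν : ℝ) (f : ℝ → ℂ) (ω x : ℝ) : ℂ :=
  f x / ((|x| ^ ν * (ω - x) : ℝ) : ℂ)

/-- The singular contribution `π tan(πν/2) sgn(ω) f(ω) / |ω|^ν`; its value at `ω = 0` is `0`. -/
noncomputable def singularTerm (ν : ℝ) (f : ℝ → ℂ) (ω : ℝ) : ℂ :=
  ((Real.pi * Real.tan (Real.pi * ν / 2) * Real.sign ω : ℝ) : ℂ) * (f ω / ((|ω| ^ ν : ℝ) : ℂ))

/-! Fix `R` with `|ω| < R < min(a, ρ₀)`. On `[-R, R]` the function is the sum of its Taylor series,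
so `f(x) = f(ω) + Q(x)(x - ω)` with `Q` continuous, and the principal value over `[-R, R]` is `f(ω)`
times that of the bare kernel `|x|^(-ν)/(ω - x)`, minus the ordinary integral of `Q(x)|x|^(-ν)`. The
kernel is computed exactly. Scaling reduces it to `ω = 1`; the folds `x ↦ -x` and `x ↦ 1/x` then
split it into `∫_0^1 2(u^(-ν) - u^ν)/(1 - u²) du`, which is `π tan(πν/2)` by the partial fractions
of the tangent, and an integral of `2u^ν/(1 - u²)` near `0`, which is a power series in `ω`
(`tendsto_integral_kernel_one`, `exists_intervalPV_hilbertKernel`). The first piece is the singular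
term, the one that a formal expansion of `1/(ω - x)` in powers of `ω/x` misses. Divided differences
carry the result from `1` to `x^j`, and an absolutely convergent double series carries it to `f`
(`exists_intervalPV_of_hasSum`).

On `R ≤ |x| ≤ A` the geometric series in `ω/x` may be integrated termwise (`hasSum_integral_tails`).
The two contributions to the coefficient of `ω^k` add up to the finite part over `(0, A)`. In
`HasTaylorFinitePart` the divergent part is prescribed by the Taylor coefficients, so the value is a
limit, hence unique, hence independent of `R`; one sequence of coefficients therefore serves every
`ω`.

For `a = ∞` the limit `A → ∞` has to pass through the series although the integrals may converge
only conditionally. Let `g_k` be the `k`-th coefficient integrand. The folded integrand is `(1 -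
ω²/x²)⁻¹ (g_0 + ω g_1)`, and `g_(2n+i) = x^(-2n) g_i`. The principal values at the two points `0`
and `R/2`, with Abel's test, give convergence of the tail integrals of `g_0` and `g_1`. The
decreasing weights `x^(-2n)` then give convergence for every `k` and a bound `M R^(-k)` uniform in
`A` (`exists_tendsto_integral_coeffIntegrand`), and dominated convergence finishes
(`exists_coeff_top`).

The other three formulas are read off from the first: parity makes every second coefficient vanish,
and a factor `x^m` removes the divergent terms from the first `m` finite parts, which become
ordinary integrals. -/

/-! ### The tangent series -/

/-- The partial fraction expansion of the tangent, with the terms grouped by poles. -/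
theorem hasSum_pi_mul_tan {ν : ℝ} (h0 : 0 < ν) (h1 : ν < 1) :
    HasSum (fun k : ℕ => 2 / (2 * (k : ℝ) + 1 - ν) - 2 / (2 * (k : ℝ) + 1 + ν))
      (Real.pi * Real.tan (Real.pi * ν / 2)) := by
  -- With this `x`, `π tan(πν/2) = π cot(πx)`, and the poles of the tangent series are those of the
  -- Mittag-Leffler series of the cotangent.
  set x : ℝ := (1 - ν) / 2 with hx
  have hx0 : 0 < x := by rw [hx]; linarith
  have hx1 : x < 1 := by rw [hx]; linarith
  have hxc : (x : ℂ) ∈ Complex.integerComplement := by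
    rintro ⟨n, hn⟩
    have hn' : (n : ℝ) = x := by exact_mod_cast hn
    have a1 : (0 : ℝ) < n := by linarith
    have a2 : (n : ℝ) < 1 := by linarith
    norm_cast at a1 a2
    omega
  have hs := (summable_cotTerm hxc).hasSum
  simp only [cotTerm] at hs
  rw [← cot_series_rep' hxc] at hs
  have hcot : (Real.pi : ℂ) * Complex.cot (Real.pi * x) =
      ((Real.pi * Real.tan (Real.pi * ν / 2) : ℝ) : ℂ) := by
    have h2 : Real.pi * ν / 2 = Real.pi / 2 - Real.pi * x := by rw [hx]; ring
    rw [h2, Real.tan_pi_div_two_sub, ← Real.cot_inv_eq_tan, inv_inv]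
    push_cast [Complex.ofReal_cot]
    rfl
  rw [hcot] at hs
  have hs' : HasSum (fun n : ℕ => 1 / (x - (n + 1)) + 1 / (x + (n + 1)))
      (Real.pi * Real.tan (Real.pi * ν / 2) - 1 / x) := by
    rw [← Complex.hasSum_ofReal]
    convert hs using 1
    · ext n; push_cast; rfl
    · push_cast; rfl
  rw [hasSum_iff_tendsto_nat_of_nonneg]
  -- The cotangent series pairs `1/(x - (n+1))` with `1/(x + (n+1))`; here it is paired with `1/(x +
  -- n)`. The partial sums differ by `1/x - 1/(x + N)`.
  · have ht : Tendsto (fun N : ℕ => 1 / (x + N)) atTop (𝓝 0) := by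
      simp only [one_div]
      exact tendsto_inv_atTop_zero.comp
        (tendsto_atTop_add_const_left _ _ tendsto_natCast_atTop_atTop)
    have := (hs'.tendsto_sum_nat.add_const (1 / x)).sub ht
    rw [sub_add_cancel, sub_zero] at this
    refine this.congr fun N => ?_
    induction N with
    | zero => simp
    | succ N ih =>
      rw [Finset.sum_range_succ, Finset.sum_range_succ, ← ih]
      have hN : (0 : ℝ) ≤ N := N.cast_nonneg
      have e1 : 2 / (2 * (N : ℝ) + 1 - ν) = 1 / (x + N) := by
        rw [div_eq_div_iff (by linarith) (by linarith), hx]; ring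
      have e2 : 2 / (2 * (N : ℝ) + 1 + ν) = -(1 / (x - (N + 1))) := by
        rw [← one_div_neg_eq_neg_one_div, div_eq_div_iff (by linarith) (by linarith), hx]; ring
      rw [e1, e2]
      push_cast
      ring
  · intro k
    have hk : (0 : ℝ) ≤ k := k.cast_nonneg
    rw [sub_nonneg]
    apply div_le_div_of_nonneg_left <;> linarith

/-! ### Taylor expansion on a real interval -/

/-- Analytic functions that agree on the reals near `0` agree near `0`. -/
theorem eventuallyEq_of_eventuallyEq_ofReal {F G : ℂ → ℂ} (hF : AnalyticAt ℂ F 0)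
    (hG : AnalyticAt ℂ G 0) (h : ∀ᶠ x : ℝ in 𝓝 0, F x = G x) : F =ᶠ[𝓝 0] G := by
  refine (AnalyticAt.frequently_eq_iff_eventually_eq hF hG).1 ?_
  have ht : Tendsto (fun x : ℝ => (x : ℂ)) (𝓝[≠] 0) (𝓝[≠] 0) := by
    refine tendsto_nhdsWithin_iff.2 ⟨?_, ?_⟩
    · exact (Complex.continuous_ofReal.tendsto' 0 0 rfl).mono_left nhdsWithin_le_nhds
    · filter_upwards [self_mem_nhdsWithin] with x hx
      simpa using hx
  exact ht.frequently (h.filter_mono nhdsWithin_le_nhds).frequently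

theorem symmInterval_mem_nhds_zero {a : ℝ≥0∞} (ha : 0 < a) : symmInterval a ∈ 𝓝 (0 : ℝ) := by
  have h : Tendsto (fun x : ℝ => ‖x‖ₑ) (𝓝 0) (𝓝 0) := continuous_enorm.tendsto' 0 0 (by simp)
  exact (h.eventually (gt_mem_nhds ha)).mono fun x hx => le_of_lt hx

theorem singularityDistance_pos {f : ℝ → ℂ} {a : ℝ≥0∞} (ha : 0 < a)
    (hf : ComplexAnalyticOn f (symmInterval a)) : 0 < singularityDistance f := by
  obtain ⟨F, hF, hFf⟩ := hf
  have hA : AnalyticAt ℂ F 0 := by simpa using hF _ ⟨0, by simp [symmInterval], rfl⟩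
  obtain ⟨r, hr, hball⟩ := Metric.eventually_nhds_iff_ball.1 hA.eventually_analyticAt
  refine lt_of_lt_of_le (ENNReal.ofReal_pos.2 hr) (le_sSup ⟨F, fun z hz => hball z ?_, ?_⟩)
  · have hz' : ‖z‖ₑ < ENNReal.ofReal r := hz
    rw [← ofReal_norm, ENNReal.ofReal_lt_ofReal_iff hr] at hz'
    simpa using hz'
  · filter_upwards [symmInterval_mem_nhds_zero ha] with x hx using hFf x hx

theorem ComplexAnalyticOn.continuousOn {f : ℝ → ℂ} {s : Set ℝ} (hf : ComplexAnalyticOn f s) :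
    ContinuousOn f s := by
  obtain ⟨F, hF, hFf⟩ := hf
  have h : ContinuousOn (fun x : ℝ => F x) s := fun x hx =>
    ((hF x ⟨x, hx, rfl⟩).continuousAt.comp
      Complex.continuous_ofReal.continuousAt).continuousWithinAt
  exact h.congr fun x hx => (hFf x hx).symm

/-- The Taylor coefficients at `0` of a complex analytic function sum to it on every closed
interval that lies inside both the interval of analyticity and the disc of analyticity;
those of index less than `m` vanish when `x^m` can be factored out, and those of the wrong parity
vanish when the function has a parity. -/
theorem exists_taylor_coeff {f : ℝ → ℂ} {a : ℝ≥0∞} (ha : 0 < a)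
    (hf : ComplexAnalyticOn f (symmInterval a)) :
    ∃ al : ℕ → ℂ,
      (∀ R : ℝ, 0 < R → ENNReal.ofReal R < a → ENNReal.ofReal R < singularityDistance f →
        Summable (fun j => ‖al j‖ * R ^ j) ∧
          ∀ x : ℝ, |x| ≤ R → HasSum (fun j => al j * (x : ℂ) ^ j) (f x)) ∧
      (∀ (m : ℕ) (g : ℝ → ℂ), ComplexAnalyticOn g (symmInterval a) →
        (∀ x ∈ symmInterval a, f x = (x : ℂ) ^ m * g x) → ∀ j < m, al j = 0) ∧
      ∀ m : ℕ, (∀ x ∈ symmInterval a, f (-x) = (-1) ^ m * f x) →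
        ∀ j, Odd (j + m) → al j = 0 := by
  obtain ⟨F₀, hF₀, hF₀f⟩ := hf
  have h0mem : (0 : ℝ) ∈ symmInterval a := by simp [symmInterval]
  have hA0 : AnalyticAt ℂ F₀ 0 := by simpa using hF₀ _ ⟨0, h0mem, rfl⟩
  have hp := hA0.hasFPowerSeriesAt
  -- The coefficients come from the extension `F₀` of `f` at `0`, so they are fixed before any
  -- radius is chosen.
  set p := FormalMultilinearSeries.ofScalars ℂ fun n => iteratedDeriv n F₀ 0 / (n.factorial : ℂ)
  refine ⟨p.coeff, fun R hR hRa hRs => ?_, fun m g hg hfg j hj => ?_,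
    fun m hfm j hj => ?_⟩
  rotate_left
  · obtain ⟨G₀, hG₀, hG₀g⟩ := hg
    have hB0 : AnalyticAt ℂ G₀ 0 := by simpa using hG₀ _ ⟨0, h0mem, rfl⟩
    have hev : ∀ᶠ x : ℝ in 𝓝 0, F₀ x = (x : ℂ) ^ m * G₀ x := by
      filter_upwards [symmInterval_mem_nhds_zero ha] with x hx
      rw [hF₀f x hx, hG₀g x hx, hfg x hx]
    have hFG : F₀ =ᶠ[𝓝 0] fun z => z ^ m * G₀ z :=
      eventuallyEq_of_eventuallyEq_ofReal hA0 (by fun_prop) hev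
    have hord := (natCast_le_analyticOrderAt hA0 (n := m)).2
      ⟨G₀, hB0, by simpa [Filter.EventuallyEq] using hFG⟩
    have hz := (natCast_le_analyticOrderAt_iff_iteratedDeriv_eq_zero hA0).1 hord j hj
    simp [p, FormalMultilinearSeries.coeff_ofScalars, hz]
  · have hev : ∀ᶠ x : ℝ in 𝓝 0, F₀ (-x) = (-1) ^ m * F₀ x := by
      have hneg : Tendsto (fun x : ℝ => -x) (𝓝 0) (𝓝 0) := continuous_neg.tendsto' 0 0 neg_zero
      filter_upwards [symmInterval_mem_nhds_zero ha,
        hneg.eventually (symmInterval_mem_nhds_zero ha)] with x hx hx'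
      rw [hF₀f x hx, ← hfm x hx, ← hF₀f _ hx', Complex.ofReal_neg]
    have hFF : (fun z => F₀ (-z)) =ᶠ[𝓝 0] fun z => (-1) ^ m * F₀ z := by
      refine eventuallyEq_of_eventuallyEq_ofReal ?_ (by fun_prop) hev
      exact AnalyticAt.fun_comp (by simpa using hA0) (by fun_prop)
    have hd := hFF.iteratedDeriv_eq j
    rw [iteratedDeriv_comp_neg, iteratedDeriv_const_mul_field, neg_zero, smul_eq_mul] at hd
    have hz : iteratedDeriv j F₀ 0 = 0 := by
      have h2 : (-1 : ℂ) ^ j * (-1) ^ m = -1 := by rw [← pow_add, hj.neg_one_pow]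
      have h3 : (-1 : ℂ) ^ j * (-1) ^ j = 1 := by rw [← mul_pow]; simp
      have h4 : iteratedDeriv j F₀ 0 = -iteratedDeriv j F₀ 0 := by
        linear_combination (-1 : ℂ) ^ j * hd - iteratedDeriv j F₀ 0 * h3 +
          iteratedDeriv j F₀ 0 * h2
      exact self_eq_neg.1 h4
    simp [p, FormalMultilinearSeries.coeff_ofScalars, hz]
  obtain ⟨r, ⟨F, hF, hFf⟩, hRr⟩ := lt_sSup_iff.1 hRs
  -- The room between `R` and `r` gives a closed disc of radius `R'` for the Cauchy series, which
  -- then converges absolutely at the smaller radius `R`.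
  obtain ⟨R', hRR', hR'r⟩ := ENNReal.lt_iff_exists_nnreal_btwn.1 hRr
  have hR0' : (0 : ℝ≥0∞) < R' := lt_of_le_of_lt bot_le hRR'
  have hR'0 : 0 < R' := by exact_mod_cast hR0'
  have hRR'' : R < R' := by
    rw [ENNReal.ofReal, ENNReal.coe_lt_coe] at hRR'
    exact (Real.toNNReal_lt_iff_lt_coe hR.le).1 hRR'
  have hdiff : DifferentiableOn ℂ F (Metric.closedBall 0 R') := by
    intro z hz
    refine (hF z ?_).differentiableAt.differentiableWithinAt
    refine lt_of_le_of_lt ?_ hR'r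
    rw [mem_closedBall_zero_iff] at hz
    rw [← ofReal_norm, ENNReal.ofReal, ENNReal.coe_le_coe]
    exact Real.toNNReal_le_iff_le_coe.2 hz
  have hq := hdiff.hasFPowerSeriesOnBall hR'0
  have hmemI : ∀ x : ℝ, |x| ≤ R → x ∈ symmInterval a := by
    intro x hx
    refine le_of_lt (lt_of_le_of_lt ?_ hRa)
    rw [← ofReal_norm]
    exact ENNReal.ofReal_le_ofReal hx
  have hev : ∀ᶠ x : ℝ in 𝓝 0, F x = F₀ x := by
    filter_upwards [hFf, Metric.closedBall_mem_nhds (0 : ℝ) hR] with x hx hxR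
    rw [hx, hF₀f x (hmemI x (by simpa using hxR))]
  have hFF₀ : F =ᶠ[𝓝 0] F₀ := eventuallyEq_of_eventuallyEq_ofReal hq.analyticAt hA0 hev
  have hqp : cauchyPowerSeries F 0 R' = p :=
    HasFPowerSeriesAt.eq_formalMultilinearSeries (hq.hasFPowerSeriesAt.congr hFF₀) hp
  rw [hqp] at hq
  constructor
  · have := p.summable_norm_mul_pow (r := ⟨R, hR.le⟩)
      (lt_of_lt_of_le (ENNReal.coe_lt_coe.2 hRR'') hq.r_le)
    simp only [FormalMultilinearSeries.norm_apply_eq_norm_coef] at this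
    exact this
  · intro x hx
    -- `F` lives in a disc and `F₀` near the real interval; they are known to agree only near `0`.
    -- The identity theorem for real analytic functions on the connected segment `[-R, R]` spreads
    -- the agreement.
    have hUF : AnalyticOnNhd ℝ (fun x : ℝ => F x) (Set.Icc (-R) R) := by
      intro y hy
      have h1 : AnalyticAt ℂ F (y : ℂ) := by
        refine hF _ (lt_of_le_of_lt ?_ hRr)
        rw [← ofReal_norm, Complex.norm_real]
        exact ENNReal.ofReal_le_ofReal (abs_le.2 hy)
      exact h1.restrictScalars.comp (Complex.ofRealCLM.analyticAt y)
    have hUF₀ : AnalyticOnNhd ℝ (fun x : ℝ => F₀ x) (Set.Icc (-R) R) := by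
      intro y hy
      have h1 : AnalyticAt ℂ F₀ (y : ℂ) := hF₀ _ ⟨y, hmemI y (abs_le.2 hy), rfl⟩
      exact h1.restrictScalars.comp (Complex.ofRealCLM.analyticAt y)
    have heq := hUF.eqOn_of_preconnected_of_eventuallyEq hUF₀ isPreconnected_Icc
      (z₀ := 0) (by constructor <;> linarith) hev (abs_le.1 hx)
    have hs := hq.hasSum (y := (x : ℂ)) (by
      rw [Metric.mem_eball, edist_zero_right, ← ofReal_norm, Complex.norm_real]
      exact lt_of_le_of_lt (ENNReal.ofReal_le_ofReal hx) hRR')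
    have heq' : F x = f x := heq.trans (hF₀f x (hmemI x hx))
    rw [zero_add, heq'] at hs
    have hj : ∀ j, p.coeff j * (x : ℂ) ^ j = p j fun _ => (x : ℂ) := fun j => by
      rw [FormalMultilinearSeries.apply_eq_pow_smul_coeff, smul_eq_mul, mul_comm]
    simp only [hj]
    exact hs

/-! ### Principal value of the kernel at `ω = 1` -/

/-- The weight `|x|^(-ν)` is integrable on bounded intervals. -/
theorem intervalIntegrable_inv_abs_rpow {ν : ℝ} (h1 : ν < 1) (a b : ℝ) :
    IntervalIntegrable (fun x : ℝ => (|x| ^ ν)⁻¹) volume a b := by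
  have hpos : ∀ b : ℝ, 0 ≤ b → IntervalIntegrable (fun x : ℝ => (|x| ^ ν)⁻¹) volume 0 b := by
    intro b hb
    refine (intervalIntegral.intervalIntegrable_rpow' (r := -ν) (by linarith)).congr ?_
    intro x hx
    rw [Set.uIoc_of_le hb] at hx
    simp only
    rw [abs_of_pos hx.1, Real.rpow_neg hx.1.le]
  have hall : ∀ b : ℝ, IntervalIntegrable (fun x : ℝ => (|x| ^ ν)⁻¹) volume 0 b := by
    intro b
    rcases le_total 0 b with hb | hb
    · exact hpos b hb
    · refine (IntervalIntegrable.iff_comp_neg (by simp)).2 ?_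
      simpa using hpos (-b) (by linarith)
  exact (hall a).symm.trans (hall b)

theorem hasSum_geometric_div_one_sub_sq {u : ℝ} (hu0 : 0 < u) (hu1 : u < 1) (p : ℝ) :
    HasSum (fun k : ℕ => 2 * u ^ (2 * (k : ℝ) + p)) (u ^ p * (2 / (1 - u ^ 2))) := by
  have h := (hasSum_geometric_of_lt_one (sq_nonneg u) (by nlinarith : u ^ 2 < 1)).mul_left
    (2 * u ^ p)
  have hterm : ∀ k : ℕ, 2 * u ^ (2 * (k : ℝ) + p) = 2 * u ^ p * (u ^ 2) ^ k := by
    intro k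
    rw [Real.rpow_add hu0, ← pow_mul, ← Real.rpow_natCast u (2 * k)]
    push_cast
    ring
  have hval : u ^ p * (2 / (1 - u ^ 2)) = 2 * u ^ p * (1 - u ^ 2)⁻¹ := by
    rw [div_eq_mul_inv]; ring
  simp only [hterm, hval]
  exact h

/-- Integrating a weighted geometric series termwise. -/
theorem hasSum_integral_rpow_div_one_sub_sq {p t : ℝ} (hp : -1 < p) (ht0 : 0 < t) (ht1 : t < 1) :
    HasSum (fun k : ℕ => 2 * t ^ (2 * (k : ℝ) + p + 1) / (2 * (k : ℝ) + p + 1))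
      (∫ u in (0 : ℝ)..t, u ^ p * (2 / (1 - u ^ 2))) := by
  have hint : ∀ k : ℕ, IntervalIntegrable (fun u : ℝ => 2 * u ^ (2 * (k : ℝ) + p)) volume 0 t :=
    fun k => (intervalIntegral.intervalIntegrable_rpow'
      (by have : (0 : ℝ) ≤ k := k.cast_nonneg
          linarith)).const_mul 2
  have hval : ∀ k : ℕ, ∫ u in (0 : ℝ)..t, 2 * u ^ (2 * (k : ℝ) + p) =
      2 * t ^ (2 * (k : ℝ) + p + 1) / (2 * (k : ℝ) + p + 1) := by
    intro k
    have hk : (0 : ℝ) ≤ k := k.cast_nonneg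
    rw [intervalIntegral.integral_const_mul, integral_rpow (Or.inl (by linarith)),
      Real.zero_rpow (by linarith)]
    ring
  have hsum : Summable (fun k : ℕ => 2 * t ^ (2 * (k : ℝ) + p + 1) / (2 * (k : ℝ) + p + 1)) := by
    refine Summable.of_nonneg_of_le (fun k => ?_) (fun k => ?_)
      ((hasSum_geometric_div_one_sub_sq ht0 ht1 (p + 1)).summable.mul_right (1 / (p + 1)))
    · have hk : (0 : ℝ) ≤ k := k.cast_nonneg
      have : 0 < 2 * (k : ℝ) + p + 1 := by linarith
      positivity
    · have hk : (0 : ℝ) ≤ k := k.cast_nonneg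
      rw [← add_assoc, mul_one_div]
      gcongr
      · linarith
      · linarith
  have h := hasSum_integral_of_summable_integral_norm
    (μ := volume.restrict (Set.Ioc 0 t)) (F := fun (k : ℕ) (u : ℝ) => 2 * u ^ (2 * (k : ℝ) + p))
    (fun k => (intervalIntegrable_iff_integrableOn_Ioc_of_le ht0.le).1 (hint k)) ?_
  · simp only [← intervalIntegral.integral_of_le ht0.le, hval] at h
    have he : ∫ u in (0 : ℝ)..t, u ^ p * (2 / (1 - u ^ 2)) =
        ∫ u in (0 : ℝ)..t, ∑' k : ℕ, 2 * u ^ (2 * (k : ℝ) + p) := by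
      rw [intervalIntegral.integral_of_le ht0.le, intervalIntegral.integral_of_le ht0.le]
      refine setIntegral_congr_fun measurableSet_Ioc fun u hu => ?_
      exact (hasSum_geometric_div_one_sub_sq hu.1 (lt_of_le_of_lt hu.2 ht1) p).tsum_eq.symm
    rw [he]
    exact h
  · refine hsum.congr fun k => ?_
    rw [← hval, intervalIntegral.integral_of_le ht0.le]
    refine setIntegral_congr_fun measurableSet_Ioc fun u hu => ?_
    have := Real.rpow_nonneg hu.1.le (2 * (k : ℝ) + p)
    exact (Real.norm_of_nonneg (by linarith)).symm

theorem rpow_neg_sub_rpow_nonneg {ν u : ℝ} (h0 : 0 < ν) (hu0 : 0 < u) (hu1 : u ≤ 1) (q : ℝ) :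
    0 ≤ u ^ (q + -ν) - u ^ (q + ν) :=
  sub_nonneg.2 (Real.rpow_le_rpow_of_exponent_ge hu0 hu1 (by linarith))

/-- Expanding `1/(1 - u²)` geometrically and integrating gives the tangent series term by term. The
terms are nonnegative, so their integrals are also the integrals of their norms, and convergence of
that series justifies the exchange. -/
theorem integral_rpow_neg_sub_rpow_div_one_sub_sq {ν : ℝ} (h0 : 0 < ν) (h1 : ν < 1) :
    ∫ u in (0 : ℝ)..1, (u ^ (-ν) * (2 / (1 - u ^ 2)) - u ^ ν * (2 / (1 - u ^ 2))) =
      Real.pi * Real.tan (Real.pi * ν / 2) := by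
  have hint : ∀ (k : ℕ) (p : ℝ), -1 < p →
      IntervalIntegrable (fun u : ℝ => 2 * u ^ (2 * (k : ℝ) + p)) volume 0 1 :=
    fun k p hp => (intervalIntegral.intervalIntegrable_rpow'
      (by have : (0 : ℝ) ≤ k := k.cast_nonneg
          linarith)).const_mul 2
  have hval1 : ∀ (k : ℕ) (p : ℝ), -1 < p → ∫ u in (0 : ℝ)..1, 2 * u ^ (2 * (k : ℝ) + p) =
      2 / (2 * (k : ℝ) + 1 + p) := by
    intro k p hp
    have hk : (0 : ℝ) ≤ k := k.cast_nonneg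
    rw [intervalIntegral.integral_const_mul, integral_rpow (Or.inl (by linarith)),
      Real.zero_rpow (by linarith), Real.one_rpow]
    ring
  have hint2 : ∀ k : ℕ, IntervalIntegrable
      (fun u : ℝ => 2 * u ^ (2 * (k : ℝ) + -ν) - 2 * u ^ (2 * (k : ℝ) + ν)) volume 0 1 :=
    fun k => (hint k _ (by linarith)).sub (hint k _ (by linarith))
  have hval : ∀ k : ℕ, ∫ u in (0 : ℝ)..1,
      (2 * u ^ (2 * (k : ℝ) + -ν) - 2 * u ^ (2 * (k : ℝ) + ν)) =
      2 / (2 * (k : ℝ) + 1 - ν) - 2 / (2 * (k : ℝ) + 1 + ν) := by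
    intro k
    rw [intervalIntegral.integral_sub (hint k _ (by linarith)) (hint k _ (by linarith)),
      hval1 k _ (by linarith), hval1 k _ (by linarith), ← sub_eq_add_neg]
  have h := hasSum_integral_of_summable_integral_norm
    (μ := volume.restrict (Set.Ioc 0 1))
    (F := fun (k : ℕ) (u : ℝ) => 2 * u ^ (2 * (k : ℝ) + -ν) - 2 * u ^ (2 * (k : ℝ) + ν))
    (fun k => (intervalIntegrable_iff_integrableOn_Ioc_of_le zero_le_one).1 (hint2 k)) ?_
  · simp only [← intervalIntegral.integral_of_le (zero_le_one' ℝ), hval] at h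
    rw [← h.unique (hasSum_pi_mul_tan h0 h1), intervalIntegral.integral_of_le zero_le_one,
      intervalIntegral.integral_of_le zero_le_one, integral_Ioc_eq_integral_Ioo,
      integral_Ioc_eq_integral_Ioo]
    refine setIntegral_congr_fun measurableSet_Ioo fun u hu => ?_
    exact ((hasSum_geometric_div_one_sub_sq hu.1 hu.2 (-ν)).sub
      (hasSum_geometric_div_one_sub_sq hu.1 hu.2 ν)).tsum_eq.symm
  · refine (hasSum_pi_mul_tan h0 h1).summable.congr fun k => ?_
    rw [← hval, intervalIntegral.integral_of_le zero_le_one]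
    refine setIntegral_congr_fun measurableSet_Ioc fun u hu => ?_
    have := rpow_neg_sub_rpow_nonneg h0 hu.1 hu.2 (2 * (k : ℝ))
    exact (Real.norm_of_nonneg (by linarith)).symm

/-- The numerator vanishes at `u = 1`: since `ν < 1`, `u² ≤ u^(2ν)`, so `u^(-ν) - u^ν ≤ u^(-ν)(1 -
u²)` and the integrand is at most `2u^(-ν)`. -/
theorem intervalIntegrable_rpow_neg_sub_rpow_div_one_sub_sq {ν : ℝ} (h0 : 0 < ν) (h1 : ν < 1) :
    IntervalIntegrable
      (fun u : ℝ => u ^ (-ν) * (2 / (1 - u ^ 2)) - u ^ ν * (2 / (1 - u ^ 2))) volume 0 1 := by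
  refine ((intervalIntegral.intervalIntegrable_rpow' (r := -ν) (by linarith)).const_mul 2).mono_fun
    (by fun_prop) ?_
  rw [EventuallyLE, ae_restrict_iff' measurableSet_uIoc]
  refine Eventually.of_forall fun u hu => ?_
  rw [Set.uIoc_of_le zero_le_one] at hu
  have hp : 0 < u ^ (-ν) := Real.rpow_pos_of_pos hu.1 _
  -- At `u = 1` the integrand is `0` by the convention for division by zero.
  rcases eq_or_lt_of_le hu.2 with rfl | hu1
  · simp
  have hd : 0 < 1 - u ^ 2 := by nlinarith [hu.1]
  have h2 : u ^ 2 ≤ u ^ ν * u ^ ν := by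
    rw [← Real.rpow_add hu.1, ← Real.rpow_natCast]
    exact Real.rpow_le_rpow_of_exponent_ge hu.1 hu.2 (by push_cast; linarith)
  have h3 : u ^ (-ν) * u ^ ν = 1 := by rw [← Real.rpow_add hu.1]; simp
  have h4 := rpow_neg_sub_rpow_nonneg h0 hu.1 hu.2 0
  simp only [zero_add] at h4
  rw [← sub_mul, Real.norm_of_nonneg (by positivity), Real.norm_of_nonneg (by positivity),
    mul_div_assoc', div_le_iff₀ hd]
  nlinarith

theorem inv_abs_rpow_eq_rpow_neg {x : ℝ} (hx : 0 ≤ x) (ν : ℝ) : (|x| ^ ν)⁻¹ = x ^ (-ν) := by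
  rw [abs_of_nonneg hx, Real.rpow_neg hx]

theorem intervalIntegrable_inv_abs_rpow_mul_inv {ν : ℝ} (h1 : ν < 1) {a b : ℝ} {d : ℝ → ℝ}
    (hd : Continuous d) (h : ∀ x ∈ Set.uIcc a b, d x ≠ 0) :
    IntervalIntegrable (fun x : ℝ => (|x| ^ ν)⁻¹ * (d x)⁻¹) volume a b :=
  (intervalIntegrable_inv_abs_rpow h1 a b).mul_continuousOn (hd.continuousOn.inv₀ h)

/-- The substitution `x = 1 / u` in the folded kernel. -/
theorem integral_folded_kernel_comp_inv {ν b R : ℝ} (hb : 1 < b) (hR : b ≤ R) :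
    ∫ x in b..R, ((|x| ^ ν)⁻¹ * (1 - x)⁻¹ + (|x| ^ ν)⁻¹ * (1 + x)⁻¹) =
      ∫ u in b⁻¹..R⁻¹, u ^ ν * (2 / (1 - u ^ 2)) := by
  have hsub : Set.uIcc b⁻¹ R⁻¹ ⊆ Set.Ioo 0 1 := by
    have hR0 : 0 < R⁻¹ := inv_pos.2 (by linarith)
    rw [Set.uIcc_of_ge ((inv_le_inv₀ (by linarith) (by linarith)).2 hR)]
    exact fun x hx => ⟨hR0.trans_le hx.1, hx.2.trans_lt (inv_lt_one_of_one_lt₀ hb)⟩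
  have h := intervalIntegral.integral_comp_mul_deriv' (a := b⁻¹) (b := R⁻¹) (f := fun u => u⁻¹)
    (f' := fun u => -(u ^ 2)⁻¹)
    (g := fun x => (|x| ^ ν)⁻¹ * (1 - x)⁻¹ + (|x| ^ ν)⁻¹ * (1 + x)⁻¹) ?_ ?_ ?_
  · rw [inv_inv, inv_inv] at h
    rw [← h]
    refine intervalIntegral.integral_congr fun u hu => ?_
    obtain ⟨hu0, hu1⟩ := hsub hu
    have hp : u ^ ν ≠ 0 := (Real.rpow_pos_of_pos hu0 ν).ne'
    have e1 : 1 - u ^ 2 ≠ 0 := by nlinarith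
    have e2 : u - 1 ≠ 0 := by linarith
    have e3 : u + 1 ≠ 0 := by linarith
    have e4 : 1 - u⁻¹ = (u - 1) / u := by field_simp
    have e5 : 1 + u⁻¹ = (u + 1) / u := by field_simp
    simp only [Function.comp]
    rw [abs_of_pos (inv_pos.2 hu0), Real.inv_rpow hu0.le, e4, e5, inv_inv]
    field_simp
    ring
  · intro u hu
    exact hasDerivAt_inv (hsub hu).1.ne'
  · refine ContinuousOn.neg (ContinuousOn.inv₀ (by fun_prop) fun u hu => ?_)
    exact pow_ne_zero _ (hsub hu).1.ne'
  · rintro _ ⟨u, hu, rfl⟩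
    obtain ⟨hu0, hu1⟩ := hsub hu
    have h1 : 1 < u⁻¹ := (one_lt_inv₀ hu0).2 hu1
    refine ContinuousAt.continuousWithinAt ?_
    have hW : ContinuousAt (fun x : ℝ => (|x| ^ ν)⁻¹) u⁻¹ := by
      refine ContinuousAt.inv₀ (continuous_abs.continuousAt.rpow_const (Or.inl ?_)) ?_
      · positivity
      · positivity
    refine (hW.mul (ContinuousAt.inv₀ (by fun_prop) ?_)).add
      (hW.mul (ContinuousAt.inv₀ (by fun_prop) ?_)) <;> linarith

theorem inv_abs_rpow_mul_inv_one_add_le {ν x : ℝ} (h0 : 0 < ν) (h1 : ν < 1) (hx : 1 / 2 ≤ x) :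
    ‖(|x| ^ ν)⁻¹ * (1 + x)⁻¹‖ ≤ 2 := by
  have hx0 : 0 < x := by linarith
  have hW : (|x| ^ ν)⁻¹ ≤ 2 := by
    rw [abs_of_pos hx0]
    refine inv_le_of_inv_le₀ two_pos ?_
    calc (2 : ℝ)⁻¹ = (2⁻¹) ^ (1 : ℝ) := by simp
      _ ≤ (2⁻¹) ^ ν := Real.rpow_le_rpow_of_exponent_ge (by norm_num) (by norm_num) h1.le
      _ ≤ x ^ ν := Real.rpow_le_rpow (by norm_num) (by linarith) h0.le
  have hi : (1 + x)⁻¹ ≤ 1 := inv_le_one_of_one_le₀ (by linarith)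
  rw [Real.norm_of_nonneg (by positivity)]
  calc (|x| ^ ν)⁻¹ * (1 + x)⁻¹ ≤ 2 * 1 := by gcongr
    _ = 2 := by norm_num

/-- The principal value of the kernel `|x|^(-ν) / (1 - x)` on `[-R, R]`, `1 < R`. -/
theorem tendsto_integral_kernel_one {ν R : ℝ} (h0 : 0 < ν) (h1 : ν < 1) (hR : 1 < R) :
    Tendsto (fun ε => (∫ x in (-R)..(1 - ε), (|x| ^ ν)⁻¹ * (1 - x)⁻¹) +
        ∫ x in (1 + ε)..R, (|x| ^ ν)⁻¹ * (1 - x)⁻¹) (𝓝[>] 0)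
      (𝓝 (Real.pi * Real.tan (Real.pi * ν / 2) +
        ∫ u in (0 : ℝ)..R⁻¹, u ^ ν * (2 / (1 - u ^ 2)))) := by
  -- `M` is `K` reflected, so `∫_{-R}^0 K = ∫_0^R M`. On `(0, 1)`, `K + M = 2u^(-ν)/(1 - u²)`; on
  -- `(1 + ε, R)`, inversion turns `K + M` into `v`. The truncated integral is thus `∫_0^(1-ε) (K +
  -- M - v)`, plus `∫ M` over the gap, minus `∫ v` over the mismatch between `1 - ε` and `(1 +
  -- ε)⁻¹`, plus `∫_0^(1/R) v`.
  set K : ℝ → ℝ := fun x => (|x| ^ ν)⁻¹ * (1 - x)⁻¹ with hK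
  set M : ℝ → ℝ := fun x => (|x| ^ ν)⁻¹ * (1 + x)⁻¹ with hM
  set v : ℝ → ℝ := fun u => u ^ ν * (2 / (1 - u ^ 2)) with hv
  have hKi : ∀ a b : ℝ, (∀ x ∈ Set.uIcc a b, x ≠ 1) → IntervalIntegrable K volume a b :=
    fun a b h => intervalIntegrable_inv_abs_rpow_mul_inv h1 (d := fun x => 1 - x) (by fun_prop)
      fun x hx => sub_ne_zero.2 (h x hx).symm
  have hMi : ∀ a b : ℝ, 0 ≤ a → 0 ≤ b → IntervalIntegrable M volume a b :=
    fun a b ha hb => intervalIntegrable_inv_abs_rpow_mul_inv h1 (d := fun x => 1 + x) (by fun_prop)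
      fun x hx => by
        have : min a b ≤ x := hx.1
        have : 0 ≤ min a b := le_min ha hb
        linarith
  have hvi : ∀ a b : ℝ, 0 ≤ a → 0 ≤ b → a < 1 → b < 1 → IntervalIntegrable v volume a b := by
    intro a b ha hb ha1 hb1
    refine ContinuousOn.intervalIntegrable fun x hx => ?_
    have hx0 : 0 ≤ x := (le_min ha hb).trans hx.1
    have hx1 : x < 1 := hx.2.trans_lt (max_lt ha1 hb1)
    refine ContinuousAt.continuousWithinAt ?_
    refine ContinuousAt.mul (Real.continuousAt_rpow_const _ _ (Or.inr h0.le)) ?_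
    exact ContinuousAt.div₀ (by fun_prop) (by fun_prop) (by nlinarith)
  have hev : ∀ᶠ ε in 𝓝[>] (0 : ℝ), 0 < ε ∧ ε < 1 / 2 ∧ ε < R - 1 := by
    filter_upwards [Ioo_mem_nhdsGT (show (0 : ℝ) < min (1 / 2) (R - 1) by
      exact lt_min (by norm_num) (by linarith))] with ε hε
    exact ⟨hε.1, hε.2.trans_le (min_le_left _ _), hε.2.trans_le (min_le_right _ _)⟩
  have hneg : ∫ x in (-R)..0, K x = ∫ x in (0 : ℝ)..R, M x := by
    have := intervalIntegral.integral_comp_neg (a := 0) (b := R) K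
    rw [neg_zero] at this
    rw [← this]
    refine intervalIntegral.integral_congr fun x _ => ?_
    simp [hK, hM]
  have hlim1 : Tendsto (fun ε : ℝ => ∫ u in (0 : ℝ)..(1 - ε), (K u + M u - v u)) (𝓝[>] 0)
      (𝓝 (Real.pi * Real.tan (Real.pi * ν / 2))) := by
    rw [← integral_rpow_neg_sub_rpow_div_one_sub_sq h0 h1]
    have hint := intervalIntegrable_rpow_neg_sub_rpow_div_one_sub_sq h0 h1
    rw [intervalIntegrable_iff', Set.uIcc_of_le zero_le_one] at hint
    have hc := (intervalIntegral.continuousOn_primitive_interval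
      (by rwa [Set.uIcc_of_le zero_le_one])) 1 Set.right_mem_uIcc
    have ht : Tendsto (fun ε : ℝ => 1 - ε) (𝓝[>] 0) (𝓝[Set.uIcc 0 1] 1) := by
      refine tendsto_nhdsWithin_iff.2 ⟨?_, ?_⟩
      · exact ((continuous_const.sub continuous_id).tendsto' 0 1 (by simp)).mono_left
          nhdsWithin_le_nhds
      · filter_upwards [hev] with ε ⟨hε0, hε1, _⟩
        rw [Set.uIcc_of_le zero_le_one]
        constructor <;> linarith
    refine (hc.tendsto.comp ht).congr' ?_
    filter_upwards [hev] with ε ⟨hε0, hε1, _⟩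
    refine intervalIntegral.integral_congr fun u hu => ?_
    rw [Set.uIcc_of_le (by linarith)] at hu
    have hu1 : u < 1 := by linarith [hu.2]
    simp only [hK, hM, hv]
    rw [inv_abs_rpow_eq_rpow_neg hu.1]
    have e1 : 1 - u ≠ 0 := by linarith
    have e2 : 1 + u ≠ 0 := by linarith [hu.1]
    have e3 : 1 - u ^ 2 = (1 - u) * (1 + u) := by ring
    rw [e3]
    field_simp
    ring
  have hlim2 : Tendsto (fun ε : ℝ => ∫ x in (1 - ε)..(1 + ε), M x) (𝓝[>] 0) (𝓝 0) := by
    have ht : Tendsto (fun ε : ℝ => 4 * ε) (𝓝[>] 0) (𝓝 0) :=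
      ((continuous_const.mul continuous_id).tendsto' 0 0 (by simp)).mono_left nhdsWithin_le_nhds
    refine squeeze_zero_norm' ?_ ht
    filter_upwards [hev] with ε ⟨hε0, hε1, _⟩
    refine (intervalIntegral.norm_integral_le_of_norm_le_const (C := 2) fun x hx => ?_).trans ?_
    · rw [Set.uIoc_of_le (by linarith)] at hx
      exact inv_abs_rpow_mul_inv_one_add_le h0 h1 (by linarith [hx.1])
    · rw [abs_of_nonneg (by linarith)]; linarith
  have hlim3 : Tendsto (fun ε : ℝ => ∫ x in (1 - ε)..(1 + ε)⁻¹, v x) (𝓝[>] 0) (𝓝 0) := by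
    have ht : Tendsto (fun ε : ℝ => 2 * ε) (𝓝[>] 0) (𝓝 0) :=
      ((continuous_const.mul continuous_id).tendsto' 0 0 (by simp)).mono_left nhdsWithin_le_nhds
    refine squeeze_zero_norm' ?_ ht
    filter_upwards [hev] with ε ⟨hε0, hε1, _⟩
    -- Inversion does not preserve the symmetric cutoff, but the mismatch has length of order `ε²`
    -- while `v` is of order `1/ε` there.
    have hlen : (1 + ε)⁻¹ - (1 - ε) = ε ^ 2 / (1 + ε) := by field_simp; ring
    have hle : 1 - ε ≤ (1 + ε)⁻¹ := by
      have : 0 ≤ ε ^ 2 / (1 + ε) := by positivity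
      linarith
    refine (intervalIntegral.norm_integral_le_of_norm_le_const
      (C := 2 * ((1 + ε) / ε)) fun x hx => ?_).trans ?_
    · rw [Set.uIoc_of_le hle] at hx
      have hx0 : 0 < x := by linarith [hx.1]
      have hgap : ε / (1 + ε) ≤ 1 - x ^ 2 := by
        have e : 1 - (1 + ε)⁻¹ = ε / (1 + ε) := by field_simp; ring
        have hi1 : (1 + ε)⁻¹ ≤ 1 := inv_le_one_of_one_le₀ (by linarith)
        nlinarith [hx.2]
      have hpos : 0 < ε / (1 + ε) := by positivity
      have hx1 : x ≤ 1 := hx.2.trans (inv_le_one_of_one_le₀ (by linarith))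
      have hd : 2 / (1 - x ^ 2) ≤ 2 * ((1 + ε) / ε) := by
        calc 2 / (1 - x ^ 2) ≤ 2 / (ε / (1 + ε)) := by gcongr
          _ = 2 * ((1 + ε) / ε) := by field_simp
      have hd0 : 0 ≤ 2 / (1 - x ^ 2) := div_nonneg two_pos.le (hpos.le.trans hgap)
      have hp1 : x ^ ν ≤ 1 := Real.rpow_le_one hx0.le hx1 h0.le
      have hp0 : 0 ≤ x ^ ν := Real.rpow_nonneg hx0.le _
      rw [Real.norm_of_nonneg (mul_nonneg hp0 hd0)]
      nlinarith
    · rw [hlen, abs_of_nonneg (by positivity)]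
      apply le_of_eq
      field_simp
  have hlim := ((hlim1.add hlim2).sub hlim3).add_const (∫ u in (0 : ℝ)..R⁻¹, v u)
  rw [add_zero, sub_zero] at hlim
  refine hlim.congr' ?_
  filter_upwards [hev] with ε ⟨hε0, hε1, hε2⟩
  have hi0 : 0 < (1 + ε)⁻¹ := by positivity
  have hi1 : (1 + ε)⁻¹ < 1 := inv_lt_one_of_one_lt₀ (by linarith)
  have hR0 : 0 < R⁻¹ := by positivity
  have hR1 : R⁻¹ < 1 := inv_lt_one_of_one_lt₀ hR
  have hK1 : IntervalIntegrable K volume 0 (1 - ε) := hKi _ _ fun x hx => by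
    rw [Set.uIcc_of_le (by linarith)] at hx; linarith [hx.2]
  have hK2 : IntervalIntegrable K volume (-R) 0 := hKi _ _ fun x hx => by
    rw [Set.uIcc_of_le (by linarith)] at hx; linarith [hx.2]
  have hK3 : IntervalIntegrable K volume (1 + ε) R := hKi _ _ fun x hx => by
    rw [Set.uIcc_of_le (by linarith)] at hx; linarith [hx.1]
  have e1 := intervalIntegral.integral_add_adjacent_intervals hK2 hK1
  have e2 := intervalIntegral.integral_add_adjacent_intervals
    (hMi 0 (1 - ε) le_rfl (by linarith)) (hMi (1 - ε) (1 + ε) (by linarith) (by linarith))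
  have e3 := intervalIntegral.integral_add_adjacent_intervals
    (hMi 0 (1 + ε) le_rfl (by linarith)) (hMi (1 + ε) R (by linarith) (by linarith))
  have e4 := integral_folded_kernel_comp_inv (ν := ν) (b := 1 + ε) (R := R) (by linarith)
    (by linarith)
  have e5 := intervalIntegral.integral_add hK3 (hMi (1 + ε) R (by linarith) (by linarith))
  have e6 := intervalIntegral.integral_add_adjacent_intervals
    (hvi 0 (1 - ε) le_rfl (by linarith) (by linarith) (by linarith))
    (hvi (1 - ε) (1 + ε)⁻¹ (by linarith) hi0.le (by linarith) hi1)
  have e7 := intervalIntegral.integral_add_adjacent_intervals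
    (hvi 0 (1 + ε)⁻¹ le_rfl hi0.le (by linarith) hi1)
    (hvi (1 + ε)⁻¹ R⁻¹ hi0.le hR0.le hi1 hR1)
  have e8 := intervalIntegral.integral_sub (hK1.add (hMi 0 (1 - ε) le_rfl (by linarith)))
    (hvi 0 (1 - ε) le_rfl (by linarith) (by linarith) (by linarith))
  have e9 := intervalIntegral.integral_add hK1 (hMi 0 (1 - ε) le_rfl (by linarith))
  change ∫ x in (1 + ε)..R, (K x + M x) = ∫ x in (1 + ε)⁻¹..R⁻¹, v x at e4
  rw [e8, e9]
  linarith

/-! ### Calculus of principal values -/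

/-- The principal value at `ω` of `∫_{-R}^{R} h`, for an interior point `ω`, in terms of interval
integrals. -/
def IntervalPV (h : ℝ → ℂ) (ω R : ℝ) (L : ℂ) : Prop :=
  (∀ᶠ ε in 𝓝[>] (0 : ℝ), IntervalIntegrable h volume (-R) (ω - ε) ∧
    IntervalIntegrable h volume (ω + ε) R) ∧
  Tendsto (fun ε => (∫ x in (-R)..(ω - ε), h x) + ∫ x in (ω + ε)..R, h x) (𝓝[>] 0) (𝓝 L)

theorem eventually_lt_nhdsGT_zero {δ : ℝ} (hδ : 0 < δ) : ∀ᶠ ε in 𝓝[>] (0 : ℝ), 0 < ε ∧ ε < δ :=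
  Ioo_mem_nhdsGT hδ

namespace IntervalPV

variable {h h' : ℝ → ℂ} {ω R A : ℝ} {L L' : ℂ}

theorem add (H : IntervalPV h ω R L) (H' : IntervalPV h' ω R L') :
    IntervalPV (fun x => h x + h' x) ω R (L + L') := by
  refine ⟨?_, (H.2.add H'.2).congr' ?_⟩
  · filter_upwards [H.1, H'.1] with ε h1 h2
    exact ⟨h1.1.add h2.1, h1.2.add h2.2⟩
  · filter_upwards [H.1, H'.1] with ε h1 h2
    rw [intervalIntegral.integral_add h1.1 h2.1, intervalIntegral.integral_add h1.2 h2.2]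
    ring

theorem const_mul (c : ℂ) (H : IntervalPV h ω R L) : IntervalPV (fun x => c * h x) ω R (c * L) := by
  refine ⟨?_, (H.2.const_mul c).congr' ?_⟩
  · filter_upwards [H.1] with ε h1
    exact ⟨h1.1.const_mul c, h1.2.const_mul c⟩
  · filter_upwards with ε
    rw [intervalIntegral.integral_const_mul, intervalIntegral.integral_const_mul]
    ring

theorem congr (hω : |ω| < R) (H : IntervalPV h ω R L)
    (hh : ∀ x, |x| ≤ R → x ≠ ω → h x = h' x) : IntervalPV h' ω R L := by
  obtain ⟨hω1, hω2⟩ := abs_lt.1 hω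
  have hev := eventually_lt_nhdsGT_zero (lt_min (by linarith : 0 < R - ω) (by linarith : 0 < R + ω))
  have hkey : ∀ ε, 0 < ε ∧ ε < min (R - ω) (R + ω) →
      Set.EqOn h h' (Set.uIcc (-R) (ω - ε)) ∧ Set.EqOn h h' (Set.uIcc (ω + ε) R) := by
    intro ε ⟨h0, h1⟩
    have h2 := h1.trans_le (min_le_left _ _)
    have h3 := h1.trans_le (min_le_right _ _)
    rw [Set.uIcc_of_le (by linarith), Set.uIcc_of_le (by linarith)]
    constructor <;> intro x hx <;> refine hh x (abs_le.2 ⟨?_, ?_⟩) ?_ <;> linarith [hx.1, hx.2]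
  refine ⟨?_, H.2.congr' ?_⟩
  · filter_upwards [H.1, hev] with ε h1 h2
    exact ⟨h1.1.congr fun x hx => (hkey ε h2).1 (Set.uIoc_subset_uIcc hx),
      h1.2.congr fun x hx => (hkey ε h2).2 (Set.uIoc_subset_uIcc hx)⟩
  · filter_upwards [hev] with ε h2
    rw [intervalIntegral.integral_congr (hkey ε h2).1, intervalIntegral.integral_congr (hkey ε h2).2]

/-- The primitive of an integrable function is continuous, so nothing is lost by cutting out a
shrinking gap. -/
theorem of_intervalIntegrable (hω : |ω| < R) (H : IntervalIntegrable h volume (-R) R) :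
    IntervalPV h ω R (∫ x in (-R)..R, h x) := by
  obtain ⟨hω1, hω2⟩ := abs_lt.1 hω
  have hR : -R ≤ R := by linarith
  have hev := eventually_lt_nhdsGT_zero (lt_min (by linarith : 0 < R - ω) (by linarith : 0 < R + ω))
  have hint : ∀ a b : ℝ, a ∈ Set.Icc (-R) R → b ∈ Set.Icc (-R) R → IntervalIntegrable h volume a b :=
    fun a b ha hb => H.mono_set (by
      rw [Set.uIcc_of_le hR]
      exact Set.uIcc_subset_Icc ha hb)
  have hmem : ∀ ε, 0 < ε ∧ ε < min (R - ω) (R + ω) →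
      ω - ε ∈ Set.Icc (-R) R ∧ ω + ε ∈ Set.Icc (-R) R := by
    intro ε ⟨h0, h1⟩
    have h2 := h1.trans_le (min_le_left _ _)
    have h3 := h1.trans_le (min_le_right _ _)
    refine ⟨⟨?_, ?_⟩, ⟨?_, ?_⟩⟩ <;> linarith
  have hl : -R ∈ Set.Icc (-R) R := ⟨le_rfl, hR⟩
  have hr : R ∈ Set.Icc (-R) R := ⟨hR, le_rfl⟩
  refine ⟨?_, ?_⟩
  · filter_upwards [hev] with ε h2
    exact ⟨hint _ _ hl (hmem ε h2).1, hint _ _ (hmem ε h2).2 hr⟩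
  · have hω' : ω ∈ Set.uIcc (-R) R := by rw [Set.uIcc_of_le hR]; constructor <;> linarith
    have hc := intervalIntegral.continuousOn_primitive_interval
      ((intervalIntegrable_iff' (by simp)).1 H) ω hω'
    have ht : ∀ s : ℝ → ℝ, Continuous s → s 0 = ω →
        (∀ ε, 0 < ε ∧ ε < min (R - ω) (R + ω) → s ε ∈ Set.Icc (-R) R) →
        Tendsto (fun ε : ℝ => ∫ x in (-R)..(s ε), h x) (𝓝[>] 0) (𝓝 (∫ x in (-R)..ω, h x)) := by
      intro s hs hs0 hsm
      refine hc.tendsto.comp (tendsto_nhdsWithin_iff.2 ⟨?_, ?_⟩)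
      · exact (hs.tendsto' 0 ω hs0).mono_left nhdsWithin_le_nhds
      · filter_upwards [hev] with ε h2
        rw [Set.uIcc_of_le hR]
        exact hsm ε h2
    have h1 := ht (fun ε => ω - ε) (by fun_prop) (by simp) fun ε h2 => (hmem ε h2).1
    have h2 := ht (fun ε => ω + ε) (by fun_prop) (by simp) fun ε h2 => (hmem ε h2).2
    have h3 := (h1.sub h2).add_const (∫ x in (-R)..R, h x)
    rw [sub_self, zero_add] at h3
    refine h3.congr' ?_
    filter_upwards [hev] with ε h4
    rw [← intervalIntegral.integral_add_adjacent_intervals (hint _ _ hl (hmem ε h4).2)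
      (hint _ _ (hmem ε h4).2 hr)]
    ring

theorem extend (H : IntervalPV h ω R L) (h1 : IntervalIntegrable h volume (-A) (-R))
    (h2 : IntervalIntegrable h volume R A) :
    IntervalPV h ω A (L + ((∫ x in (-A)..(-R), h x) + ∫ x in R..A, h x)) := by
  refine ⟨?_, (H.2.add_const _).congr' ?_⟩
  · filter_upwards [H.1] with ε h3
    exact ⟨h1.trans h3.1, h3.2.trans h2⟩
  · filter_upwards [H.1] with ε h3
    rw [← intervalIntegral.integral_add_adjacent_intervals h1 h3.1,
      ← intervalIntegral.integral_add_adjacent_intervals h3.2 h2]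
    ring

theorem comp_neg (H : IntervalPV h ω R L) : IntervalPV (fun x => h (-x)) (-ω) R L := by
  refine ⟨?_, H.2.congr' ?_⟩
  · filter_upwards [H.1] with ε h3
    constructor
    · have := (IntervalIntegrable.iff_comp_neg (by simp)).1 h3.2.symm
      rwa [neg_add'] at this
    · have := (IntervalIntegrable.iff_comp_neg (by simp)).1 h3.1.symm
      rwa [neg_sub', neg_neg, sub_neg_eq_add] at this
  · filter_upwards with ε
    rw [intervalIntegral.integral_comp_neg, intervalIntegral.integral_comp_neg, add_comm]
    congr 2 <;> ring

theorem comp_div (hω : 0 < ω) (H : IntervalPV h 1 (R / ω) L) :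
    IntervalPV (fun x => h (x / ω)) ω R (ω * L) := by
  have ht : Tendsto (fun ε : ℝ => ε / ω) (𝓝[>] 0) (𝓝[>] 0) := by
    refine tendsto_nhdsWithin_iff.2 ⟨?_, ?_⟩
    · exact ((continuous_id.div_const ω).tendsto' 0 0 (by simp)).mono_left nhdsWithin_le_nhds
    · filter_upwards [self_mem_nhdsWithin] with ε hε
      exact div_pos hε hω
  have e1 : ∀ ε : ℝ, 1 - ε / ω = (ω - ε) / ω := fun ε => by field_simp
  have e2 : ∀ ε : ℝ, 1 + ε / ω = (ω + ε) / ω := fun ε => by field_simp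
  have e3 : -(R / ω) = (-R) / ω := by ring
  refine ⟨?_, ((H.2.comp ht).const_mul (ω : ℂ)).congr fun ε => ?_⟩
  · filter_upwards [ht.eventually H.1] with ε h3
    rw [e1, e2, e3] at h3
    have hc : ∀ a b : ℝ, IntervalIntegrable h volume (a / ω) (b / ω) →
        IntervalIntegrable (fun x => h (x / ω)) volume a b := by
      intro a b hab
      have := hab.comp_mul_right (c := ω⁻¹) (by simp)
      simpa [div_eq_mul_inv, hω.ne'] using this
    exact ⟨hc _ _ h3.1, hc _ _ h3.2⟩
  · simp only [Function.comp]
    rw [e1, e2, e3, intervalIntegral.integral_comp_div _ hω.ne',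
      intervalIntegral.integral_comp_div _ hω.ne', ← smul_add, Complex.real_smul]

theorem hasPVOn (hω : |ω| < A) (H : IntervalPV h ω A L) : HasPVOn h ω A L := by
  obtain ⟨hω1, hω2⟩ := abs_lt.1 hω
  have hev := eventually_lt_nhdsGT_zero (lt_min (by linarith : 0 < A - ω) (by linarith : 0 < A + ω))
  have hset : ∀ ε, 0 < ε ∧ ε < min (A - ω) (A + ω) →
      Set.Icc (-A) A \ Set.Ioo (ω - ε) (ω + ε) = Set.Icc (-A) (ω - ε) ∪ Set.Icc (ω + ε) A := by
    intro ε ⟨h0, h1⟩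
    have h2 := h1.trans_le (min_le_left _ _)
    have h3 := h1.trans_le (min_le_right _ _)
    ext x
    simp only [Set.mem_sdiff, Set.mem_Icc, Set.mem_Ioo, Set.mem_union, not_and_or, not_lt]
    constructor
    · rintro ⟨⟨h4, h5⟩, h6 | h6⟩
      · exact Or.inl ⟨h4, h6⟩
      · exact Or.inr ⟨h6, h5⟩
    · rintro (⟨h4, h5⟩ | ⟨h4, h5⟩)
      · exact ⟨⟨h4, by linarith⟩, Or.inl h5⟩
      · exact ⟨⟨by linarith, h5⟩, Or.inr h4⟩
  have hle : ∀ ε, 0 < ε ∧ ε < min (A - ω) (A + ω) → -A ≤ ω - ε ∧ ω + ε ≤ A := by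
    intro ε ⟨h0, h1⟩
    have h2 := h1.trans_le (min_le_left _ _)
    have h3 := h1.trans_le (min_le_right _ _)
    constructor <;> linarith
  have hon : ∀ ε, (0 < ε ∧ ε < min (A - ω) (A + ω)) → IntervalIntegrable h volume (-A) (ω - ε) ∧
      IntervalIntegrable h volume (ω + ε) A →
      IntegrableOn h (Set.Icc (-A) (ω - ε)) ∧ IntegrableOn h (Set.Icc (ω + ε) A) := by
    intro ε h1 h2
    exact ⟨(intervalIntegrable_iff_integrableOn_Icc_of_le (hle ε h1).1).1 h2.1,
      (intervalIntegrable_iff_integrableOn_Icc_of_le (hle ε h1).2).1 h2.2⟩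
  constructor
  · intro ε hε
    -- Integrability is known only for small gaps. For an arbitrary `ε`, a gap `δ < ε` removes less,
    -- and integrability restricts to the smaller set.
    obtain ⟨δ, ⟨h1, h2⟩, hδε⟩ := ((H.1.and hev).and (eventually_lt_nhdsGT_zero hε)).exists
    have h3 := hon δ h2 h1
    have h4 : IntegrableOn h (Set.Icc (-A) A \ Set.Ioo (ω - δ) (ω + δ)) := by
      rw [hset δ h2]; exact h3.1.union h3.2
    refine h4.mono_set (Set.sdiff_subset_sdiff_right (Set.Ioo_subset_Ioo ?_ ?_)) <;> linarith [hδε.2]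
  · refine H.2.congr' ?_
    filter_upwards [H.1, hev] with ε h1 h2
    have h3 := hon ε h2 h1
    rw [hset ε h2, setIntegral_union ?_ measurableSet_Icc h3.1 h3.2, integral_Icc_eq_integral_Ioc,
      integral_Icc_eq_integral_Ioc, intervalIntegral.integral_of_le (hle ε h2).1,
      intervalIntegral.integral_of_le (hle ε h2).2]
    refine Set.disjoint_left.2 fun x hx hx' => ?_
    linarith [hx.2, hx'.1, h2.1]

end IntervalPV

/-! ### Principal value of the kernel at a general point -/

/-- The kernel `|x|^(-ν) / (ω - x)`. -/
noncomputable def hilbertKernel (ν ω x : ℝ) : ℂ := (((|x| ^ ν)⁻¹ * (ω - x)⁻¹ : ℝ) : ℂ)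

theorem intervalIntegrable_hilbertKernel {ν : ℝ} (h1 : ν < 1) {ω a b : ℝ}
    (h : ∀ x ∈ Set.uIcc a b, x ≠ ω) : IntervalIntegrable (hilbertKernel ν ω) volume a b := by
  have := intervalIntegrable_inv_abs_rpow_mul_inv h1 (d := fun x => ω - x) (by fun_prop)
    fun x hx => sub_ne_zero.2 (h x hx).symm
  exact ⟨this.1.ofReal, this.2.ofReal⟩

/-- The finite part of `∫_0^R ((-1)^k (-x)^j - x^j) / x^(k+ν+1)`. -/
noncomputable def finiteMoment (ν R : ℝ) (k j : ℕ) : ℂ :=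
  ((-1) ^ (k + j) - 1) * ((R ^ ((j : ℝ) - k - ν) / ((j : ℝ) - k - ν) : ℝ) : ℂ)

theorem intervalPV_hilbertKernel_one {ν R : ℝ} (h0 : 0 < ν) (h1 : ν < 1) (hR : 1 < R) :
    IntervalPV (hilbertKernel ν 1) 1 R
      ((Real.pi * Real.tan (Real.pi * ν / 2) +
        ∫ u in (0 : ℝ)..R⁻¹, u ^ ν * (2 / (1 - u ^ 2)) : ℝ)) := by
  constructor
  · filter_upwards [eventually_lt_nhdsGT_zero (by linarith : 0 < R - 1)] with ε hε
    constructor <;> refine intervalIntegrable_hilbertKernel h1 fun x hx => ?_ <;> rw [Set.uIcc_of_le (by linarith)] at hx <;>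
      linarith [hx.1, hx.2]
  · refine ((Complex.continuous_ofReal.tendsto _).comp
      (tendsto_integral_kernel_one h0 h1 hR)).congr fun ε => ?_
    simp only [Function.comp, hilbertKernel]
    rw [intervalIntegral.integral_ofReal, intervalIntegral.integral_ofReal, Complex.ofReal_add]

theorem intervalPV_hilbertKernel_of_pos {ν ω R : ℝ} (h0 : 0 < ν) (h1 : ν < 1) (hω : 0 < ω)
    (hR : ω < R) :
    IntervalPV (hilbertKernel ν ω) ω R
      ((ω ^ (-ν) * (Real.pi * Real.tan (Real.pi * ν / 2) +
        ∫ u in (0 : ℝ)..(ω / R), u ^ ν * (2 / (1 - u ^ 2))) : ℝ)) := by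
  have hR1 : 1 < R / ω := (one_lt_div hω).2 hR
  -- The kernel is homogeneous of degree `-ν - 1` in `(x, ω)`; the change of variables gives back
  -- one factor `ω`.
  have h := ((intervalPV_hilbertKernel_one h0 h1 hR1).comp_div hω).const_mul
    ((ω ^ (-ν - 1) : ℝ) : ℂ)
  have he : (fun x : ℝ => ((ω ^ (-ν - 1) : ℝ) : ℂ) * hilbertKernel ν 1 (x / ω)) =
      hilbertKernel ν ω := by
    ext x
    rw [hilbertKernel, hilbertKernel, ← Complex.ofReal_mul]
    congr 1
    have e1 : 1 - x / ω = (ω - x) / ω := by field_simp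
    rw [abs_div, abs_of_pos hω, Real.div_rpow (abs_nonneg x) hω.le, e1, inv_div, inv_div,
      Real.rpow_sub_one hω.ne', Real.rpow_neg hω.le]
    have : ω ^ ν ≠ 0 := (Real.rpow_pos_of_pos hω ν).ne'
    rw [div_eq_mul_inv, div_eq_mul_inv, div_eq_mul_inv]
    field_simp
  rw [he, ← mul_assoc, ← Complex.ofReal_mul, ← Complex.ofReal_mul, Real.rpow_sub_one hω.ne',
    div_mul_cancel₀ _ hω.ne', inv_div] at h
  exact h

/-- The factor `(-1)^k - 1` kills even `k`; for `k = 2n + 1` the term is the `n`-th term of the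
integrated geometric series at `ω/R`, multiplied by `ω^(-ν)`. -/
theorem hasSum_finiteMoment_zero_of_pos {ν ω R : ℝ} (h0 : 0 < ν) (hω : 0 < ω) (hR : ω < R) :
    HasSum (fun k : ℕ => (ω : ℂ) ^ k * finiteMoment ν R k 0)
      ((ω ^ (-ν) * ∫ u in (0 : ℝ)..(ω / R), u ^ ν * (2 / (1 - u ^ 2)) : ℝ) : ℂ) := by
  have hR0 : 0 < R := hω.trans hR
  have h := (hasSum_integral_rpow_div_one_sub_sq (by linarith : -1 < ν) (div_pos hω hR0)
    ((div_lt_one hR0).2 hR)).mul_left (ω ^ (-ν))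
  have hinj : Function.Injective (fun n : ℕ => 2 * n + 1) := fun a b hab => by
    simp only at hab; omega
  rw [← hinj.hasSum_iff]
  · rw [← Complex.hasSum_ofReal] at h
    convert h using 2 with n
    simp only [Function.comp, finiteMoment]
    have e1 : ((-1 : ℂ) ^ (2 * n + 1 + 0) - 1) = ((-2 : ℝ) : ℂ) := by
      rw [add_zero, pow_succ, pow_mul]; norm_num
    rw [e1, ← Complex.ofReal_pow, ← Complex.ofReal_mul, ← Complex.ofReal_mul]
    congr 1
    push_cast
    have e2 : (0 : ℝ) - (2 * n + 1) - ν = -(2 * n + ν + 1) := by ring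
    rw [e2, Real.div_rpow hω.le hR0.le, Real.rpow_neg hR0.le, ← Real.rpow_natCast ω (2 * n + 1)]
    have e3 : ω ^ (((2 * n + 1 : ℕ) : ℝ)) = ω ^ (-ν) * ω ^ (2 * (n : ℝ) + ν + 1) := by
      rw [← Real.rpow_add hω]; congr 1; push_cast; ring
    have hn : (0 : ℝ) ≤ n := n.cast_nonneg
    have e4 : 2 * (n : ℝ) + ν + 1 ≠ 0 := by positivity
    rw [e3]
    field_simp
  · intro k hk
    have hke : Even k := by
      by_contra hodd
      obtain ⟨n, hn⟩ := Nat.not_even_iff_odd.1 hodd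
      exact hk ⟨n, hn.symm⟩
    simp [finiteMoment, hke.neg_one_pow]

theorem hilbertKernel_neg (ν ω x : ℝ) : hilbertKernel ν ω x = -hilbertKernel ν (-ω) (-x) := by
  rw [hilbertKernel, hilbertKernel, abs_neg, ← Complex.ofReal_neg]
  congr 1
  rw [show -ω - -x = -(ω - x) by ring, inv_neg]
  ring

theorem neg_pow_mul_finiteMoment_zero (ν R ω : ℝ) (k : ℕ) :
    ((-ω : ℝ) : ℂ) ^ k * finiteMoment ν R k 0 = -((ω : ℂ) ^ k * finiteMoment ν R k 0) := by
  rcases Nat.even_or_odd k with hk | hk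
  · simp [finiteMoment, hk.neg_one_pow]
  · rw [Complex.ofReal_neg, hk.neg_pow, neg_mul]

/-- The principal value of `∫_{-R}^{R} |x|^(-ν) / (ω - x) dx` as a power series in `ω` and a
singular term. -/
theorem exists_intervalPV_hilbertKernel {ν ω R : ℝ} (h0 : 0 < ν) (h1 : ν < 1) (hω : |ω| < R) :
    ∃ S : ℂ, HasSum (fun k : ℕ => (ω : ℂ) ^ k * finiteMoment ν R k 0) S ∧
      IntervalPV (hilbertKernel ν ω) ω R (S + singularTerm ν 1 ω) := by
  have hpos : ∀ ω : ℝ, 0 < ω → ω < R →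
      ∃ S : ℂ, HasSum (fun k : ℕ => (ω : ℂ) ^ k * finiteMoment ν R k 0) S ∧
      IntervalPV (hilbertKernel ν ω) ω R (S + singularTerm ν 1 ω) := by
    intro ω hω hR
    refine ⟨_, hasSum_finiteMoment_zero_of_pos h0 hω hR, ?_⟩
    convert intervalPV_hilbertKernel_of_pos h0 h1 hω hR using 1
    rw [singularTerm, Real.sign_of_pos hω, abs_of_pos hω, Pi.one_apply, Real.rpow_neg hω.le]
    push_cast
    ring
  rcases lt_trichotomy ω 0 with h | rfl | h
  · obtain ⟨S, hS, hPV⟩ := hpos (-ω) (by linarith) (by rwa [abs_of_neg h] at hω)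
    refine ⟨-S, ?_, ?_⟩
    · have := hS.neg
      simpa only [neg_pow_mul_finiteMoment_zero, neg_neg] using this
    · have := hPV.comp_neg.const_mul (-1)
      rw [neg_neg] at this
      have e : ∀ x, -1 * hilbertKernel ν (-ω) (-x) = hilbertKernel ν ω x := fun x => by
        rw [hilbertKernel_neg ν ω x]; ring
      simp only [e] at this
      convert this using 1
      rw [singularTerm, singularTerm, Real.sign_of_neg h, Real.sign_of_pos (neg_pos.2 h), abs_neg]
      simp only [Pi.one_apply]
      push_cast
      ring
  -- At `ω = 0` the kernel is odd and the two sides cancel for every `ε`. The singular term is `0`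
  -- since `Real.sign 0 = 0`, and the moment with `k = j = 0` has the factor `1 - 1`.
  · have hR : 0 < R := by simpa using hω
    refine ⟨0, ?_, ?_⟩
    · convert hasSum_zero with k
      rcases k with _ | k
      · simp [finiteMoment]
      · simp
    · refine ⟨?_, ?_⟩
      · filter_upwards [eventually_lt_nhdsGT_zero hR] with ε hε
        constructor <;> refine intervalIntegrable_hilbertKernel h1 fun x hx => ?_ <;>
          rw [Set.uIcc_of_le (by linarith)] at hx
        · exact (by linarith [hx.2] : x < 0).ne
        · exact (by linarith [hx.1] : 0 < x).ne'
      · refine Tendsto.congr (fun ε => ?_) (by simpa [singularTerm] using tendsto_const_nhds)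
        have := intervalIntegral.integral_comp_neg (a := ε) (b := R) (hilbertKernel ν 0)
        rw [zero_sub, zero_add, ← this]
        have e : ∀ x, hilbertKernel ν 0 (-x) = -hilbertKernel ν 0 x := fun x => by
          rw [hilbertKernel_neg ν 0 x, neg_neg, neg_zero]
        simp only [e, intervalIntegral.integral_neg]
        simp
  · exact hpos ω h (by rwa [abs_of_pos h] at hω)

/-! ### Principal value of a power series -/

theorem hasSum_of_eq {f g : ℕ → ℂ} {a b : ℂ} (h : HasSum f a) (hfg : ∀ n, g n = f n)
    (hab : b = a) : HasSum g b := by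
  rw [hab, funext hfg]
  exact h

/-- For `0 < ν < 1` this keeps the denominators `j - k - ν` uniformly away from `0`; it is also why
no logarithm enters the finite parts. -/
theorem min_le_abs_intCast_sub {ν : ℝ} (n : ℤ) : min ν (1 - ν) ≤ |(n : ℝ) - ν| := by
  rcases le_or_gt n 0 with h | h
  · have : (n : ℝ) ≤ 0 := by exact_mod_cast h
    refine (min_le_left _ _).trans (le_trans ?_ (neg_le_abs _))
    linarith
  · have : (1 : ℝ) ≤ n := by exact_mod_cast h
    refine (min_le_right _ _).trans (le_trans ?_ (le_abs_self _))
    linarith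

theorem norm_neg_one_pow_sub_one_le (n : ℕ) : ‖(-1 : ℂ) ^ n - 1‖ ≤ 2 := by
  refine (norm_sub_le _ _).trans ?_
  simp
  norm_num

/-- The bound is a product of a function of `k` and one of `j`, so that the double series is
dominated by a geometric series in `|ω|/R` times the Taylor majorant at `R`. -/
theorem norm_finiteMoment_le {ν R : ℝ} (h0 : 0 < ν) (h1 : ν < 1) (hR : 0 < R) (k j : ℕ) :
    ‖finiteMoment ν R k j‖ ≤ 2 * R ^ (-ν) / min ν (1 - ν) * (R⁻¹ ^ k * R ^ j) := by
  have hδ : 0 < min ν (1 - ν) := lt_min h0 (by linarith)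
  have hden : min ν (1 - ν) ≤ |(j : ℝ) - k - ν| := by
    have := min_le_abs_intCast_sub (ν := ν) ((j : ℤ) - k)
    push_cast at this
    exact this
  have hpow : R ^ ((j : ℝ) - k - ν) = R ^ (-ν) * (R⁻¹ ^ k * R ^ j) := by
    rw [show (j : ℝ) - k - ν = -ν + (-(k : ℝ) + j) by ring, Real.rpow_add hR, Real.rpow_add hR,
      Real.rpow_neg hR.le (k : ℝ), Real.rpow_natCast, Real.rpow_natCast, inv_pow]
  rw [finiteMoment, norm_mul, Complex.norm_real, norm_div, Real.norm_eq_abs, Real.norm_eq_abs,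
    abs_of_pos (Real.rpow_pos_of_pos hR _), hpow]
  calc ‖(-1 : ℂ) ^ (k + j) - 1‖ * (R ^ (-ν) * (R⁻¹ ^ k * R ^ j) / |(j : ℝ) - k - ν|)
      ≤ 2 * (R ^ (-ν) * (R⁻¹ ^ k * R ^ j) / min ν (1 - ν)) := by
        gcongr
        exact norm_neg_one_pow_sub_one_le _
    _ = _ := by ring

/-- Exponent and parity depend on `j - k` only. Hence multiplication of the function by `x` shifts
the power series by one power of `ω`. -/
theorem finiteMoment_succ_succ (ν R : ℝ) (k j : ℕ) :
    finiteMoment ν R (k + 1) (j + 1) = finiteMoment ν R k j := by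
  rw [finiteMoment, finiteMoment]
  have e1 : ((j + 1 : ℕ) : ℝ) - ((k + 1 : ℕ) : ℝ) - ν = j - k - ν := by push_cast; ring
  have e2 : k + 1 + (j + 1) = (k + j) + 2 := by ring
  rw [e1, e2, pow_add]
  norm_num

/-- Here `x^j |x|^(-ν)` is integrable at `0`, so the finite part is an ordinary integral; folding `x
↦ -x` gives the factor `(-1)^j + 1 = -((-1)^(j+1) - 1)`. -/
theorem integral_pow_mul_inv_abs_rpow {ν R : ℝ} (h1 : ν < 1) (hR : 0 < R) (j : ℕ) :
    ∫ x in (-R)..R, (x : ℂ) ^ j * (((|x| ^ ν)⁻¹ : ℝ) : ℂ) = -finiteMoment ν R 0 (j + 1) := by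
  have hi : ∀ a b, IntervalIntegrable (fun x : ℝ => x ^ j * (|x| ^ ν)⁻¹) volume a b := fun a b =>
    (intervalIntegrable_inv_abs_rpow h1 a b).continuousOn_mul (by fun_prop)
  have hj : (0 : ℝ) ≤ j := j.cast_nonneg
  have hpos : ∫ x in (0 : ℝ)..R, x ^ j * (|x| ^ ν)⁻¹ =
      R ^ (((j + 1 : ℕ) : ℝ) - (0 : ℕ) - ν) / (((j + 1 : ℕ) : ℝ) - (0 : ℕ) - ν) := by
    have e : ∫ x in (0 : ℝ)..R, x ^ j * (|x| ^ ν)⁻¹ = ∫ x in (0 : ℝ)..R, x ^ ((j : ℝ) - ν) := by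
      rw [intervalIntegral.integral_of_le hR.le, intervalIntegral.integral_of_le hR.le]
      refine setIntegral_congr_fun measurableSet_Ioc fun x hx => ?_
      rw [inv_abs_rpow_eq_rpow_neg hx.1.le, ← Real.rpow_natCast, ← Real.rpow_add hx.1,
        sub_eq_add_neg]
    rw [e, integral_rpow (Or.inl (by linarith)), Real.zero_rpow (by linarith), sub_zero]
    congr 1
    · congr 1; push_cast; ring
    · push_cast; ring
  have hneg : ∫ x in (-R)..0, x ^ j * (|x| ^ ν)⁻¹ =
      (-1) ^ j * ∫ x in (0 : ℝ)..R, x ^ j * (|x| ^ ν)⁻¹ := by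
    have := intervalIntegral.integral_comp_neg (a := 0) (b := R) fun x : ℝ => x ^ j * (|x| ^ ν)⁻¹
    rw [neg_zero] at this
    rw [← this, ← intervalIntegral.integral_const_mul]
    refine intervalIntegral.integral_congr fun x _ => ?_
    rw [neg_pow, abs_neg, mul_assoc]
  have hall : ∫ x in (-R)..R, x ^ j * (|x| ^ ν)⁻¹ =
      ((-1) ^ j + 1) * (R ^ (((j + 1 : ℕ) : ℝ) - (0 : ℕ) - ν) / (((j + 1 : ℕ) : ℝ) - (0 : ℕ) - ν)) := by
    rw [← intervalIntegral.integral_add_adjacent_intervals (hi (-R) 0) (hi 0 R), hneg, hpos]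
    ring
  have hc : ∫ x in (-R)..R, (x : ℂ) ^ j * (((|x| ^ ν)⁻¹ : ℝ) : ℂ) =
      ((∫ x in (-R)..R, x ^ j * (|x| ^ ν)⁻¹ : ℝ) : ℂ) := by
    rw [← intervalIntegral.integral_ofReal]
    simp only [Complex.ofReal_mul, Complex.ofReal_pow]
  rw [hc, hall, finiteMoment, Complex.ofReal_mul, ← neg_mul]
  congr 1
  push_cast
  ring

/-- The divided difference `(x^j - ω^j) / (x - ω)`. -/
noncomputable def powDiff (ω : ℝ) (j : ℕ) (x : ℝ) : ℂ :=
  ∑ i ∈ Finset.range j, (x : ℂ) ^ i * (ω : ℂ) ^ (j - 1 - i)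

theorem powDiff_mul (ω : ℝ) (j : ℕ) (x : ℝ) :
    powDiff ω j x * ((x : ℂ) - ω) = (x : ℂ) ^ j - (ω : ℂ) ^ j :=
  (Commute.all _ _).geom_sum₂_mul j

theorem powDiff_succ (ω : ℝ) (j : ℕ) (x : ℝ) :
    powDiff ω (j + 1) x = (x : ℂ) ^ j + ω * powDiff ω j x := by
  rw [powDiff, powDiff, Nat.add_sub_cancel]
  exact (Commute.all _ _).geom_sum₂_succ_eq

theorem continuous_powDiff (ω : ℝ) (j : ℕ) : Continuous (powDiff ω j) := by
  unfold powDiff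
  fun_prop

/-- Termwise bounds give the real divided difference `(R^j - |ω|^j)/(R - |ω|)`. The gap `R - |ω|`
avoids a factor `j`, so summability at `R` itself suffices. -/
theorem norm_powDiff_le {ω R x : ℝ} (hω : |ω| < R) (hx : |x| ≤ R) (j : ℕ) :
    ‖powDiff ω j x‖ ≤ R ^ j / (R - |ω|) := by
  have hR : 0 ≤ R := (abs_nonneg ω).trans hω.le
  rw [le_div_iff₀ (sub_pos.2 hω)]
  have h1 : ‖powDiff ω j x‖ ≤ ∑ i ∈ Finset.range j, R ^ i * |ω| ^ (j - 1 - i) := by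
    refine (norm_sum_le _ _).trans (Finset.sum_le_sum fun i _ => ?_)
    rw [norm_mul, norm_pow, norm_pow, Complex.norm_real, Complex.norm_real, Real.norm_eq_abs,
      Real.norm_eq_abs]
    gcongr
  have h2 := (Commute.all R |ω|).geom_sum₂_mul j
  calc ‖powDiff ω j x‖ * (R - |ω|)
      ≤ (∑ i ∈ Finset.range j, R ^ i * |ω| ^ (j - 1 - i)) * (R - |ω|) := by
        gcongr
    _ = R ^ j - |ω| ^ j := h2
    _ ≤ R ^ j := by
        have : 0 ≤ |ω| ^ j := by positivity
        linarith

theorem intervalIntegrable_mul_inv_abs_rpow {ν : ℝ} (h1 : ν < 1) {a b : ℝ} {q : ℝ → ℂ}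
    (hq : ContinuousOn q (Set.uIcc a b)) :
    IntervalIntegrable (fun x => q x * (((|x| ^ ν)⁻¹ : ℝ) : ℂ)) volume a b := by
  have h := intervalIntegrable_inv_abs_rpow h1 a b
  have h' : IntervalIntegrable (fun x : ℝ => (((|x| ^ ν)⁻¹ : ℝ) : ℂ)) volume a b :=
    ⟨h.1.ofReal, h.2.ofReal⟩
  exact h'.continuousOn_mul hq

/-- The power series in `ω` attached to the monomial `x^j`. -/
theorem hasSum_finiteMoment {ν ω R : ℝ} (h1 : ν < 1) (hR : 0 < R) {S : ℂ}
    (hS : HasSum (fun k : ℕ => (ω : ℂ) ^ k * finiteMoment ν R k 0) S) (j : ℕ) :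
    HasSum (fun k : ℕ => (ω : ℂ) ^ k * finiteMoment ν R k j)
      ((ω : ℂ) ^ j * S - ∫ x in (-R)..R, powDiff ω j x * (((|x| ^ ν)⁻¹ : ℝ) : ℂ)) := by
  induction j with
  | zero => simpa [powDiff] using hS
  | succ j ih =>
    -- The terms with index at least `1` are `ω` times the series for `x^j`. The term of index `0`
    -- matches the summand `x^j` that `powDiff` gains.
    rw [← hasSum_nat_add_iff' 1]
    have h := ih.mul_left (ω : ℂ)
    simp only [finiteMoment_succ_succ, Finset.sum_range_one, pow_zero, one_mul]
    have e1 : ∫ x in (-R)..R, powDiff ω (j + 1) x * (((|x| ^ ν)⁻¹ : ℝ) : ℂ) =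
        -finiteMoment ν R 0 (j + 1) +
          ω * ∫ x in (-R)..R, powDiff ω j x * (((|x| ^ ν)⁻¹ : ℝ) : ℂ) := by
      rw [← integral_pow_mul_inv_abs_rpow h1 hR, ← intervalIntegral.integral_const_mul,
        ← intervalIntegral.integral_add]
      · simp only [powDiff_succ, add_mul, mul_assoc]
      · exact intervalIntegrable_mul_inv_abs_rpow h1 (by fun_prop)
      · exact (intervalIntegrable_mul_inv_abs_rpow h1
          (continuous_powDiff ω j).continuousOn).const_mul _
    rw [e1]
    have e2 : ∀ k : ℕ, (ω : ℂ) ^ (k + 1) * finiteMoment ν R k j =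
        ω * ((ω : ℂ) ^ k * finiteMoment ν R k j) := fun k => by ring
    exact hasSum_of_eq h e2 (by ring)

theorem hilbertIntegrand_eq_mul_hilbertKernel (ν : ℝ) (f : ℝ → ℂ) (ω x : ℝ) :
    hilbertIntegrand ν f ω x = f x * hilbertKernel ν ω x := by
  rw [hilbertIntegrand, hilbertKernel, ← mul_inv, Complex.ofReal_inv, div_eq_mul_inv]

/-- The principal value over an interval on which `f` is the sum of its Taylor series. -/
theorem exists_intervalPV_of_hasSum {ν ω R : ℝ} (h0 : 0 < ν) (h1 : ν < 1) (hω : |ω| < R)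
    {f : ℝ → ℂ} {al : ℕ → ℂ} (hs : Summable fun j => ‖al j‖ * R ^ j)
    (hf : ∀ x : ℝ, |x| ≤ R → HasSum (fun j => al j * (x : ℂ) ^ j) (f x)) :
    ∃ S : ℂ, HasSum (fun k : ℕ => (ω : ℂ) ^ k * ∑' j, al j * finiteMoment ν R k j) S ∧
      IntervalPV (hilbertIntegrand ν f ω) ω R (S + singularTerm ν f ω) := by
  have hR : 0 < R := (abs_nonneg ω).trans_lt hω
  have hgap : 0 < R - |ω| := sub_pos.2 hω
  obtain ⟨S₀, hS₀, hPV₀⟩ := exists_intervalPV_hilbertKernel h0 h1 hω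
  set W : ℝ → ℂ := fun x => (((|x| ^ ν)⁻¹ : ℝ) : ℂ) with hW
  -- `Q` is the divided difference of `f`, summed termwise; unlike the quotient it needs no special
  -- value at `x = ω`.
  set Q : ℝ → ℂ := fun x => ∑' j, al j * powDiff ω j x with hQ
  have hmem : ∀ x ∈ Set.uIcc (-R) R, |x| ≤ R := fun x hx => by
    rw [Set.uIcc_of_le (by linarith)] at hx
    exact abs_le.2 hx
  have hs' : Summable fun j => ‖al j‖ * (R ^ j / (R - |ω|)) := by
    simpa only [mul_div_assoc] using hs.div_const (R - |ω|)
  have hbound : ∀ (j : ℕ) (x : ℝ), |x| ≤ R →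
      ‖al j * powDiff ω j x‖ ≤ ‖al j‖ * (R ^ j / (R - |ω|)) := fun j x hx => by
    rw [norm_mul]
    gcongr
    exact norm_powDiff_le hω hx j
  have hQs : ∀ x, |x| ≤ R → HasSum (fun j => al j * powDiff ω j x) (Q x) := fun x hx =>
    (Summable.of_norm_bounded hs' fun j => hbound j x hx).hasSum
  have hQc : ContinuousOn Q (Set.uIcc (-R) R) :=
    continuousOn_tsum (fun j => (continuous_const.mul (continuous_powDiff ω j)).continuousOn) hs'
      fun j x hx => hbound j x (hmem x hx)
  have hQW : IntervalIntegrable (fun x => Q x * W x) volume (-R) R :=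
    intervalIntegrable_mul_inv_abs_rpow h1 hQc
  have hQint : HasSum (fun j => al j * ∫ x in (-R)..R, powDiff ω j x * W x)
      (∫ x in (-R)..R, Q x * W x) := by
    have hWi := intervalIntegrable_inv_abs_rpow h1 (-R) R
    have := intervalIntegral.hasSum_integral_of_dominated_convergence (a := -R) (b := R)
      (μ := volume) (F := fun j x => al j * powDiff ω j x * W x) (f := fun x => Q x * W x)
      (fun j x => ‖al j‖ * (R ^ j / (R - |ω|)) * (|x| ^ ν)⁻¹) ?_ ?_ ?_ ?_ ?_
    · simpa only [mul_assoc, intervalIntegral.integral_const_mul] using this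
    · intro j
      have hj : IntervalIntegrable (fun x => al j * powDiff ω j x * W x) volume (-R) R :=
        intervalIntegrable_mul_inv_abs_rpow h1
          (continuous_const.mul (continuous_powDiff ω j)).continuousOn
      exact hj.def'.aestronglyMeasurable
    · intro j
      refine Eventually.of_forall fun x hx => ?_
      have hWn : 0 ≤ (|x| ^ ν)⁻¹ := by positivity
      rw [norm_mul, hW, Complex.norm_real, Real.norm_of_nonneg hWn]
      gcongr
      exact hbound j x (hmem x (Set.uIoc_subset_uIcc hx))
    · exact Eventually.of_forall fun x _ => hs'.mul_right _
    · simp only [tsum_mul_right]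
      exact hWi.const_mul _
    · exact Eventually.of_forall fun x hx =>
        (hQs x (hmem x (Set.uIoc_subset_uIcc hx))).mul_right _
  have hfac : ∀ x, |x| ≤ R → f x = f ω + Q x * ((x : ℂ) - ω) := by
    intro x hx
    have e1 := (hQs x hx).mul_right ((x : ℂ) - ω)
    have e2 := (hf x hx).sub (hf ω hω.le)
    have e3 : ∀ j, al j * powDiff ω j x * ((x : ℂ) - ω) = al j * (x : ℂ) ^ j - al j * (ω : ℂ) ^ j :=
      fun j => by rw [mul_assoc, powDiff_mul]; ring
    simp only [e3] at e1
    rw [e1.unique e2]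
    ring
  have hPV : IntervalPV (hilbertIntegrand ν f ω) ω R
      (f ω * (S₀ + singularTerm ν 1 ω) + -1 * ∫ x in (-R)..R, Q x * W x) := by
    refine ((hPV₀.const_mul (f ω)).add
      ((IntervalPV.of_intervalIntegrable hω hQW).const_mul (-1))).congr hω fun x hx hxω => ?_
    rw [hilbertIntegrand_eq_mul_hilbertKernel, hfac x hx, hilbertKernel, hW]
    have : (ω : ℂ) - x ≠ 0 := by
      rw [← Complex.ofReal_sub]
      exact Complex.ofReal_ne_zero.2 (sub_ne_zero.2 hxω.symm)
    push_cast
    field_simp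
    ring
  -- Summing over `k` first gives the known values for the monomials `x^j`; summing over `j` first
  -- gives a power series in `ω`. Absolute summability identifies the two.
  have hdouble : Summable fun p : ℕ × ℕ => (ω : ℂ) ^ p.2 * (al p.1 * finiteMoment ν R p.2 p.1) := by
    have hgeo : Summable fun k : ℕ => (|ω| * R⁻¹) ^ k :=
      summable_geometric_of_lt_one (by positivity)
        (by rw [← div_eq_mul_inv]; exact (div_lt_one hR).2 hω)
    have := (hs.mul_of_nonneg hgeo (fun j => by positivity) (fun k => by positivity)).mul_left
      (2 * R ^ (-ν) / min ν (1 - ν))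
    refine Summable.of_norm_bounded this fun p => ?_
    rw [norm_mul, norm_mul, norm_pow, Complex.norm_real, Real.norm_eq_abs]
    calc |ω| ^ p.2 * (‖al p.1‖ * ‖finiteMoment ν R p.2 p.1‖)
        ≤ |ω| ^ p.2 * (‖al p.1‖ *
          (2 * R ^ (-ν) / min ν (1 - ν) * (R⁻¹ ^ p.2 * R ^ p.1))) := by
          gcongr
          exact norm_finiteMoment_le h0 h1 hR _ _
      _ = _ := by rw [mul_pow]; ring
  have hsum_j : HasSum (fun j => al j * ((ω : ℂ) ^ j * S₀ - ∫ x in (-R)..R, powDiff ω j x * W x))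
      (f ω * S₀ - ∫ x in (-R)..R, Q x * W x) := by
    exact hasSum_of_eq (((hf ω hω.le).mul_right S₀).sub hQint) (fun j => by ring) rfl
  have hprod := hdouble.hasSum
  have hrow := hprod.prod_fiberwise fun j => by
    have := (hasSum_finiteMoment h1 hR hS₀ j).mul_left (al j)
    simpa only [mul_left_comm] using this
  have hval := hrow.unique hsum_j
  rw [hval] at hprod
  refine ⟨_, ((Equiv.prodComm ℕ ℕ).hasSum_iff.2 hprod).prod_fiberwise fun k => ?_, ?_⟩
  · have hk : Summable fun j => (ω : ℂ) ^ k * (al j * finiteMoment ν R k j) :=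
      (((Equiv.prodComm ℕ ℕ).summable_iff.2 hdouble).prod_factor k)
    have := hk.hasSum
    rw [tsum_mul_left] at this
    exact this
  · convert hPV using 1
    simp only [singularTerm, Pi.one_apply]
    ring

/-! ### Finite parts of the coefficient integrals -/

/-- The integrand `((-1)^k f(-x) - f(x)) / x^(k+ν+1)` of the `k`-th coefficient. -/
noncomputable def coeffIntegrand (ν : ℝ) (f : ℝ → ℂ) (k : ℕ) (x : ℝ) : ℂ :=
  ((-1) ^ k * f (-x) - f x) / ((x ^ ((k : ℝ) + ν + 1) : ℝ) : ℂ)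

/-- The finite part of `∫_0^A` of the `k`-th coefficient integrand is `L`, the divergent part being
the one given by the Taylor coefficients `al` of `f`. -/
def HasTaylorFinitePart (ν : ℝ) (f : ℝ → ℂ) (al : ℕ → ℂ) (k : ℕ) (A : ℝ) (L : ℂ) : Prop :=
  Tendsto (fun ε => (∫ x in ε..A, coeffIntegrand ν f k x) +
    ∑ j ∈ Finset.range (k + 1), al j * finiteMoment ν ε k j) (𝓝[>] 0) (𝓝 L)

theorem continuousOn_coeffIntegrand {ν B : ℝ} {f : ℝ → ℂ} (hf : ContinuousOn f (Set.Icc (-B) B))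
    (k : ℕ) : ContinuousOn (coeffIntegrand ν f k) (Set.Ioc 0 B) := by
  have h1 : ContinuousOn f (Set.Ioc 0 B) :=
    hf.mono fun x hx => ⟨by linarith [hx.1, hx.2], hx.2⟩
  have h2 : ContinuousOn (fun x => f (-x)) (Set.Ioc 0 B) :=
    hf.comp continuousOn_neg fun x hx => ⟨by linarith [hx.2], by linarith [hx.1, hx.2]⟩
  refine ((continuousOn_const.mul h2).sub h1).div ?_ fun x hx => ?_
  · refine Complex.continuous_ofReal.comp_continuousOn ?_
    exact continuousOn_id.rpow_const fun x hx => Or.inl hx.1.ne'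
  · exact Complex.ofReal_ne_zero.2 (Real.rpow_pos_of_pos hx.1 _).ne'

theorem intervalIntegrable_coeffIntegrand {ν B : ℝ} {f : ℝ → ℂ}
    (hf : ContinuousOn f (Set.Icc (-B) B)) (k : ℕ) {x y : ℝ} (hx : x ∈ Set.Ioc 0 B)
    (hy : y ∈ Set.Ioc 0 B) : IntervalIntegrable (coeffIntegrand ν f k) volume x y :=
  ((continuousOn_coeffIntegrand hf k).mono
    (Set.ordConnected_Ioc.uIcc_subset hx hy)).intervalIntegrable

theorem coeffIntegrand_pow (ν : ℝ) (k j : ℕ) {x : ℝ} (hx : 0 < x) :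
    coeffIntegrand ν (fun x => (x : ℂ) ^ j) k x =
      ((-1) ^ (k + j) - 1) * ((x ^ ((j : ℝ) - k - ν - 1) : ℝ) : ℂ) := by
  have e : x ^ ((j : ℝ) - k - ν - 1) = x ^ j / x ^ ((k : ℝ) + ν + 1) := by
    rw [← Real.rpow_natCast, ← Real.rpow_sub hx]
    congr 1
    ring
  rw [coeffIntegrand, e]
  push_cast
  rw [neg_pow, pow_add]
  ring

theorem natCast_sub_sub_ne_zero {ν : ℝ} (h0 : 0 < ν) (h1 : ν < 1) (k j : ℕ) :
    (j : ℝ) - k - ν ≠ 0 := by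
  have h := min_le_abs_intCast_sub (ν := ν) ((j : ℤ) - k)
  push_cast at h
  exact abs_pos.1 ((lt_min h0 (by linarith)).trans_le h)

theorem integral_coeffIntegrand_pow {ν : ℝ} (h0 : 0 < ν) (h1 : ν < 1) (k j : ℕ) {ε R : ℝ}
    (hε : 0 < ε) (hR : ε ≤ R) :
    ∫ x in ε..R, coeffIntegrand ν (fun x => (x : ℂ) ^ j) k x =
      finiteMoment ν R k j - finiteMoment ν ε k j := by
  have hne := natCast_sub_sub_ne_zero h0 h1 k j
  have e : ∫ x in ε..R, coeffIntegrand ν (fun x => (x : ℂ) ^ j) k x =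
      ∫ x in ε..R, ((-1 : ℂ) ^ (k + j) - 1) * ((x ^ ((j : ℝ) - k - ν - 1) : ℝ) : ℂ) := by
    refine intervalIntegral.integral_congr fun x hx => ?_
    rw [Set.uIcc_of_le hR] at hx
    exact coeffIntegrand_pow ν k j (hε.trans_le hx.1)
  rw [e, intervalIntegral.integral_const_mul, intervalIntegral.integral_ofReal, integral_rpow,
    finiteMoment, finiteMoment, ← mul_sub, ← Complex.ofReal_sub, sub_add_cancel, sub_div]
  refine Or.inr ⟨fun h => hne (by linarith), ?_⟩
  rw [Set.uIcc_of_le hR]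
  exact fun h => absurd h.1 (not_le.2 hε)

theorem norm_coeffIntegrand_le {ν M ε x : ℝ} {f : ℝ → ℂ} {k : ℕ} (h0 : 0 < ν) (hε : 0 < ε)
    (hx : ε ≤ x) (h1 : ‖f x‖ ≤ M) (h2 : ‖f (-x)‖ ≤ M) :
    ‖coeffIntegrand ν f k x‖ ≤ 2 * M / ε ^ ((k : ℝ) + ν + 1) := by
  have hk : (0 : ℝ) ≤ k := k.cast_nonneg
  have hM : 0 ≤ M := (norm_nonneg _).trans h1
  have hp : 0 < ε ^ ((k : ℝ) + ν + 1) := Real.rpow_pos_of_pos hε _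
  rw [coeffIntegrand, norm_div, Complex.norm_real, Real.norm_of_nonneg (Real.rpow_nonneg
    (hε.le.trans hx) _)]
  gcongr
  refine (norm_sub_le _ _).trans ?_
  rw [norm_mul, norm_pow, norm_neg, norm_one, one_pow, one_mul]
  linarith

theorem hasSum_coeffIntegrand {ν x : ℝ} {f : ℝ → ℂ} {al : ℕ → ℂ} (k : ℕ)
    (h1 : HasSum (fun j => al j * (x : ℂ) ^ j) (f x))
    (h2 : HasSum (fun j => al j * ((-x : ℝ) : ℂ) ^ j) (f (-x))) :
    HasSum (fun j => al j * coeffIntegrand ν (fun x => (x : ℂ) ^ j) k x)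
      (coeffIntegrand ν f k x) :=
  hasSum_of_eq (((h2.mul_left ((-1) ^ k)).sub h1).div_const _)
    (fun j => by rw [coeffIntegrand]; ring) rfl

/-- Termwise integration of the Taylor series in a coefficient integrand. -/
theorem hasSum_integral_coeffIntegrand {ν : ℝ} (h0 : 0 < ν) (h1 : ν < 1) {R ε : ℝ} (hε : 0 < ε)
    (hR : ε ≤ R) {f : ℝ → ℂ} {al : ℕ → ℂ} (hs : Summable fun j => ‖al j‖ * R ^ j)
    (hf : ∀ x : ℝ, |x| ≤ R → HasSum (fun j => al j * (x : ℂ) ^ j) (f x)) (k : ℕ) :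
    HasSum (fun j => al j * (finiteMoment ν R k j - finiteMoment ν ε k j))
      (∫ x in ε..R, coeffIntegrand ν f k x) := by
  have hmem : ∀ x ∈ Set.uIoc ε R, ε ≤ x ∧ |x| ≤ R ∧ |-x| ≤ R := fun x hx => by
    rw [Set.uIoc_of_le hR] at hx
    have : 0 < x := hε.trans hx.1
    rw [abs_neg, abs_of_pos this]
    exact ⟨hx.1.le, hx.2, hx.2⟩
  have hmono : ∀ j x, |x| ≤ R → ‖(x : ℂ) ^ j‖ ≤ R ^ j := fun j x hx => by
    rw [norm_pow, Complex.norm_real, Real.norm_eq_abs]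
    gcongr
  have hs' : Summable fun j => ‖al j‖ * (2 * R ^ j / ε ^ ((k : ℝ) + ν + 1)) :=
    (hs.mul_right (2 / ε ^ ((k : ℝ) + ν + 1))).congr fun j => by ring
  have := intervalIntegral.hasSum_integral_of_dominated_convergence (a := ε) (b := R)
      (μ := volume) (F := fun j x => al j * coeffIntegrand ν (fun x => (x : ℂ) ^ j) k x)
      (f := coeffIntegrand ν f k) (fun j _ => ‖al j‖ * (2 * R ^ j / ε ^ ((k : ℝ) + ν + 1)))
      ?_ ?_ ?_ ?_ ?_
  · simpa only [intervalIntegral.integral_const_mul,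
      integral_coeffIntegrand_pow h0 h1 k _ hε hR] using this
  · intro j
    exact ((intervalIntegrable_coeffIntegrand (B := R) (by fun_prop) k ⟨hε, hR⟩
      ⟨hε.trans_le hR, le_rfl⟩).const_mul (al j)).aestronglyMeasurable_restrict_uIoc
  · intro j
    refine Eventually.of_forall fun x hx => ?_
    obtain ⟨hx1, hx2, hx3⟩ := hmem x hx
    rw [norm_mul]
    gcongr
    exact norm_coeffIntegrand_le h0 hε hx1 (hmono j x hx2) (hmono j (-x) hx3)
  · exact Eventually.of_forall fun x _ => hs'
  · exact intervalIntegrable_const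
  · exact Eventually.of_forall fun x hx =>
      hasSum_coeffIntegrand k (hf x (hmem x hx).2.1) (hf (-x) (hmem x hx).2.2)

theorem summable_mul_finiteMoment {ν : ℝ} (h0 : 0 < ν) (h1 : ν < 1) {R : ℝ} (hR : 0 < R)
    {al : ℕ → ℂ} (hs : Summable fun j => ‖al j‖ * R ^ j) (k : ℕ) :
    Summable fun j => ‖al j‖ * ‖finiteMoment ν R k j‖ := by
  refine Summable.of_nonneg_of_le (fun j => by positivity) (fun j => ?_)
    (hs.mul_left (2 * R ^ (-ν) / min ν (1 - ν) * R⁻¹ ^ k))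
  calc ‖al j‖ * ‖finiteMoment ν R k j‖
      ≤ ‖al j‖ * (2 * R ^ (-ν) / min ν (1 - ν) * (R⁻¹ ^ k * R ^ j)) := by
        gcongr
        exact norm_finiteMoment_le h0 h1 hR k j
    _ = _ := by ring

/-- As `ν < 1`, the exponent `j - k - ν` is positive for `j > k`: these terms do not diverge, and
monotonicity in `ε` supplies a dominating series. -/
theorem finiteMoment_bound_and_tendsto {ν : ℝ} (h1 : ν < 1) {k j : ℕ} (hkj : k < j) {R : ℝ} :
    (∀ ε, 0 < ε → ε ≤ R → ‖finiteMoment ν ε k j‖ ≤ ‖finiteMoment ν R k j‖) ∧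
      Tendsto (fun ε => finiteMoment ν ε k j) (𝓝[>] 0) (𝓝 0) := by
  have hjk : (k : ℝ) + 1 ≤ j := by exact_mod_cast hkj
  have hs : 0 < (j : ℝ) - k - ν := by linarith
  constructor
  · intro ε hε hR
    rw [finiteMoment, finiteMoment, norm_mul, norm_mul, Complex.norm_real, Complex.norm_real,
      Real.norm_of_nonneg (by positivity),
      Real.norm_of_nonneg (div_nonneg (Real.rpow_nonneg (hε.le.trans hR) _) hs.le)]
    gcongr
  · have h : Tendsto (fun ε : ℝ => ε ^ ((j : ℝ) - k - ν) / ((j : ℝ) - k - ν)) (𝓝[>] 0) (𝓝 0) := by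
      have h2 := ((Real.continuous_rpow_const hs.le).div_const ((j : ℝ) - k - ν)).tendsto 0
      rw [Real.zero_rpow hs.ne', zero_div] at h2
      exact h2.mono_left nhdsWithin_le_nhds
    have h3 := ((Complex.continuous_ofReal.tendsto 0).comp h).const_mul ((-1 : ℂ) ^ (k + j) - 1)
    rw [Complex.ofReal_zero, mul_zero] at h3
    exact h3

/-- After termwise integration over `[ε, R]`, the compensator cancels exactly the lower-endpoint
terms with `j ≤ k`; those with `j > k` tend to `0` under a common summable bound. -/
theorem hasTaylorFinitePart_of_hasSum {ν : ℝ} (h0 : 0 < ν) (h1 : ν < 1) {R : ℝ} (hR : 0 < R)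
    {f : ℝ → ℂ} {al : ℕ → ℂ} (hs : Summable fun j => ‖al j‖ * R ^ j)
    (hf : ∀ x : ℝ, |x| ≤ R → HasSum (fun j => al j * (x : ℂ) ^ j) (f x)) (k : ℕ) :
    HasTaylorFinitePart ν f al k R (∑' j, al j * finiteMoment ν R k j) := by
  have hsm := summable_mul_finiteMoment h0 h1 hR hs k
  have hev : ∀ᶠ ε in 𝓝[>] (0 : ℝ), 0 < ε ∧ ε < R := eventually_lt_nhdsGT_zero hR
  have hlim := tendsto_tsum_of_dominated_convergence (𝓕 := 𝓝[>] (0 : ℝ))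
    (f := fun ε j => al j * (finiteMoment ν R k j - if j ≤ k then 0 else finiteMoment ν ε k j))
    (g := fun j => al j * finiteMoment ν R k j) (hsm.mul_left 2) ?_ ?_
  · refine hlim.congr' ?_
    filter_upwards [hev] with ε ⟨hε, hεR⟩
    have e1 := hasSum_integral_coeffIntegrand h0 h1 hε hεR.le hs hf k
    have e2 : HasSum (fun j => if j ≤ k then al j * finiteMoment ν ε k j else 0)
        (∑ j ∈ Finset.range (k + 1), al j * finiteMoment ν ε k j) := by
      have := hasSum_sum_of_ne_finset_zero (L := SummationFilter.unconditional ℕ)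
        (f := fun j => if j ≤ k then al j * finiteMoment ν ε k j else 0)
        (s := Finset.range (k + 1)) fun j hj => by
          rw [Finset.mem_range] at hj
          exact if_neg (by omega)
      rwa [Finset.sum_congr rfl fun j hj =>
        if_pos (Nat.lt_succ_iff.1 (Finset.mem_range.1 hj))] at this
    refine (hasSum_of_eq (e1.add e2) (fun j => ?_) rfl).tsum_eq
    split_ifs <;> ring
  · intro j
    by_cases hj : j ≤ k
    · simp [hj]
    · have := ((finiteMoment_bound_and_tendsto (R := R) h1 (not_le.1 hj)).2.const_sub
        (finiteMoment ν R k j)).const_mul (al j)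
      simpa [hj] using this
  · filter_upwards [hev] with ε ⟨hε, hεR⟩ j
    rw [norm_mul, two_mul, ← mul_add]
    gcongr
    refine (norm_sub_le _ _).trans ?_
    gcongr
    split_ifs with hj
    · simp
    · exact (finiteMoment_bound_and_tendsto h1 (not_le.1 hj)).1 ε hε hεR.le

namespace HasTaylorFinitePart

variable {ν A B R : ℝ} {f : ℝ → ℂ} {al : ℕ → ℂ} {k : ℕ} {L L' : ℂ}

/-- The compensator is prescribed by `al`, so uniqueness is that of a limit. This is what makes the
coefficients independent of the auxiliary radius. -/
theorem unique (h : HasTaylorFinitePart ν f al k A L) (h' : HasTaylorFinitePart ν f al k A L') :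
    L = L' :=
  tendsto_nhds_unique h h'

theorem extend (h : HasTaylorFinitePart ν f al k R L) (hf : ContinuousOn f (Set.Icc (-B) B))
    (hR : R ∈ Set.Ioc 0 B) (hA : A ∈ Set.Ioc 0 B) :
    HasTaylorFinitePart ν f al k A (L + ∫ x in R..A, coeffIntegrand ν f k x) := by
  refine (h.add_const _).congr' ?_
  filter_upwards [eventually_lt_nhdsGT_zero hR.1] with ε hε
  rw [← intervalIntegral.integral_add_adjacent_intervals
    (intervalIntegrable_coeffIntegrand hf k (x := ε) ⟨hε.1, hε.2.le.trans hR.2⟩ hR)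
    (intervalIntegrable_coeffIntegrand hf k hR hA)]
  ring

theorem hasFinitePartOn (h0 : 0 < ν) (h : HasTaylorFinitePart ν f al k A L)
    (hf : ContinuousOn f (Set.Icc (-A) A)) (hA : 0 < A) :
    HasFinitePartOn (coeffIntegrand ν f k) A L := by
  have hinj : Function.Injective fun j : ℕ => (k : ℝ) + ν - j := fun i j hij => by
    simpa using hij
  -- The divergent powers are `ε^(-p)` with `p = k + ν - j`, `j ≤ k`, all positive. The map `j ↦ p`
  -- is injective, so `Function.extend` reads the coefficient of `ε^(-p)` off `j`. The logarithm has
  -- coefficient `0`.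
  refine ⟨fun ε hε => ?_, (Finset.range (k + 1)).image fun j : ℕ => (k : ℝ) + ν - j,
    Function.extend (fun j : ℕ => (k : ℝ) + ν - j) (fun j =>
      -(al j * (((-1) ^ (k + j) - 1) / (((j : ℝ) - k - ν : ℝ) : ℂ)))) 0, 0, ?_, ?_⟩
  · rcases le_or_gt ε A with hεA | hεA
    · exact (intervalIntegrable_iff_integrableOn_Ioc_of_le hεA).1
        (intervalIntegrable_coeffIntegrand hf k ⟨hε, hεA⟩ ⟨hA, le_rfl⟩)
    · rw [Set.Ioc_eq_empty (not_lt.2 hεA.le)]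
      exact integrableOn_empty
  · intro p hp
    obtain ⟨j, hj, rfl⟩ := Finset.mem_image.1 hp
    have : (j : ℝ) ≤ k := by exact_mod_cast Nat.lt_succ_iff.1 (Finset.mem_range.1 hj)
    linarith
  · refine h.congr' ?_
    filter_upwards [eventually_lt_nhdsGT_zero hA] with ε hε
    rw [intervalIntegral.integral_of_le hε.2.le, Finset.sum_image fun i _ j _ hij => hinj hij,
      zero_mul, add_zero, sub_eq_add_neg, ← Finset.sum_neg_distrib]
    congr 1
    refine Finset.sum_congr rfl fun j _ => ?_
    rw [hinj.extend_apply, finiteMoment, show -((k : ℝ) + ν - j) = (j : ℝ) - k - ν by ring]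
    push_cast
    ring

end HasTaylorFinitePart

/-! ### Contribution away from the origin -/

theorem coeffIntegrand_eq {ν x : ℝ} (hx : 0 < x) (f : ℝ → ℂ) (k : ℕ) :
    coeffIntegrand ν f k x =
      ((-1) ^ k * f (-x) - f x) * (((|x| ^ ν)⁻¹ : ℝ) : ℂ) * ((x : ℂ)⁻¹) ^ (k + 1) := by
  have e : x ^ ((k : ℝ) + ν + 1) = x ^ ν * x ^ (k + 1) := by
    rw [← Real.rpow_natCast x (k + 1), ← Real.rpow_add hx]
    congr 1
    push_cast
    ring
  rw [coeffIntegrand, e, abs_of_pos hx, div_eq_mul_inv, mul_assoc]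
  push_cast
  rw [mul_inv, inv_pow]

theorem hilbertIntegrand_add_neg_eq {ν ω x : ℝ} (hω : |ω| < x) (f : ℝ → ℂ) :
    hilbertIntegrand ν f ω x + hilbertIntegrand ν f ω (-x) =
      f (-x) * (((|x| ^ ν)⁻¹ : ℝ) : ℂ) * (x : ℂ)⁻¹ * (1 - -(ω : ℂ) * (x : ℂ)⁻¹)⁻¹ -
      f x * (((|x| ^ ν)⁻¹ : ℝ) : ℂ) * (x : ℂ)⁻¹ * (1 - (ω : ℂ) * (x : ℂ)⁻¹)⁻¹ := by
  obtain ⟨h1, h2⟩ := abs_lt.1 hω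
  have hx : (x : ℂ) ≠ 0 := Complex.ofReal_ne_zero.2 ((abs_nonneg ω).trans_lt hω).ne'
  have h3 : (x : ℂ) - ω ≠ 0 := by
    rw [← Complex.ofReal_sub]
    exact Complex.ofReal_ne_zero.2 (by linarith)
  have h4 : (x : ℂ) + ω ≠ 0 := by
    rw [← Complex.ofReal_add]
    exact Complex.ofReal_ne_zero.2 (by linarith)
  have e1 : (x : ℂ)⁻¹ * (1 - -(ω : ℂ) * (x : ℂ)⁻¹)⁻¹ = ((x : ℂ) + ω)⁻¹ := by
    rw [← mul_inv]; congr 1; field_simp; ring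
  have e2 : (x : ℂ)⁻¹ * (1 - (ω : ℂ) * (x : ℂ)⁻¹)⁻¹ = ((x : ℂ) - ω)⁻¹ := by
    rw [← mul_inv]; congr 1; field_simp
  rw [mul_assoc (f (-x) * _), mul_assoc (f x * _), e1, e2, hilbertIntegrand_eq_mul_hilbertKernel,
    hilbertIntegrand_eq_mul_hilbertKernel, hilbertKernel, hilbertKernel, abs_neg]
  push_cast
  rw [sub_neg_eq_add, add_comm (ω : ℂ) x, ← neg_sub (x : ℂ) ω, inv_neg]
  ring

/-- For `x > |ω|` both `1/(ω - x)` and `1/(ω + x)` are geometric series in `ω/x`; folding `x` with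
`-x` collects their terms into the coefficient integrands. -/
theorem hasSum_pow_mul_coeffIntegrand {ν ω x : ℝ} (hω : |ω| < x) (f : ℝ → ℂ) :
    HasSum (fun k : ℕ => (ω : ℂ) ^ k * coeffIntegrand ν f k x)
      (hilbertIntegrand ν f ω x + hilbertIntegrand ν f ω (-x)) := by
  have hx : 0 < x := (abs_nonneg ω).trans_lt hω
  have hn : ‖(ω : ℂ) * (x : ℂ)⁻¹‖ < 1 := by
    rw [norm_mul, norm_inv, Complex.norm_real, Complex.norm_real, Real.norm_eq_abs, Real.norm_eq_abs,
      abs_of_pos hx, ← div_eq_mul_inv]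
    exact (div_lt_one hx).2 hω
  have hn' : ‖-(ω : ℂ) * (x : ℂ)⁻¹‖ < 1 := by rwa [neg_mul, norm_neg]
  have h := ((hasSum_geometric_of_norm_lt_one hn').mul_left
      (f (-x) * (((|x| ^ ν)⁻¹ : ℝ) : ℂ) * (x : ℂ)⁻¹)).sub
    ((hasSum_geometric_of_norm_lt_one hn).mul_left (f x * (((|x| ^ ν)⁻¹ : ℝ) : ℂ) * (x : ℂ)⁻¹))
  refine hasSum_of_eq h (fun k => ?_) (hilbertIntegrand_add_neg_eq hω f)
  rw [coeffIntegrand_eq hx, mul_pow, mul_pow, neg_pow (ω : ℂ), pow_succ]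
  ring

theorem intervalIntegrable_hilbertIntegrand {ν : ℝ} (h1 : ν < 1) {f : ℝ → ℂ} {ω a b : ℝ}
    (hf : ContinuousOn f (Set.uIcc a b)) (h : ∀ x ∈ Set.uIcc a b, x ≠ ω) :
    IntervalIntegrable (hilbertIntegrand ν f ω) volume a b := by
  simp only [funext (hilbertIntegrand_eq_mul_hilbertKernel ν f ω)]
  exact (intervalIntegrable_hilbertKernel h1 h).continuousOn_mul hf

theorem integral_hilbertIntegrand_tails {ν R A : ℝ} (h1 : ν < 1) {ω : ℝ}
    (hω : |ω| < R) (hA : R ≤ A) {f : ℝ → ℂ} (hf : ContinuousOn f (Set.Icc (-A) A)) :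
    IntervalIntegrable (hilbertIntegrand ν f ω) volume (-A) (-R) ∧
      IntervalIntegrable (hilbertIntegrand ν f ω) volume R A ∧
      (∫ x in (-A)..(-R), hilbertIntegrand ν f ω x) + ∫ x in R..A, hilbertIntegrand ν f ω x =
        ∫ x in R..A, (hilbertIntegrand ν f ω x + hilbertIntegrand ν f ω (-x)) := by
  obtain ⟨hω1, hω2⟩ := abs_lt.1 hω
  have hl : IntervalIntegrable (hilbertIntegrand ν f ω) volume (-A) (-R) := by
    refine intervalIntegrable_hilbertIntegrand h1 (hf.mono ?_) fun x hx => ?_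
    · rw [Set.uIcc_of_le (by linarith)]
      exact Set.Icc_subset_Icc_right (by linarith)
    · rw [Set.uIcc_of_le (by linarith)] at hx
      exact (by linarith [hx.2] : x < ω).ne
  have hr : IntervalIntegrable (hilbertIntegrand ν f ω) volume R A := by
    refine intervalIntegrable_hilbertIntegrand h1 (hf.mono ?_) fun x hx => ?_
    · rw [Set.uIcc_of_le (by linarith)]
      exact Set.Icc_subset_Icc_left (by linarith)
    · rw [Set.uIcc_of_le (by linarith)] at hx
      exact (by linarith [hx.1] : ω < x).ne'
  have hl' : IntervalIntegrable (fun x => hilbertIntegrand ν f ω (-x)) volume R A := by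
    have := (IntervalIntegrable.iff_comp_neg (by simp)).1 hl.symm
    simpa using this
  refine ⟨hl, hr, ?_⟩
  rw [intervalIntegral.integral_add hr hl', intervalIntegral.integral_comp_neg, add_comm]

/-- The contribution of `R ≤ |x| ≤ A` as a power series in `ω`. -/
theorem hasSum_integral_tails {ν R A : ℝ} (h0 : 0 < ν) {ω : ℝ}
    (hω : |ω| < R) (hA : R ≤ A) {f : ℝ → ℂ} (hf : ContinuousOn f (Set.Icc (-A) A)) :
    HasSum (fun k : ℕ => (ω : ℂ) ^ k * ∫ x in R..A, coeffIntegrand ν f k x)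
      (∫ x in R..A, (hilbertIntegrand ν f ω x + hilbertIntegrand ν f ω (-x))) := by
  have hR : 0 < R := (abs_nonneg ω).trans_lt hω
  obtain ⟨M, hM⟩ := isCompact_Icc.exists_bound_of_continuousOn hf
  have hM0 : 0 ≤ M := (norm_nonneg _).trans (hM A ⟨by linarith, le_rfl⟩)
  have hgeo : Summable fun k : ℕ => |ω| ^ k * (2 * M / R ^ ((k : ℝ) + ν + 1)) := by
    have := (summable_geometric_of_lt_one (r := |ω| / R) (by positivity)
      ((div_lt_one hR).2 hω)).mul_left (2 * M / R ^ (ν + 1))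
    refine this.congr fun k => ?_
    rw [add_assoc, Real.rpow_add hR (k : ℝ), Real.rpow_natCast, div_pow]
    have := (Real.rpow_pos_of_pos hR (ν + 1)).ne'
    field_simp
  have hmem : ∀ x ∈ Set.uIoc R A, R ≤ x ∧ x ∈ Set.Icc (-A) A ∧ -x ∈ Set.Icc (-A) A := by
    intro x hx
    rw [Set.uIoc_of_le hA] at hx
    exact ⟨hx.1.le, ⟨by linarith [hx.1], hx.2⟩, ⟨by linarith [hx.2], by linarith [hx.1]⟩⟩
  have := intervalIntegral.hasSum_integral_of_dominated_convergence (a := R) (b := A)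
      (μ := volume) (F := fun (k : ℕ) x => (ω : ℂ) ^ k * coeffIntegrand ν f k x)
      (f := fun x => hilbertIntegrand ν f ω x + hilbertIntegrand ν f ω (-x))
      (fun k _ => |ω| ^ k * (2 * M / R ^ ((k : ℝ) + ν + 1))) ?_ ?_ ?_ ?_ ?_
  · simpa only [intervalIntegral.integral_const_mul] using this
  · intro k
    exact ((intervalIntegrable_coeffIntegrand hf k ⟨hR, hA⟩
      ⟨hR.trans_le hA, le_rfl⟩).const_mul _).aestronglyMeasurable_restrict_uIoc
  · intro k
    refine Eventually.of_forall fun x hx => ?_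
    obtain ⟨hx1, hx2, hx3⟩ := hmem x hx
    rw [norm_mul, norm_pow, Complex.norm_real, Real.norm_eq_abs]
    gcongr
    exact norm_coeffIntegrand_le h0 hR hx1 (hM x hx2) (hM _ hx3)
  · exact Eventually.of_forall fun x _ => hgeo
  · exact intervalIntegrable_const
  · exact Eventually.of_forall fun x hx =>
      hasSum_pow_mul_coeffIntegrand (hω.trans_le (hmem x hx).1) f

/-- The coefficient of `ω^k` for the interval `[-A, A]`, computed with the Taylor series on
`[-R, R]`. -/
noncomputable def coeffValue (ν : ℝ) (f : ℝ → ℂ) (al : ℕ → ℂ) (R : ℝ) (k : ℕ) (A : ℝ) : ℂ :=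
  (∑' j, al j * finiteMoment ν R k j) + ∫ x in R..A, coeffIntegrand ν f k x

/-- The principal value over a bounded interval. -/
theorem exists_intervalPV {ν R A : ℝ} (h0 : 0 < ν) (h1 : ν < 1) {ω : ℝ} (hω : |ω| < R)
    (hA : R ≤ A) {f : ℝ → ℂ} {al : ℕ → ℂ} (hs : Summable fun j => ‖al j‖ * R ^ j)
    (hf : ∀ x : ℝ, |x| ≤ R → HasSum (fun j => al j * (x : ℂ) ^ j) (f x))
    (hfc : ContinuousOn f (Set.Icc (-A) A)) :
    ∃ S₀ : ℂ, HasSum (fun k : ℕ => (ω : ℂ) ^ k * ∑' j, al j * finiteMoment ν R k j) S₀ ∧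
      IntervalPV (hilbertIntegrand ν f ω) ω A
        (S₀ + (∫ x in R..A, (hilbertIntegrand ν f ω x + hilbertIntegrand ν f ω (-x))) +
          singularTerm ν f ω) := by
  obtain ⟨S₀, hS₀, hPV⟩ := exists_intervalPV_of_hasSum h0 h1 hω hs hf
  obtain ⟨hl, hr, he⟩ := integral_hilbertIntegrand_tails h1 hω hA hfc
  refine ⟨S₀, hS₀, ?_⟩
  have := hPV.extend hl hr
  rw [he] at this
  convert this using 1
  ring

/-! ### Abel's test -/

section AbelTest

variable {g : ℝ → ℂ} {φ φ' : ℝ → ℝ} {ρ R M : ℝ}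

/-- Integration by parts against the primitive of `g` that vanishes at `R`. Continuity beyond `ρ <
R` makes that primitive differentiable from both sides at `R`. -/
theorem integral_eq_of_continuousOn_Ioi (hg : ContinuousOn g (Set.Ioi ρ)) (hR : ρ < R)
    (hφ : ∀ x, R ≤ x → HasDerivAt φ (φ' x) x) (hφc : ContinuousOn φ' (Set.Ici R)) {A : ℝ}
    (hA : R ≤ A) :
    ∫ x in R..A, (φ x : ℂ) * g x =
      φ A * (∫ x in R..A, g x) - ∫ x in R..A, (φ' x : ℂ) * ∫ t in R..x, g t := by
  have hsub : Set.uIcc R A ⊆ Set.Ici R := by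
    rw [Set.uIcc_of_le hA]
    exact Set.Icc_subset_Ici_self
  have hint : ∀ x, R ≤ x → IntervalIntegrable g volume R x := fun x hx =>
    (hg.mono fun y hy => by
      rw [Set.uIcc_of_le hx] at hy
      exact hR.trans_le hy.1).intervalIntegrable
  have h := intervalIntegral.integral_mul_deriv_eq_deriv_mul (a := R) (b := A)
    (u := fun x => (φ x : ℂ)) (v := fun x => ∫ t in R..x, g t) (u' := fun x => (φ' x : ℂ)) (v' := g)
    (fun x hx => (hφ x (hsub hx)).ofReal_comp) (fun x hx => ?_) ?_ (hint A hA)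
  · rw [h, intervalIntegral.integral_same, mul_zero, sub_zero]
  · have hx0 : x ∈ Set.Ioi ρ := hR.trans_le (hsub hx)
    exact intervalIntegral.integral_hasDerivAt_right (hint x (hsub hx))
      (hg.stronglyMeasurableAtFilter isOpen_Ioi x hx0) (hg.continuousAt (Ioi_mem_nhds hx0))
  · exact (Complex.continuous_ofReal.comp_continuousOn (hφc.mono hsub)).intervalIntegrable

/-- After integration by parts the boundary term is at most `φ(A) M` and the remaining integral at
most `(φ(R) - φ(A)) M`; the sum telescopes. The bound involves neither `A` nor the integral of
`‖g‖`. -/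
theorem norm_integral_mul_le_of_antitone (hg : ContinuousOn g (Set.Ioi ρ)) (hR : ρ < R)
    (hφ : ∀ x, R ≤ x → HasDerivAt φ (φ' x) x) (hφc : ContinuousOn φ' (Set.Ici R))
    (hφ' : ∀ x, R ≤ x → φ' x ≤ 0) (hφ0 : ∀ x, R ≤ x → 0 ≤ φ x)
    (hM : ∀ x, R ≤ x → ‖∫ t in R..x, g t‖ ≤ M) {A : ℝ} (hA : R ≤ A) :
    ‖∫ x in R..A, (φ x : ℂ) * g x‖ ≤ φ R * M := by
  have hsub : Set.uIcc R A ⊆ Set.Ici R := by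
    rw [Set.uIcc_of_le hA]
    exact Set.Icc_subset_Ici_self
  have hii : IntervalIntegrable φ' volume R A := (hφc.mono hsub).intervalIntegrable
  have hftc : ∫ x in R..A, φ' x = φ A - φ R :=
    intervalIntegral.integral_eq_sub_of_hasDerivAt (fun x hx => hφ x (hsub hx)) hii
  have h1 : ‖∫ x in R..A, (φ' x : ℂ) * ∫ t in R..x, g t‖ ≤ ∫ x in R..A, -φ' x * M := by
    refine intervalIntegral.norm_integral_le_of_norm_le hA (Eventually.of_forall fun x hx => ?_)
      (hii.neg.mul_const M)
    rw [norm_mul, Complex.norm_real, Real.norm_of_nonpos (hφ' x hx.1.le)]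
    exact mul_le_mul_of_nonneg_left (hM x hx.1.le) (by linarith [hφ' x hx.1.le])
  have h2 : ∫ x in R..A, -φ' x * M = (φ R - φ A) * M := by
    rw [intervalIntegral.integral_mul_const, intervalIntegral.integral_neg, hftc, neg_sub]
  rw [integral_eq_of_continuousOn_Ioi hg hR hφ hφc hA]
  refine (norm_sub_le _ _).trans ?_
  rw [norm_mul, Complex.norm_real, Real.norm_of_nonneg (hφ0 A hA)]
  nlinarith [mul_le_mul_of_nonneg_left (hM A hA) (hφ0 A hA)]

/-- The primitive is bounded near infinity because it converges, and on the remaining compact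
interval because it is continuous. -/
theorem exists_bound_of_tendsto_integral (hg : ContinuousOn g (Set.Ioi ρ)) (hR : ρ < R)
    (hlim : ∃ l, Tendsto (fun A => ∫ x in R..A, g x) atTop (𝓝 l)) :
    ∃ M, ∀ x, R ≤ x → ‖∫ t in R..x, g t‖ ≤ M := by
  obtain ⟨l, hl⟩ := hlim
  obtain ⟨B, hB⟩ := eventually_atTop.1 (hl.norm.eventually (gt_mem_nhds (lt_add_one ‖l‖)))
  have hint : IntervalIntegrable g volume R (max R B) :=
    (hg.mono fun y hy => by
      rw [Set.uIcc_of_le (le_max_left _ _)] at hy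
      exact hR.trans_le hy.1).intervalIntegrable
  have hc := intervalIntegral.continuousOn_primitive_interval
    ((intervalIntegrable_iff' (by simp)).1 hint)
  obtain ⟨C, hC⟩ := isCompact_uIcc.exists_bound_of_continuousOn hc
  refine ⟨max C (‖l‖ + 1), fun x hx => ?_⟩
  rcases le_total x (max R B) with h | h
  · refine (hC x ?_).trans (le_max_left _ _)
    rw [Set.uIcc_of_le (le_max_left _ _)]
    exact ⟨hx, h⟩
  · exact (hB x ((le_max_right _ _).trans h)).le.trans (le_max_right _ _)

/-- Abel's test for improper integrals. -/
theorem exists_tendsto_integral_mul (hg : ContinuousOn g (Set.Ioi ρ)) (hR : ρ < R)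
    (hφ : ∀ x, R ≤ x → HasDerivAt φ (φ' x) x) (hφc : ContinuousOn φ' (Set.Ici R))
    (hφ' : ∀ x, R ≤ x → φ' x ≤ 0) (hφl : ∃ l, Tendsto φ atTop (𝓝 l))
    (hlim : ∃ l, Tendsto (fun A => ∫ x in R..A, g x) atTop (𝓝 l)) :
    ∃ l, Tendsto (fun A => ∫ x in R..A, (φ x : ℂ) * g x) atTop (𝓝 l) := by
  obtain ⟨M, hM⟩ := exists_bound_of_tendsto_integral hg hR hlim
  obtain ⟨l, hl⟩ := hlim
  obtain ⟨b, hb⟩ := hφl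
  -- A monotone function with a limit has integrable derivative; multiplied by the bounded primitive
  -- of `g` it stays integrable.
  have hφi : IntegrableOn φ' (Set.Ioi R) :=
    integrableOn_Ioi_deriv_of_nonpos (hφ R le_rfl).continuousAt.continuousWithinAt
      (fun x hx => hφ x (le_of_lt hx)) (fun x hx => hφ' x (le_of_lt hx)) hb
  have hGc : ContinuousOn (fun x => ∫ t in R..x, g t) (Set.Ioi R) := by
    intro x hx
    have hx0 : x ∈ Set.Ioi ρ := hR.trans hx
    refine (intervalIntegral.integral_hasDerivAt_right ?_
      (hg.stronglyMeasurableAtFilter isOpen_Ioi x hx0)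
      (hg.continuousAt (Ioi_mem_nhds hx0))).continuousAt.continuousWithinAt
    exact (hg.mono fun y hy => by
      rw [Set.uIcc_of_le (le_of_lt hx)] at hy
      exact hR.trans_le hy.1).intervalIntegrable
  have hI : IntegrableOn (fun x => (φ' x : ℂ) * ∫ t in R..x, g t) (Set.Ioi R) :=
    Integrable.mul_bdd (c := M) hφi.ofReal (hGc.aestronglyMeasurable measurableSet_Ioi)
      ((ae_restrict_iff' measurableSet_Ioi).2 (Eventually.of_forall fun x hx => hM x (le_of_lt hx)))
  refine ⟨_, ((((Complex.continuous_ofReal.tendsto b).comp hb).mul hl).sub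
    (intervalIntegral_tendsto_integral_Ioi R hI tendsto_id)).congr' ?_⟩
  filter_upwards [eventually_ge_atTop R] with A hA
  exact (integral_eq_of_continuousOn_Ioi hg hR hφ hφc hA).symm

end AbelTest

/-! ### Convergence of the coefficient integrals on the line -/

theorem hasDerivAt_inv_sq_pow (n : ℕ) {x : ℝ} (hx : x ≠ 0) :
    HasDerivAt (fun x : ℝ => (x⁻¹ ^ 2) ^ n) (-(2 * n * (x⁻¹ ^ 2) ^ n * x⁻¹)) x := by
  have h := ((hasDerivAt_inv hx).pow 2).pow n
  convert! h using 1
  rcases n with _ | n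
  · simp
  · change _ = ((n + 1 : ℕ) : ℝ) * (x⁻¹ ^ 2) ^ n * ((2 : ℕ) * x⁻¹ ^ 1 * -(x ^ 2)⁻¹)
    rw [← inv_pow]
    push_cast
    ring

theorem continuousOn_Ici_inv {R : ℝ} (hR : 0 < R) :
    ContinuousOn (fun x : ℝ => x⁻¹) (Set.Ici R) :=
  continuousOn_inv₀.mono fun _ hx => (hR.trans_le hx).ne'

theorem mul_inv_sq_lt_one {ω x : ℝ} (hω : |ω| < x) : (ω * x⁻¹) ^ 2 < 1 := by
  have hx : 0 < x := (abs_nonneg ω).trans_lt hω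
  rw [sq_lt_one_iff_abs_lt_one, abs_mul, abs_inv, abs_of_pos hx, ← div_eq_mul_inv]
  exact (div_lt_one hx).2 hω

theorem hasDerivAt_inv_one_sub_sq {ω x : ℝ} (hω : |ω| < x) :
    HasDerivAt (fun x : ℝ => (1 - (ω * x⁻¹) ^ 2)⁻¹)
      (-(2 * ω ^ 2 * x⁻¹ ^ 3 * ((1 - (ω * x⁻¹) ^ 2)⁻¹) ^ 2)) x := by
  have hx : 0 < x := (abs_nonneg ω).trans_lt hω
  have hne : 1 - (ω * x⁻¹) ^ 2 ≠ 0 := by linarith [mul_inv_sq_lt_one hω]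
  have h := ((((hasDerivAt_inv hx.ne').const_mul ω).pow 2).const_sub 1).inv hne
  convert! h using 1
  change _ = - -((2 : ℕ) * (ω * x⁻¹) ^ 1 * (ω * -(x ^ 2)⁻¹)) / (1 - (ω * x⁻¹) ^ 2) ^ 2
  generalize 1 - (ω * x⁻¹) ^ 2 = d
  rw [← inv_pow, div_eq_mul_inv, ← inv_pow]
  push_cast
  ring

/-- Raising the index by two leaves the sign alone and multiplies by `x^(-2)`, so only the indices
`0` and `1` need a separate convergence argument. -/
theorem coeffIntegrand_add_two_mul {ν x : ℝ} (hx : 0 < x) (f : ℝ → ℂ) (i n : ℕ) :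
    coeffIntegrand ν f (2 * n + i) x =
      (((x⁻¹ ^ 2) ^ n : ℝ) : ℂ) * coeffIntegrand ν f i x := by
  rw [coeffIntegrand_eq hx, coeffIntegrand_eq hx, pow_add (-1 : ℂ) (2 * n), pow_mul, neg_one_sq,
    one_pow, one_mul]
  push_cast
  ring

/-- The closed form of the geometric expansion, even and odd powers of `ω` summed separately: two
integrands and one monotone weight carry all the dependence on `x`. -/
theorem hilbertIntegrand_add_neg_eq_coeffIntegrand {ν ω x : ℝ} (hω : |ω| < x) (f : ℝ → ℂ) :
    hilbertIntegrand ν f ω x + hilbertIntegrand ν f ω (-x) =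
      (((1 - (ω * x⁻¹) ^ 2)⁻¹ : ℝ) : ℂ) *
        (coeffIntegrand ν f 0 x + ω * coeffIntegrand ν f 1 x) := by
  have hx : 0 < x := (abs_nonneg ω).trans_lt hω
  have h1 : (1 : ℂ) - (ω * (x : ℂ)⁻¹) ^ 2 ≠ 0 := by
    have := mul_inv_sq_lt_one hω
    have h2 : (1 - (ω * x⁻¹) ^ 2 : ℝ) ≠ 0 := by linarith
    exact_mod_cast h2
  have e : (1 : ℂ) - (ω * (x : ℂ)⁻¹) ^ 2 =
      (1 - -(ω : ℂ) * (x : ℂ)⁻¹) * (1 - (ω : ℂ) * (x : ℂ)⁻¹) := by ring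
  have h2 := h1
  rw [e] at h2
  have h3 := left_ne_zero_of_mul h2
  have h4 := right_ne_zero_of_mul h2
  have e3 : (1 - -(ω : ℂ) * (x : ℂ)⁻¹)⁻¹ =
      (1 - (ω : ℂ) * (x : ℂ)⁻¹) * (1 - (ω * (x : ℂ)⁻¹) ^ 2)⁻¹ := by
    rw [e, mul_inv, mul_comm (1 - -(ω : ℂ) * (x : ℂ)⁻¹)⁻¹, mul_inv_cancel_left₀ h4]
  have e4 : (1 - (ω : ℂ) * (x : ℂ)⁻¹)⁻¹ =
      (1 - -(ω : ℂ) * (x : ℂ)⁻¹) * (1 - (ω * (x : ℂ)⁻¹) ^ 2)⁻¹ := by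
    rw [e, mul_inv, mul_inv_cancel_left₀ h3]
  rw [hilbertIntegrand_add_neg_eq hω, coeffIntegrand_eq hx, coeffIntegrand_eq hx, e3, e4]
  push_cast
  generalize (1 - ((ω : ℂ) * (x : ℂ)⁻¹) ^ 2)⁻¹ = d
  ring

/-- If two suitable combinations of the tails converge, then all coefficient integrals converge,
with a geometric bound. -/
theorem exists_tendsto_integral_coeffIntegrand {ν R ω : ℝ} (hω0 : ω ≠ 0) (hω : |ω| < R)
    {f : ℝ → ℂ} (hf : Continuous f)
    (hl0 : ∃ l, Tendsto (fun A => ∫ x in R..A,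
      (hilbertIntegrand ν f 0 x + hilbertIntegrand ν f 0 (-x))) atTop (𝓝 l))
    (hlω : ∃ l, Tendsto (fun A => ∫ x in R..A,
      (hilbertIntegrand ν f ω x + hilbertIntegrand ν f ω (-x))) atTop (𝓝 l)) :
    (∀ k, ∃ l, Tendsto (fun A => ∫ x in R..A, coeffIntegrand ν f k x) atTop (𝓝 l)) ∧
      ∃ M, ∀ k A, R ≤ A → ‖∫ x in R..A, coeffIntegrand ν f k x‖ ≤ M * R⁻¹ ^ k := by
  have hR : 0 < R := (abs_nonneg ω).trans_lt hω
  have hcont : ∀ k, ContinuousOn (coeffIntegrand ν f k) (Set.Ioi 0) := fun k x hx =>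
    ((continuousOn_coeffIntegrand (B := x + 1) hf.continuousOn k).continuousAt
      (Ioc_mem_nhds hx (lt_add_one x))).continuousWithinAt
  have hint : ∀ k A, R ≤ A → IntervalIntegrable (coeffIntegrand ν f k) volume R A := fun k A hA =>
    intervalIntegrable_coeffIntegrand (B := A) hf.continuousOn k ⟨hR, hA⟩ ⟨hR.trans_le hA, le_rfl⟩
  have hicc : ∀ A, R ≤ A → ∀ x ∈ Set.uIcc R A, R ≤ x := fun A hA x hx => by
    rw [Set.uIcc_of_le hA] at hx
    exact hx.1
  -- At `ω = 0` the folded integrand is the coefficient integrand of index `0`.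
  have h0 : ∃ l, Tendsto (fun A => ∫ x in R..A, coeffIntegrand ν f 0 x) atTop (𝓝 l) := by
    obtain ⟨l, hl⟩ := hl0
    refine ⟨l, hl.congr' ?_⟩
    filter_upwards [eventually_ge_atTop R] with A hA
    refine intervalIntegral.integral_congr fun x hx => ?_
    have hx0 : |(0 : ℝ)| < x := by simpa using hR.trans_le (hicc A hA x hx)
    simp [hilbertIntegrand_add_neg_eq_coeffIntegrand hx0]
  -- This weight decreases to `1` on `[R, ∞)`, so Abel's test applies to it.
  set ψ : ℝ → ℝ := fun x => (1 - (ω * x⁻¹) ^ 2)⁻¹ with hψ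
  have hψ1 : ∀ x, R ≤ x → (ω * x⁻¹) ^ 2 < 1 := fun x hx => mul_inv_sq_lt_one (hω.trans_le hx)
  have hψcont : ContinuousOn ψ (Set.Ici R) := fun x hx =>
    (hasDerivAt_inv_one_sub_sq (hω.trans_le hx)).continuousAt.continuousWithinAt
  have hinv0 : Tendsto (fun x : ℝ => x⁻¹) atTop (𝓝 0) := tendsto_inv_atTop_zero
  have hψl : ∃ l, Tendsto ψ atTop (𝓝 l) := by
    have := (((hinv0.const_mul ω).pow 2).const_sub 1).inv₀ (by simp)
    exact ⟨_, this⟩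
  have h0ψ : ∃ l, Tendsto (fun A => ∫ x in R..A, (ψ x : ℂ) * coeffIntegrand ν f 0 x)
      atTop (𝓝 l) := by
    refine exists_tendsto_integral_mul (hcont 0) hR
      (fun x hx => hasDerivAt_inv_one_sub_sq (hω.trans_le hx)) ?_ ?_ hψl h0
    · exact ((continuousOn_const.mul ((continuousOn_Ici_inv hR).pow 3)).mul (hψcont.pow 2)).neg
    · intro x hx
      have : 0 < x := hR.trans_le hx
      rw [neg_nonpos]
      positivity
  have hψg : ∀ k A, R ≤ A → IntervalIntegrable (fun x => (ψ x : ℂ) * coeffIntegrand ν f k x)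
      volume R A := fun k A hA => (hint k A hA).continuousOn_mul
    (Complex.continuous_ofReal.comp_continuousOn (hψcont.mono (hicc A hA)))
  -- Subtract the index `0` part from the folded integral at `ω`, then divide by `ω ≠ 0`.
  have h1ψ : ∃ l, Tendsto (fun A => ∫ x in R..A, (ψ x : ℂ) * coeffIntegrand ν f 1 x)
      atTop (𝓝 l) := by
    obtain ⟨l, hl⟩ := hlω
    obtain ⟨l', hl'⟩ := h0ψ
    refine ⟨_, ((hl.sub hl').const_mul (ω : ℂ)⁻¹).congr' ?_⟩
    filter_upwards [eventually_ge_atTop R] with A hA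
    have e : ∫ x in R..A, (hilbertIntegrand ν f ω x + hilbertIntegrand ν f ω (-x)) =
        (∫ x in R..A, (ψ x : ℂ) * coeffIntegrand ν f 0 x) +
          ω * ∫ x in R..A, (ψ x : ℂ) * coeffIntegrand ν f 1 x := by
      rw [← intervalIntegral.integral_const_mul, ← intervalIntegral.integral_add (hψg 0 A hA)
        ((hψg 1 A hA).const_mul _)]
      refine intervalIntegral.integral_congr fun x hx => ?_
      simp only [hilbertIntegrand_add_neg_eq_coeffIntegrand (hω.trans_le (hicc A hA x hx)), hψ]
      ring
    rw [e, add_sub_cancel_left, inv_mul_cancel_left₀ (Complex.ofReal_ne_zero.2 hω0)]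
  have hsq : ∀ n : ℕ, ∀ g : ℝ → ℂ, ContinuousOn g (Set.Ioi |ω|) →
      (∃ l, Tendsto (fun A => ∫ x in R..A, g x) atTop (𝓝 l)) →
      ∃ l, Tendsto (fun A => ∫ x in R..A, (((x⁻¹ ^ 2) ^ n : ℝ) : ℂ) * g x) atTop (𝓝 l) := by
    intro n g hg hgl
    refine exists_tendsto_integral_mul hg hω
      (fun x hx => hasDerivAt_inv_sq_pow n (hR.trans_le hx).ne') ?_ ?_
      ⟨_, (hinv0.pow 2).pow n⟩ hgl
    · exact ((continuousOn_const.mul (((continuousOn_Ici_inv hR).pow 2).pow n)).mul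
        (continuousOn_Ici_inv hR)).neg
    · intro x hx
      have : 0 < x := hR.trans_le hx
      rw [neg_nonpos]
      positivity
  have hsubω : Set.Ioi |ω| ⊆ Set.Ioi 0 := Set.Ioi_subset_Ioi (abs_nonneg ω)
  -- The weight `1/ψ = 1 - ω²/x²` is increasing, so it is split: `∫ ψ g_1` converges already, and
  -- Abel's test with `x^(-2)` handles the rest.
  have h1 : ∃ l, Tendsto (fun A => ∫ x in R..A, coeffIntegrand ν f 1 x) atTop (𝓝 l) := by
    obtain ⟨l, hl⟩ := h1ψ
    obtain ⟨l', hl'⟩ := hsq 1 (fun x => (ψ x : ℂ) * coeffIntegrand ν f 1 x) (by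
      refine ContinuousOn.mul ?_ ((hcont 1).mono hsubω)
      exact Complex.continuous_ofReal.comp_continuousOn fun x hx =>
        (hasDerivAt_inv_one_sub_sq hx).continuousAt.continuousWithinAt) ⟨l, hl⟩
    refine ⟨_, (hl.sub (hl'.const_mul ((ω : ℂ) ^ 2))).congr' ?_⟩
    filter_upwards [eventually_ge_atTop R] with A hA
    have hi : IntervalIntegrable (fun x => (((x⁻¹ ^ 2) ^ 1 : ℝ) : ℂ) *
        ((ψ x : ℂ) * coeffIntegrand ν f 1 x)) volume R A :=
      (hψg 1 A hA).continuousOn_mul (Complex.continuous_ofReal.comp_continuousOn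
        ((((continuousOn_Ici_inv hR).mono (hicc A hA)).pow 2).pow 1))
    rw [← intervalIntegral.integral_const_mul,
      ← intervalIntegral.integral_sub (hψg 1 A hA) (hi.const_mul _)]
    refine intervalIntegral.integral_congr fun x hx => ?_
    have hne : ((1 - (ω * x⁻¹) ^ 2 : ℝ) : ℂ) ≠ 0 :=
      Complex.ofReal_ne_zero.2 (by linarith [hψ1 x (hicc A hA x hx)])
    simp only [hψ]
    calc _ = ((1 - (ω * x⁻¹) ^ 2 : ℝ) : ℂ) * (((1 - (ω * x⁻¹) ^ 2)⁻¹ : ℝ) : ℂ) *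
          coeffIntegrand ν f 1 x := by push_cast; ring
      _ = coeffIntegrand ν f 1 x := by rw [Complex.ofReal_inv, mul_inv_cancel₀ hne, one_mul]
  have hbase : ∀ i, ∃ l, Tendsto (fun A => ∫ x in R..A, coeffIntegrand ν f (i % 2) x)
      atTop (𝓝 l) := fun i => by
    rcases Nat.mod_two_eq_zero_or_one i with h | h <;> rw [h] <;> assumption
  have hred : ∀ k A, R ≤ A → ∫ x in R..A, coeffIntegrand ν f k x =
      ∫ x in R..A, (((x⁻¹ ^ 2) ^ (k / 2) : ℝ) : ℂ) * coeffIntegrand ν f (k % 2) x := by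
    intro k A hA
    refine intervalIntegral.integral_congr fun x hx => ?_
    rw [← coeffIntegrand_add_two_mul (hR.trans_le (hicc A hA x hx)), Nat.div_add_mod]
  refine ⟨fun k => ?_, ?_⟩
  · obtain ⟨l, hl⟩ := hsq (k / 2) _ ((hcont (k % 2)).mono hsubω) (hbase k)
    refine ⟨l, hl.congr' ?_⟩
    filter_upwards [eventually_ge_atTop R] with A hA
    exact (hred k A hA).symm
  · obtain ⟨M₀, hM₀⟩ := exists_bound_of_tendsto_integral (hcont 0) hR h0
    obtain ⟨M₁, hM₁⟩ := exists_bound_of_tendsto_integral (hcont 1) hR h1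
    -- For odd `k = 2n + 1` the bound is `R^(-2n) M₁ = (M₁ R) R^(-k)`, hence the extra factor `R`.
    refine ⟨max M₀ (M₁ * R), fun k A hA => ?_⟩
    have key : ∀ i M, (∀ x, R ≤ x → ‖∫ t in R..x, coeffIntegrand ν f i t‖ ≤ M) →
        ‖∫ x in R..A, (((x⁻¹ ^ 2) ^ (k / 2) : ℝ) : ℂ) * coeffIntegrand ν f i x‖ ≤
          (R⁻¹ ^ 2) ^ (k / 2) * M := by
      intro i M hM
      refine norm_integral_mul_le_of_antitone (φ := fun x => (x⁻¹ ^ 2) ^ (k / 2)) (hcont i) hR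
        (fun x hx => hasDerivAt_inv_sq_pow _ (hR.trans_le hx).ne') ?_ ?_ ?_ hM hA
      · exact ((continuousOn_const.mul (((continuousOn_Ici_inv hR).pow 2).pow _)).mul
          (continuousOn_Ici_inv hR)).neg
      · intro x hx
        have : 0 < x := hR.trans_le hx
        rw [neg_nonpos]
        positivity
      · intro x hx
        positivity
    rw [hred k A hA]
    rcases Nat.mod_two_eq_zero_or_one k with h | h <;> rw [h]
    · refine (key 0 M₀ hM₀).trans ?_
      rw [← pow_mul, show 2 * (k / 2) = k by omega, mul_comm]
      gcongr
      exact le_max_left _ _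
    · refine (key 1 M₁ hM₁).trans ?_
      have e : R⁻¹ ^ k = (R⁻¹ ^ 2) ^ (k / 2) * R⁻¹ := by
        rw [← pow_mul, ← pow_succ, show 2 * (k / 2) + 1 = k by omega]
      rw [e]
      calc (R⁻¹ ^ 2) ^ (k / 2) * M₁ = M₁ * R * ((R⁻¹ ^ 2) ^ (k / 2) * R⁻¹) := by
            field_simp
        _ ≤ _ := by
            gcongr
            exact le_max_right _ _

/-! ### Assembling the general formula -/

theorem exists_radius_between {ω : ℝ} {a ρ : ℝ≥0∞} (ha : ‖ω‖ₑ < a) (hρ : ‖ω‖ₑ < ρ) :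
    ∃ R : ℝ, |ω| < R ∧ ENNReal.ofReal R < a ∧ ENNReal.ofReal R < ρ := by
  obtain ⟨r, h1, h2⟩ := ENNReal.lt_iff_exists_nnreal_btwn.1 (lt_min ha hρ)
  refine ⟨r, ?_, ?_, ?_⟩
  · rw [← ofReal_norm, ENNReal.ofReal, ENNReal.coe_lt_coe] at h1
    exact (Real.toNNReal_lt_iff_lt_coe (norm_nonneg ω)).1 h1
  · rw [ENNReal.ofReal_coe_nnreal]
    exact h2.trans_le (min_le_left _ _)
  · rw [ENNReal.ofReal_coe_nnreal]
    exact h2.trans_le (min_le_right _ _)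

theorem symmInterval_of_ne_top {a : ℝ≥0∞} (ha : a ≠ ∞) :
    symmInterval a = Set.Icc (-a.toReal) a.toReal := by
  ext x
  rw [symmInterval, Set.mem_ofPred_eq, ← ofReal_norm, ENNReal.ofReal_le_iff_le_toReal ha,
    Real.norm_eq_abs, abs_le, Set.mem_Icc]

theorem symmInterval_top : symmInterval ∞ = Set.univ := by
  simp [symmInterval]

theorem ofReal_lt_iff_lt_toReal_of_pos {a : ℝ≥0∞} (ha : a ≠ ∞) {R : ℝ} (hR : 0 < R) :
    ENNReal.ofReal R < a ↔ R < a.toReal :=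
  ENNReal.ofReal_lt_iff_lt_toReal hR.le ha

/-- The finite part over `(0, a)`, `0 < a ≤ ∞`, with the divergent part given by the Taylor
coefficients of `f`. -/
def HasTaylorFinitePartTo (ν : ℝ) (f : ℝ → ℂ) (al : ℕ → ℂ) (k : ℕ) (a : ℝ≥0∞) (L : ℂ) : Prop :=
  (a ≠ ∞ → HasTaylorFinitePart ν f al k a.toReal L) ∧
  (a = ∞ → ∃ P : ℝ → ℂ, (∀ A > 0, HasTaylorFinitePart ν f al k A (P A)) ∧
    Tendsto P atTop (𝓝 L))

theorem hasTaylorFinitePart_coeffValue {ν R A B : ℝ} (h0 : 0 < ν) (h1 : ν < 1) {f : ℝ → ℂ}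
    {al : ℕ → ℂ} (hs : Summable fun j => ‖al j‖ * R ^ j)
    (hf : ∀ x : ℝ, |x| ≤ R → HasSum (fun j => al j * (x : ℂ) ^ j) (f x))
    (hfc : ContinuousOn f (Set.Icc (-B) B)) (hR : R ∈ Set.Ioc 0 B) (hA : A ∈ Set.Ioc 0 B) (k : ℕ) :
    HasTaylorFinitePart ν f al k A (coeffValue ν f al R k A) :=
  (hasTaylorFinitePart_of_hasSum h0 h1 hR.1 hs hf k).extend hfc hR hA

/-- The principal value over a bounded interval as a power series and a singular term. -/
theorem exists_hasSum_coeffValue {ν R A : ℝ} (h0 : 0 < ν) (h1 : ν < 1) {ω : ℝ} (hω : |ω| < R)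
    (hA : R ≤ A) {f : ℝ → ℂ} {al : ℕ → ℂ} (hs : Summable fun j => ‖al j‖ * R ^ j)
    (hf : ∀ x : ℝ, |x| ≤ R → HasSum (fun j => al j * (x : ℂ) ^ j) (f x))
    (hfc : ContinuousOn f (Set.Icc (-A) A)) :
    ∃ S : ℂ, HasSum (fun k : ℕ => (ω : ℂ) ^ k * coeffValue ν f al R k A) S ∧
      IntervalPV (hilbertIntegrand ν f ω) ω A (S + singularTerm ν f ω) := by
  obtain ⟨S₀, hS₀, hPV⟩ := exists_intervalPV h0 h1 hω hA hs hf hfc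
  exact ⟨_, hasSum_of_eq (hS₀.add (hasSum_integral_tails h0 hω hA hfc))
    (fun k => by rw [coeffValue, mul_add]) rfl, hPV⟩

/-- The coefficients are defined with one radius `R₀`. The series at `ω` is obtained with a radius
`R > |ω|`, and uniqueness of the finite part identifies the two sets of coefficients. -/
theorem exists_coeff_of_ne_top {ν : ℝ} (h0 : 0 < ν) (h1 : ν < 1) {a : ℝ≥0∞} (ha : 0 < a)
    (hat : a ≠ ∞) {f : ℝ → ℂ} (hf : ComplexAnalyticOn f (symmInterval a)) {al : ℕ → ℂ}
    (hal : ∀ R : ℝ, 0 < R → ENNReal.ofReal R < a → ENNReal.ofReal R < singularityDistance f →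
        Summable (fun j => ‖al j‖ * R ^ j) ∧
          ∀ x : ℝ, |x| ≤ R → HasSum (fun j => al j * (x : ℂ) ^ j) (f x)) :
    ∃ c : ℕ → ℂ, (∀ k, HasTaylorFinitePartTo ν f al k a (c k)) ∧
      ∀ ω : ℝ, ‖ω‖ₑ < a → ‖ω‖ₑ < singularityDistance f →
        ∃ S : ℂ, HasSum (fun k : ℕ => (ω : ℂ) ^ k * c k) S ∧
          HasPVIntegral (hilbertIntegrand ν f ω) ω a (S + singularTerm ν f ω) := by
  have hfc := hf.continuousOn
  rw [symmInterval_of_ne_top hat] at hfc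
  have hA : 0 < a.toReal := ENNReal.toReal_pos ha.ne' hat
  have hkey : ∀ R : ℝ, 0 < R → ENNReal.ofReal R < a → ENNReal.ofReal R < singularityDistance f →
      ∀ k, HasTaylorFinitePart ν f al k a.toReal (coeffValue ν f al R k a.toReal) :=
    fun R hR hRa hRs k => hasTaylorFinitePart_coeffValue h0 h1 (hal R hR hRa hRs).1
      (hal R hR hRa hRs).2 hfc ⟨hR, ((ofReal_lt_iff_lt_toReal_of_pos hat hR).1 hRa).le⟩ ⟨hA, le_rfl⟩ k
  obtain ⟨R₀, hR₀, hR₀a, hR₀s⟩ := exists_radius_between (ω := 0) (by simpa using ha)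
    (by simpa using singularityDistance_pos ha hf)
  rw [abs_zero] at hR₀
  refine ⟨fun k => coeffValue ν f al R₀ k a.toReal, fun k =>
    ⟨fun _ => hkey R₀ hR₀ hR₀a hR₀s k, fun h => absurd h hat⟩, fun ω hωa hωs => ?_⟩
  obtain ⟨R, hωR, hRa, hRs⟩ := exists_radius_between hωa hωs
  have hR : 0 < R := (abs_nonneg ω).trans_lt hωR
  have hRA : R < a.toReal := (ofReal_lt_iff_lt_toReal_of_pos hat hR).1 hRa
  obtain ⟨S, hS, hPV⟩ := exists_hasSum_coeffValue h0 h1 hωR hRA.le (hal R hR hRa hRs).1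
    (hal R hR hRa hRs).2 hfc
  refine ⟨S, hasSum_of_eq hS (fun k => ?_) rfl, fun _ => hPV.hasPVOn (hωR.trans hRA),
    fun h => absurd h hat⟩
  exact congrArg _ ((hkey R₀ hR₀ hR₀a hR₀s k).unique (hkey R hR hRa hRs k))

theorem HasPVOn.unique {h : ℝ → ℂ} {ω A : ℝ} {L L' : ℂ} (H : HasPVOn h ω A L)
    (H' : HasPVOn h ω A L') : L = L' :=
  tendsto_nhds_unique H.2 H'.2

/-- When the principal values over the line exist, the tails of the folded integrals converge. -/
theorem exists_tendsto_integral_tails {ν R : ℝ} (h0 : 0 < ν) (h1 : ν < 1) {ω : ℝ} (hω : |ω| < R)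
    {f : ℝ → ℂ} {al : ℕ → ℂ} (hs : Summable fun j => ‖al j‖ * R ^ j)
    (hf : ∀ x : ℝ, |x| ≤ R → HasSum (fun j => al j * (x : ℂ) ^ j) (f x)) (hfc : Continuous f)
    (hPV : ∃ L : ℂ, HasPVIntegral (hilbertIntegrand ν f ω) ω ∞ L) :
    ∃ l, Tendsto (fun A => ∫ x in R..A,
      (hilbertIntegrand ν f ω x + hilbertIntegrand ν f ω (-x))) atTop (𝓝 l) := by
  obtain ⟨L, -, hL⟩ := hPV
  obtain ⟨P, hP, hPL⟩ := hL rfl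
  -- The inner contribution `S₀` is the sum of a series in which `A` does not occur, so the tail is
  -- the principal value over `[-A, A]` minus a constant.
  obtain ⟨S₀, hS₀, -⟩ := exists_intervalPV h0 h1 hω le_rfl hs hf hfc.continuousOn
  refine ⟨_, (hPL.sub_const (S₀ + singularTerm ν f ω)).congr' ?_⟩
  filter_upwards [hP, eventually_ge_atTop R] with A hPA hA
  obtain ⟨S₁, hS₁, hPV₁⟩ := exists_intervalPV h0 h1 hω hA hs hf hfc.continuousOn
  rw [hPA.unique (hPV₁.hasPVOn (hω.trans_le hA)), hS₁.unique hS₀]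
  ring

/-- The formula holds on every `[-A, A]` with `A ≥ R`. A bound on the terms that is uniform in `A`
lets the limit pass through the series, which yields the principal value and its expansion together.
-/
theorem exists_coeff_top {ν : ℝ} (h0 : 0 < ν) (h1 : ν < 1) {f : ℝ → ℂ}
    (hf : ComplexAnalyticOn f (symmInterval ∞)) {al : ℕ → ℂ}
    (hal : ∀ R : ℝ, 0 < R → ENNReal.ofReal R < ∞ → ENNReal.ofReal R < singularityDistance f →
        Summable (fun j => ‖al j‖ * R ^ j) ∧
          ∀ x : ℝ, |x| ≤ R → HasSum (fun j => al j * (x : ℂ) ^ j) (f x))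
    (hPV : ∀ ω : ℝ, ‖ω‖ₑ < singularityDistance f →
      ∃ L : ℂ, HasPVIntegral (hilbertIntegrand ν f ω) ω ∞ L) :
    ∃ c : ℕ → ℂ, (∀ k, HasTaylorFinitePartTo ν f al k ∞ (c k)) ∧
      ∀ ω : ℝ, ‖ω‖ₑ < ∞ → ‖ω‖ₑ < singularityDistance f →
        ∃ S : ℂ, HasSum (fun k : ℕ => (ω : ℂ) ^ k * c k) S ∧
          HasPVIntegral (hilbertIntegrand ν f ω) ω ∞ (S + singularTerm ν f ω) := by
  have hfc : Continuous f := by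
    rw [← continuousOn_univ, ← symmInterval_top]
    exact hf.continuousOn
  have hkey : ∀ R : ℝ, 0 < R → ENNReal.ofReal R < singularityDistance f →
      ∀ k A, 0 < A → HasTaylorFinitePart ν f al k A (coeffValue ν f al R k A) :=
    fun R hR hRs k A hA => hasTaylorFinitePart_coeffValue (B := max R A) h0 h1
      (hal R hR ENNReal.ofReal_lt_top hRs).1 (hal R hR ENNReal.ofReal_lt_top hRs).2
      hfc.continuousOn ⟨hR, le_max_left _ _⟩ ⟨hA, le_max_right _ _⟩ k
  have htail : ∀ R : ℝ, 0 < R → ENNReal.ofReal R < singularityDistance f →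
      (∀ k, ∃ l, Tendsto (fun A => ∫ x in R..A, coeffIntegrand ν f k x) atTop (𝓝 l)) ∧
      ∃ M, ∀ k A, R ≤ A → ‖∫ x in R..A, coeffIntegrand ν f k x‖ ≤ M * R⁻¹ ^ k := by
    intro R hR hRs
    have hle : ∀ ω : ℝ, |ω| ≤ R → ‖ω‖ₑ < singularityDistance f := fun ω hω => by
      rw [← ofReal_norm]
      exact (ENNReal.ofReal_le_ofReal hω).trans_lt hRs
    -- Besides `0`, any nonzero point inside the radius would serve; `R / 2` is a convenient one.
    have hhalf : |R / 2| < R := by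
      rw [abs_of_pos (half_pos hR)]
      exact half_lt_self hR
    obtain ⟨hs, hfs⟩ := hal R hR ENNReal.ofReal_lt_top hRs
    exact exists_tendsto_integral_coeffIntegrand (half_pos hR).ne' hhalf hfc
      (exists_tendsto_integral_tails h0 h1 (by simpa using hR) hs hfs hfc
        (hPV 0 (hle 0 (by simpa using hR.le))))
      (exists_tendsto_integral_tails h0 h1 hhalf hs hfs hfc (hPV _ (hle _ hhalf.le)))
  obtain ⟨R₀, hR₀, -, hR₀s⟩ := exists_radius_between (ω := 0) (a := ∞) (by simp)
    (by simpa using singularityDistance_pos ENNReal.zero_lt_top hf)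
  rw [abs_zero] at hR₀
  choose l hl using (htail R₀ hR₀ hR₀s).1
  set c : ℕ → ℂ := fun k => (∑' j, al j * finiteMoment ν R₀ k j) + l k with hc
  have hc0 : ∀ k, Tendsto (coeffValue ν f al R₀ k) atTop (𝓝 (c k)) := fun k =>
    (hl k).const_add _
  have hcR : ∀ R : ℝ, 0 < R → ENNReal.ofReal R < singularityDistance f → ∀ k,
      Tendsto (coeffValue ν f al R k) atTop (𝓝 (c k)) := by
    intro R hR hRs k
    refine (hc0 k).congr' ?_
    filter_upwards [eventually_gt_atTop 0] with A hA
    exact (hkey R₀ hR₀ hR₀s k A hA).unique (hkey R hR hRs k A hA)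
  refine ⟨c, fun k => ⟨fun h => absurd rfl h, fun _ =>
    ⟨_, fun A hA => hkey R₀ hR₀ hR₀s k A hA, hc0 k⟩⟩, fun ω hωa hωs => ?_⟩
  obtain ⟨R, hωR, hRa, hRs⟩ := exists_radius_between hωa hωs
  have hR : 0 < R := (abs_nonneg ω).trans_lt hωR
  obtain ⟨hs, hfs⟩ := hal R hR hRa hRs
  obtain ⟨M, hM⟩ := (htail R hR hRs).2
  have hPVA : ∀ A, R ≤ A → ∃ S : ℂ, HasSum (fun k : ℕ => (ω : ℂ) ^ k * coeffValue ν f al R k A) S ∧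
      IntervalPV (hilbertIntegrand ν f ω) ω A (S + singularTerm ν f ω) := fun A hA =>
    exists_hasSum_coeffValue h0 h1 hωR hA hs hfs hfc.continuousOn
  obtain ⟨S₀, hS₀, -⟩ := exists_intervalPV h0 h1 hωR le_rfl hs hfs hfc.continuousOn
  -- The majorant is the inner series, fixed in `A`, plus the geometric series that comes from the
  -- tail bound `M R^(-k)`.
  have hbs : Summable fun k : ℕ => ‖(ω : ℂ) ^ k * ∑' j, al j * finiteMoment ν R k j‖ +
      M * (|ω| * R⁻¹) ^ k := by
    refine hS₀.summable.norm.add (Summable.mul_left M (summable_geometric_of_lt_one (by positivity)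
      ?_))
    rw [← div_eq_mul_inv]
    exact (div_lt_one hR).2 hωR
  have hb : ∀ A, R ≤ A → ∀ k : ℕ, ‖(ω : ℂ) ^ k * coeffValue ν f al R k A‖ ≤
      ‖(ω : ℂ) ^ k * ∑' j, al j * finiteMoment ν R k j‖ + M * (|ω| * R⁻¹) ^ k := by
    intro A hA k
    rw [coeffValue, mul_add]
    refine (norm_add_le _ _).trans (add_le_add_right ?_ _)
    rw [norm_mul, norm_pow, Complex.norm_real, Real.norm_eq_abs, mul_pow]
    calc |ω| ^ k * ‖∫ x in R..A, coeffIntegrand ν f k x‖ ≤ |ω| ^ k * (M * R⁻¹ ^ k) := by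
          gcongr
          exact hM k A hA
      _ = _ := by ring
  have hterm : ∀ k : ℕ, Tendsto (fun A => (ω : ℂ) ^ k * coeffValue ν f al R k A) atTop
      (𝓝 ((ω : ℂ) ^ k * c k)) := fun k => (hcR R hR hRs k).const_mul _
  have hsum : Summable fun k : ℕ => (ω : ℂ) ^ k * c k :=
    Summable.of_norm_bounded hbs fun k => le_of_tendsto (hterm k).norm
      ((eventually_ge_atTop R).mono fun A hA => hb A hA k)
  have hlim := tendsto_tsum_of_dominated_convergence hbs hterm
    ((eventually_ge_atTop R).mono fun A hA => hb A hA)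
  refine ⟨_, hsum.hasSum, fun h => absurd rfl h, fun _ =>
    ⟨fun A => (∑' k : ℕ, (ω : ℂ) ^ k * coeffValue ν f al R k A) + singularTerm ν f ω, ?_,
      hlim.add_const _⟩⟩
  filter_upwards [eventually_ge_atTop R] with A hA
  obtain ⟨S, hS, hPVS⟩ := hPVA A hA
  rw [hS.tsum_eq]
  exact hPVS.hasPVOn (hωR.trans_le hA)

/-! ### Vanishing coefficients: zeros at the origin and parity -/

theorem HasFinitePartOn.const_mul_congr {h h' : ℝ → ℂ} {A : ℝ} {L : ℂ} (c : ℂ)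
    (H : HasFinitePartOn h A L) (heq : ∀ x ∈ Set.Ioc 0 A, h' x = c * h x) :
    HasFinitePartOn h' A (c * L) := by
  obtain ⟨hint, s, b, d, hs, hlim⟩ := H
  have heq' : ∀ ε, 0 < ε → ∀ x ∈ Set.Ioc ε A, h' x = c * h x := fun ε hε x hx =>
    heq x ⟨hε.trans hx.1, hx.2⟩
  refine ⟨fun ε hε => ?_, s, fun p => c * b p, c * d, hs, (hlim.const_mul c).congr' ?_⟩
  · exact IntegrableOn.congr_fun ((hint ε hε).const_mul c) (fun x hx => (heq' ε hε x hx).symm)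
      measurableSet_Ioc
  · filter_upwards [self_mem_nhdsWithin] with ε hε
    rw [setIntegral_congr_fun measurableSet_Ioc (heq' ε hε), integral_const_mul, mul_sub, mul_add,
      Finset.mul_sum]
    simp only [mul_assoc]

theorem mem_symmInterval_top (x : ℝ) : x ∈ symmInterval ∞ := by
  rw [symmInterval_top]
  trivial

theorem mem_symmInterval_of_mem_Icc {a : ℝ≥0∞} (ha : a ≠ ∞) {x : ℝ}
    (hx : x ∈ Set.Icc (-a.toReal) a.toReal) : x ∈ symmInterval a := by
  rwa [symmInterval_of_ne_top ha]

theorem neg_mem_symmInterval {a : ℝ≥0∞} {x : ℝ} (hx : x ∈ symmInterval a) :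
    -x ∈ symmInterval a := by
  simpa [symmInterval] using hx

namespace HasTaylorFinitePart

variable {ν A : ℝ} {f : ℝ → ℂ} {al : ℕ → ℂ} {k : ℕ} {L : ℂ}

/-- With vanishing Taylor coefficients up to `k` the compensator is zero, and the limit of the
truncated integrals is the integral. -/
theorem eq_integral (h : HasTaylorFinitePart ν f al k A L) (hA : 0 < A)
    (hal : ∀ j ≤ k, al j = 0) (hint : IntegrableOn (coeffIntegrand ν f k) (Set.Ioc 0 A)) :
    L = ∫ x in Set.Ioc 0 A, coeffIntegrand ν f k x := by
  have hii : IntervalIntegrable (coeffIntegrand ν f k) volume A 0 :=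
    ((intervalIntegrable_iff_integrableOn_Ioc_of_le hA.le).2 hint).symm
  have hc := (intervalIntegral.continuousOn_primitive_interval
    ((intervalIntegrable_iff' (by simp)).1 hii)) 0 Set.right_mem_uIcc
  have ht : Tendsto (fun ε : ℝ => ε) (𝓝[>] 0) (𝓝[Set.uIcc A 0] 0) := by
    refine tendsto_nhdsWithin_iff.2 ⟨tendsto_id.mono_left nhdsWithin_le_nhds, ?_⟩
    filter_upwards [eventually_lt_nhdsGT_zero hA] with ε hε
    rw [Set.uIcc_of_ge hA.le]
    exact ⟨hε.1.le, hε.2.le⟩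
  rw [← intervalIntegral.integral_of_le hA.le, intervalIntegral.integral_symm]
  refine tendsto_nhds_unique h ((hc.tendsto.comp ht).neg.congr fun ε => ?_)
  rw [Finset.sum_eq_zero fun j hj => by
    rw [hal j (Nat.lt_succ_iff.1 (Finset.mem_range.1 hj)), zero_mul], add_zero]
  exact (intervalIntegral.integral_symm A ε).symm

/-- Every term of the compensator vanishes too: either its Taylor coefficient is zero, or its parity
factor `(-1)^(k+j) - 1` is. -/
theorem eq_zero (h : HasTaylorFinitePart ν f al k A L) (hA : 0 < A)
    (hal : ∀ j, Odd (j + k) → al j = 0) (hf : ∀ x ∈ Set.Ioc 0 A, coeffIntegrand ν f k x = 0) :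
    L = 0 := by
  refine tendsto_nhds_unique h (tendsto_const_nhds.congr' ?_)
  filter_upwards [eventually_lt_nhdsGT_zero hA] with ε hε
  rw [intervalIntegral.integral_of_le hε.2.le, setIntegral_eq_zero_of_forall_eq_zero fun x hx =>
    hf x ⟨hε.1.trans hx.1, hx.2⟩, zero_add, Finset.sum_eq_zero fun j _ => ?_]
  rcases Nat.even_or_odd (j + k) with hjk | hjk
  · rw [finiteMoment, add_comm k j, hjk.neg_one_pow, sub_self, zero_mul, mul_zero]
  · rw [hal j hjk, zero_mul]

end HasTaylorFinitePart

namespace HasTaylorFinitePartTo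

variable {ν : ℝ} {f h : ℝ → ℂ} {al : ℕ → ℂ} {k : ℕ} {a : ℝ≥0∞} {L : ℂ}

theorem hasFinitePart (H : HasTaylorFinitePartTo ν f al k a L) (h0 : 0 < ν) (ha : 0 < a)
    (hf : ContinuousOn f (symmInterval a)) (c : ℂ)
    (heq : ∀ x : ℝ, 0 < x → x ∈ symmInterval a → h x = c * coeffIntegrand ν f k x) :
    HasFinitePart h a (c * L) := by
  refine ⟨fun hat => ?_, fun hat => ?_⟩
  · have hA : 0 < a.toReal := ENNReal.toReal_pos ha.ne' hat
    refine ((H.1 hat).hasFinitePartOn h0 ?_ hA).const_mul_congr c fun x hx => heq x hx.1 ?_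
    · rwa [← symmInterval_of_ne_top hat]
    · exact mem_symmInterval_of_mem_Icc hat ⟨by linarith [hx.1], hx.2⟩
  · subst hat
    rw [symmInterval_top] at hf
    obtain ⟨P, hP, hPL⟩ := H.2 rfl
    exact ⟨fun A => c * P A, fun A hA => ((hP A hA).hasFinitePartOn h0 (hf.mono (Set.subset_univ _))
      hA).const_mul_congr c fun x hx => heq x hx.1 (mem_symmInterval_top x), hPL.const_mul c⟩

theorem hasConvergentIntegral (H : HasTaylorFinitePartTo ν f al k a L) (ha : 0 < a)
    (hal : ∀ j ≤ k, al j = 0)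
    (hint : ∀ A > 0, (∀ x ∈ Set.Icc (-A) A, x ∈ symmInterval a) →
      IntegrableOn (coeffIntegrand ν f k) (Set.Ioc 0 A)) (c : ℂ)
    (heq : ∀ x : ℝ, 0 < x → x ∈ symmInterval a → h x = c * coeffIntegrand ν f k x) :
    HasConvergentIntegral h a (c * L) := by
  have key : ∀ A > 0, (∀ x ∈ Set.Icc (-A) A, x ∈ symmInterval a) →
      ∀ L, HasTaylorFinitePart ν f al k A L →
      IntegrableOn h (Set.Ioc 0 A) ∧ ∫ x in Set.Ioc 0 A, h x = c * L := by
    intro A hA hAa L hL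
    have heq' : ∀ x ∈ Set.Ioc 0 A, h x = c * coeffIntegrand ν f k x := fun x hx =>
      heq x hx.1 (hAa x ⟨by linarith [hx.1], hx.2⟩)
    refine ⟨IntegrableOn.congr_fun ((hint A hA hAa).const_mul c) (fun x hx => (heq' x hx).symm)
      measurableSet_Ioc, ?_⟩
    rw [setIntegral_congr_fun measurableSet_Ioc heq', integral_const_mul,
      ← hL.eq_integral hA hal (hint A hA hAa)]
  refine ⟨fun hat => ?_, fun hat => ?_⟩
  · exact key _ (ENNReal.toReal_pos ha.ne' hat) (fun x => mem_symmInterval_of_mem_Icc hat) _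
      (H.1 hat)
  · subst hat
    obtain ⟨P, hP, hPL⟩ := H.2 rfl
    have hall : ∀ A : ℝ, ∀ x ∈ Set.Icc (-A) A, x ∈ symmInterval ∞ := fun A x _ =>
      mem_symmInterval_top x
    refine ⟨fun A hA => (key A hA (hall A) _ (hP A hA)).1, (hPL.const_mul c).congr' ?_⟩
    filter_upwards [eventually_gt_atTop 0] with A hA
    exact (key A hA (hall A) _ (hP A hA)).2.symm

theorem eq_zero (H : HasTaylorFinitePartTo ν f al k a L) (ha : 0 < a)
    (hal : ∀ j, Odd (j + k) → al j = 0)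
    (hf : ∀ x : ℝ, 0 < x → x ∈ symmInterval a → coeffIntegrand ν f k x = 0) : L = 0 := by
  rcases eq_or_ne a ∞ with rfl | hat
  · obtain ⟨P, hP, hPL⟩ := H.2 rfl
    refine tendsto_nhds_unique hPL (tendsto_const_nhds.congr' ?_)
    filter_upwards [eventually_gt_atTop 0] with A hA
    exact ((hP A hA).eq_zero hA hal fun x hx => hf x hx.1 (mem_symmInterval_top x)).symm
  · exact (H.1 hat).eq_zero (ENNReal.toReal_pos ha.ne' hat) hal fun x hx =>
      hf x hx.1 (mem_symmInterval_of_mem_Icc hat ⟨by linarith [hx.1, hx.2], hx.2⟩)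

end HasTaylorFinitePartTo

theorem coeffIntegrand_of_eq_pow_mul {ν x : ℝ} (hx : 0 < x) {f g : ℝ → ℂ} {m : ℕ}
    (h1 : f x = (x : ℂ) ^ m * g x) (h2 : f (-x) = ((-x : ℝ) : ℂ) ^ m * g (-x)) (k : ℕ) :
    coeffIntegrand ν f k x =
      ((-1) ^ (k + m) * g (-x) - g x) / ((x ^ ((k : ℝ) - (m : ℝ) + ν + 1) : ℝ) : ℂ) := by
  have e : x ^ ((k : ℝ) + ν + 1) = x ^ m * x ^ ((k : ℝ) - (m : ℝ) + ν + 1) := by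
    rw [← Real.rpow_natCast, ← Real.rpow_add hx]
    congr 1
    ring
  have hxm : ((x : ℂ)) ^ m ≠ 0 := pow_ne_zero _ (Complex.ofReal_ne_zero.2 hx.ne')
  rw [coeffIntegrand, h1, h2, e, Complex.ofReal_mul, Complex.ofReal_pow, Complex.ofReal_neg,
    neg_pow, ← mul_div_mul_left ((-1) ^ (k + m) * g (-x) - g x) _ hxm]
  congr 1
  rw [pow_add]
  ring

/-- When `f(x) = x^m g(x)` the first `m` coefficient integrals converge at `0`. -/
theorem integrableOn_coeffIntegrand_of_eq_pow_mul {ν A : ℝ} (h1 : ν < 1) (hA : 0 < A)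
    {f g : ℝ → ℂ} {m k : ℕ} (hk : k < m) (hg : ContinuousOn g (Set.Icc (-A) A))
    (hfg : ∀ x ∈ Set.Icc (-A) A, f x = (x : ℂ) ^ m * g x) :
    IntegrableOn (coeffIntegrand ν f k) (Set.Ioc 0 A) := by
  -- After cancelling `x^m` the exponent of `x` is at least `-ν > -1`, hence integrable at `0`.
  have hkm : (k : ℝ) + 1 ≤ m := by exact_mod_cast hk
  have hr := intervalIntegral.intervalIntegrable_rpow' (a := 0) (b := A)
    (r := -((k : ℝ) - (m : ℝ) + ν + 1)) (by linarith)
  have hr' : IntervalIntegrable (fun x : ℝ => ((x ^ (-((k : ℝ) - (m : ℝ) + ν + 1)) : ℝ) : ℂ))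
      volume 0 A := ⟨hr.1.ofReal, hr.2.ofReal⟩
  have hgc : ContinuousOn (fun x => (-1) ^ (k + m) * g (-x) - g x) (Set.uIcc 0 A) := by
    rw [Set.uIcc_of_le hA.le]
    refine (continuousOn_const.mul (hg.comp continuousOn_neg fun x hx => ?_)).sub
      (hg.mono (Set.Icc_subset_Icc_left (by linarith)))
    exact ⟨by linarith [hx.2], by linarith [hx.1]⟩
  refine ((intervalIntegrable_iff_integrableOn_Ioc_of_le hA.le).1
    (hr'.continuousOn_mul hgc)).congr_fun (fun x hx => ?_) measurableSet_Ioc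
  simp only
  rw [coeffIntegrand_of_eq_pow_mul hx.1 (hfg x ⟨by linarith [hx.1], hx.2⟩)
    (hfg (-x) ⟨by linarith [hx.2], by linarith [hx.1]⟩), Real.rpow_neg hx.1.le, Complex.ofReal_inv,
    div_eq_mul_inv]

theorem coeffIntegrand_of_even {ν x : ℝ} (hx : 0 < x) {f g : ℝ → ℂ} {m : ℕ}
    (h1 : f x = (x : ℂ) ^ m * g x) (h2 : f (-x) = ((-x : ℝ) : ℂ) ^ m * g (-x))
    (hg : g (-x) = g x) {k : ℕ} (hk : Odd (k + m)) :
    g x / ((x ^ ((k : ℝ) - (m : ℝ) + ν + 1) : ℝ) : ℂ) = -(1 / 2) * coeffIntegrand ν f k x := by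
  rw [coeffIntegrand_of_eq_pow_mul hx h1 h2, hk.neg_one_pow, hg]
  ring

theorem hasSum_odd {F : ℕ → ℂ} {S : ℂ} (h : HasSum F S) (h0 : ∀ k, Even k → F k = 0) :
    HasSum (fun k => F (2 * k + 1)) S := by
  have hinj : Function.Injective (fun n : ℕ => 2 * n + 1) := fun a b hab => by
    simp only at hab; omega
  refine (hinj.hasSum_iff fun k hk => h0 k ?_).2 h
  by_contra hodd
  obtain ⟨n, hn⟩ := Nat.not_even_iff_odd.1 hodd
  exact hk ⟨n, hn.symm⟩

/-- The index runs over `1, 3, 5, …` for even `m` and over `0, 2, 4, …` for odd `m`: these are the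
numbers below `m` of parity opposite to `m`. The natural subtraction never truncates. -/
theorem sum_range_eq_sum_range_of_parity {F : ℕ → ℂ} {m : ℕ} (hm : 1 ≤ m)
    (h0 : ∀ k, Even (k + m) → F k = 0) :
    ∑ k ∈ Finset.range ((m - 1) / 2 + 1), F (2 * k + 1 + 2 * (m / 2) - m) =
      ∑ k ∈ Finset.range m, F k := by
  refine Finset.sum_of_injOn (fun k => 2 * k + 1 + 2 * (m / 2) - m) ?_ ?_ ?_ fun _ _ => rfl
  · intro i _ j _ hij
    simp only at hij
    omega
  · intro i hi
    simp only [Finset.coe_range, Set.mem_Iio] at hi ⊢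
    omega
  · intro i hi hni
    refine h0 i ?_
    by_contra hodd
    rw [Nat.not_even_iff_odd, Nat.odd_iff] at hodd
    rw [Finset.mem_range] at hi
    refine hni ⟨(i + m - 1 - 2 * (m / 2)) / 2, ?_, ?_⟩
    · simp only [Finset.coe_range, Set.mem_Iio]
      omega
    · simp only
      omega

theorem singularTerm_congr {ν ω : ℝ} {f g : ℝ → ℂ} (h : f ω = g ω) :
    singularTerm ν f ω = singularTerm ν g ω := by
  rw [singularTerm, singularTerm, h]

/-! ### The four formulas -/

/-- The coefficients are quantified before `ω`, which expresses their independence of it. `HasSum`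
over `ℕ` in `ℂ` is unconditional, hence absolute, convergence. -/
theorem theorem4p4 (ν : ℝ) (hν0 : 0 < ν) (hν1 : ν < 1) (a : ℝ≥0∞) (ha : 0 < a) (f : ℝ → ℂ)
    (hf : ComplexAnalyticOn f (symmInterval a))
    (hPV : a = ∞ → ∀ ω : ℝ, ‖ω‖ₑ < singularityDistance f →
      ∃ L : ℂ, HasPVIntegral (hilbertIntegrand ν f ω) ω ∞ L) :
    -- the general formula
    (∃ c : ℕ → ℂ,
      (∀ k : ℕ, HasFinitePart
        (fun x => ((-1) ^ k * f (-x) - f x) / ((x ^ ((k : ℝ) + ν + 1) : ℝ) : ℂ)) a (c k)) ∧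
      ∀ ω : ℝ, ‖ω‖ₑ < a → ‖ω‖ₑ < singularityDistance f →
        ∃ S : ℂ, HasSum (fun k : ℕ => (ω : ℂ) ^ k * c k) S ∧
          HasPVIntegral (hilbertIntegrand ν f ω) ω a (S + singularTerm ν f ω)) ∧
    -- `f` even
    ((∀ x ∈ symmInterval a, f (-x) = f x) →
      ∃ c : ℕ → ℂ,
        (∀ k : ℕ, HasFinitePart
          (fun x => f x / ((x ^ (2 * (k : ℝ) + ν + 2) : ℝ) : ℂ)) a (c k)) ∧
        ∀ ω : ℝ, ‖ω‖ₑ < a → ‖ω‖ₑ < singularityDistance f →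
          ∃ S : ℂ, HasSum (fun k : ℕ => (ω : ℂ) ^ (2 * k + 1) * c k) S ∧
            HasPVIntegral (hilbertIntegrand ν f ω) ω a (-2 * S + singularTerm ν f ω)) ∧
    -- `f(x) = x ^ m g(x)`
    (∀ (m : ℕ) (g : ℝ → ℂ), 1 ≤ m → ComplexAnalyticOn g (symmInterval a) →
      (∀ x ∈ symmInterval a, f x = (x : ℂ) ^ m * g x) →
      (∃ b c : ℕ → ℂ,
        (∀ k < m, HasConvergentIntegral
          (fun x => ((-1) ^ (k + m) * g (-x) - g x) /
            ((x ^ ((k : ℝ) - (m : ℝ) + ν + 1) : ℝ) : ℂ)) a (b k)) ∧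
        (∀ k : ℕ, HasFinitePart
          (fun x => ((-1) ^ k * g (-x) - g x) / ((x ^ ((k : ℝ) + ν + 1) : ℝ) : ℂ)) a (c k)) ∧
        ∀ ω : ℝ, ‖ω‖ₑ < a → ‖ω‖ₑ < singularityDistance f →
          ∃ S : ℂ, HasSum (fun k : ℕ => (ω : ℂ) ^ (k + m) * c k) S ∧
            HasPVIntegral (hilbertIntegrand ν f ω) ω a
              ((∑ k ∈ Finset.range m, (ω : ℂ) ^ k * b k) + S +
                singularTerm ν (fun x => (x : ℂ) ^ m * g x) ω)) ∧
      -- `f(x) = x ^ m g(x)` with `g` even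
      ((∀ x ∈ symmInterval a, g (-x) = g x) →
        ∃ b c : ℕ → ℂ,
          (∀ k ≤ (m - 1) / 2, HasConvergentIntegral
            (fun x => g x /
              ((x ^ (2 * (k : ℝ) - 2 * (((m - 1) / 2 : ℕ) : ℝ) + ν) : ℝ) : ℂ)) a (b k)) ∧
          (∀ k : ℕ, HasFinitePart
            (fun x => g x / ((x ^ (2 * (k : ℝ) + ν + 2) : ℝ) : ℂ)) a (c k)) ∧
          ∀ ω : ℝ, ‖ω‖ₑ < a → ‖ω‖ₑ < singularityDistance f →
            ∃ S : ℂ, HasSum (fun k : ℕ => (ω : ℂ) ^ (2 * k + m + 1) * c k) S ∧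
              HasPVIntegral (hilbertIntegrand ν f ω) ω a
                (-2 * (∑ k ∈ Finset.range ((m - 1) / 2 + 1),
                    (ω : ℂ) ^ (2 * k + 1 + 2 * (m / 2) - m) * b k) - 2 * S +
                  singularTerm ν (fun x => (x : ℂ) ^ m * g x) ω))) := by
  have hfc := hf.continuousOn
  obtain ⟨al, hal, halm, halp⟩ := exists_taylor_coeff ha hf
  obtain ⟨c, hc, hsum⟩ : ∃ c : ℕ → ℂ, (∀ k, HasTaylorFinitePartTo ν f al k a (c k)) ∧
      ∀ ω : ℝ, ‖ω‖ₑ < a → ‖ω‖ₑ < singularityDistance f →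
        ∃ S : ℂ, HasSum (fun k : ℕ => (ω : ℂ) ^ k * c k) S ∧
          HasPVIntegral (hilbertIntegrand ν f ω) ω a (S + singularTerm ν f ω) := by
    rcases eq_or_ne a ∞ with rfl | hat
    · exact exists_coeff_top hν0 hν1 hf hal (hPV rfl)
    · exact exists_coeff_of_ne_top hν0 hν1 ha hat hf hal
  -- If `f` has the parity of `m`, the numerator `(-1)^k f(-x) - f(x)` vanishes identically for `k`
  -- of that parity.
  have hzero : ∀ m : ℕ, (∀ x ∈ symmInterval a, f (-x) = (-1) ^ m * f x) →
      ∀ k, Even (k + m) → c k = 0 := by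
    intro m hm k hk
    refine (hc k).eq_zero ha (fun j hj => halp m hm j ?_) fun x hx hxa => ?_
    · rw [Nat.odd_iff] at hj ⊢
      rw [Nat.even_iff] at hk
      omega
    · rw [coeffIntegrand, hm x hxa, ← mul_assoc, ← pow_add, hk.neg_one_pow, one_mul, sub_self,
        zero_div]
  refine ⟨⟨c, fun k => ?_, hsum⟩, fun heven => ?_, fun m g hm hg hfg => ⟨?_, fun heven => ?_⟩⟩
  · have := (hc k).hasFinitePart hν0 ha hfc 1 fun x _ _ => (one_mul _).symm
    rwa [one_mul] at this
  -- For even `f` and odd index the numerator is `-2f(x)`, which explains the factor `-1/2`.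
  · refine ⟨fun k => -(1 / 2) * c (2 * k + 1), fun k => ?_, fun ω hωa hωs => ?_⟩
    · refine (hc (2 * k + 1)).hasFinitePart hν0 ha hfc _ fun x hx hxa => ?_
      rw [← coeffIntegrand_of_even (f := f) (g := f) (m := 0) hx (by simp) (by simp) (heven x hxa)
        ⟨k, rfl⟩]
      congr 3
      push_cast
      ring
    · obtain ⟨S, hS, hpv⟩ := hsum ω hωa hωs
      refine ⟨-(1 / 2) * S, ?_, ?_⟩
      · refine hasSum_of_eq ((hasSum_odd hS fun k hk => ?_).mul_left (-(1 / 2))) (fun k => by ring)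
          rfl
        rw [hzero 0 (fun x hx => by rw [pow_zero, one_mul, heven x hx]) k hk, mul_zero]
      · rwa [← mul_assoc, show (-2 : ℂ) * -(1 / 2) = 1 by norm_num, one_mul]
  all_goals
    have hfg' : ∀ x ∈ symmInterval a, f (-x) = ((-x : ℝ) : ℂ) ^ m * g (-x) := fun x hx =>
      hfg (-x) (neg_mem_symmInterval hx)
    have hint : ∀ k < m, ∀ A > 0, (∀ x ∈ Set.Icc (-A) A, x ∈ symmInterval a) →
        IntegrableOn (coeffIntegrand ν f k) (Set.Ioc 0 A) := fun k hk A hA hAa =>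
      integrableOn_coeffIntegrand_of_eq_pow_mul hν1 hA hk (hg.continuousOn.mono hAa)
        fun x hx => hfg x (hAa x hx)
    have halz := halm m g hg hfg
    -- The first `m` terms are the ordinary integrals; in the shifted ones `x^m` cancels and leaves
    -- the coefficients built from `g`.
    have hsplit : ∀ {ω : ℝ} {S : ℂ}, HasSum (fun k : ℕ => (ω : ℂ) ^ k * c k) S →
        HasSum (fun k : ℕ => (ω : ℂ) ^ (k + m) * c (k + m))
          (S - ∑ k ∈ Finset.range m, (ω : ℂ) ^ k * c k) := fun hS =>
      (hasSum_nat_add_iff' m).2 hS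
    have hsing : ∀ ω : ℝ, ‖ω‖ₑ < a →
        singularTerm ν (fun x => (x : ℂ) ^ m * g x) ω = singularTerm ν f ω := fun ω hω =>
      singularTerm_congr (hfg ω hω.le).symm
  · refine ⟨c, fun k => c (k + m), fun k hk => ?_, fun k => ?_, fun ω hωa hωs => ?_⟩
    · have := (hc k).hasConvergentIntegral ha (fun j hj => halz j (by omega)) (hint k hk) 1
        fun x hx hxa => by
          rw [one_mul, coeffIntegrand_of_eq_pow_mul hx (hfg x hxa) (hfg' x hxa)]
      rwa [one_mul] at this
    · have := (hc (k + m)).hasFinitePart hν0 ha hfc 1 fun x hx hxa => by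
        rw [one_mul, coeffIntegrand_of_eq_pow_mul hx (hfg x hxa) (hfg' x hxa)]
      rw [one_mul] at this
      convert this using 2 with x
      have e : (-1 : ℂ) ^ (k + m + m) = (-1) ^ k := by
        rw [add_assoc, pow_add, ← two_mul, pow_mul]; simp
      rw [e]
      congr 3
      push_cast
      ring
    · obtain ⟨S, hS, hpv⟩ := hsum ω hωa hωs
      refine ⟨_, hsplit hS, ?_⟩
      rwa [add_sub_cancel, hsing ω hωa]
  · have hpar : ∀ x ∈ symmInterval a, f (-x) = (-1) ^ m * f x := fun x hx => by
      rw [hfg' x hx, hfg x hx, heven x hx, Complex.ofReal_neg, neg_pow, mul_assoc]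
    refine ⟨fun k => -(1 / 2) * c (2 * k + 1 + 2 * (m / 2) - m),
      fun k => -(1 / 2) * c (2 * k + 1 + m), fun k hk => ?_, fun k => ?_, fun ω hωa hωs => ?_⟩
    · refine (hc _).hasConvergentIntegral ha (fun j hj => halz j (by omega)) (hint _ (by omega)) _
        fun x hx hxa => ?_
      rw [← coeffIntegrand_of_even hx (hfg x hxa) (hfg' x hxa) (heven x hxa)
        (by rw [Nat.odd_iff]; omega)]
      congr 3
      -- This uses `⌊m/2⌋ + ⌊(m-1)/2⌋ + 1 = m`, which reconciles the exponent of `x` with the index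
      -- of the coefficient.
      have e : ((2 * k + 1 + 2 * (m / 2) - m : ℕ) : ℝ) + 2 * ((m - 1) / 2 : ℕ) + 1 =
          2 * k + m := by
        have : (2 * k + 1 + 2 * (m / 2) - m) + 2 * ((m - 1) / 2) + 1 = 2 * k + m := by omega
        exact_mod_cast this
      linarith
    · refine (hc (2 * k + 1 + m)).hasFinitePart hν0 ha hfc _ fun x hx hxa => ?_
      rw [← coeffIntegrand_of_even hx (hfg x hxa) (hfg' x hxa) (heven x hxa)
        (by rw [Nat.odd_iff]; omega)]
      congr 3
      push_cast
      ring
    · obtain ⟨S, hS, hpv⟩ := hsum ω hωa hωs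
      refine ⟨_, hasSum_of_eq ((hasSum_odd (hsplit hS) fun k hk => ?_).mul_left (-(1 / 2)))
        (fun k => by ring) rfl, ?_⟩
      · rw [hzero m hpar (k + m) (by rw [Nat.even_iff] at hk ⊢; omega), mul_zero]
      · have e := sum_range_eq_sum_range_of_parity (F := fun k => (ω : ℂ) ^ k * c k) hm
          fun k hk => by rw [hzero m hpar k hk, mul_zero]
        have e' : ∑ k ∈ Finset.range ((m - 1) / 2 + 1), (ω : ℂ) ^ (2 * k + 1 + 2 * (m / 2) - m) *
            (-(1 / 2) * c (2 * k + 1 + 2 * (m / 2) - m)) =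
            -(1 / 2) * ∑ k ∈ Finset.range m, (ω : ℂ) ^ k * c k := by
          rw [← e, Finset.mul_sum]
          exact Finset.sum_congr rfl fun k _ => by ring
        rw [e', hsing ω hωa]
        convert hpv using 1
        ring
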